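/- Let $\alpha \ge 1$ and $\beta \ge 0$ be real numbers. All graphs are finite, simple and undirected, with unit edge lengths. A spanning subgraph $H$ of a graph $G=(V,E)$ is an $(\alpha,\beta)$-spanner of $G$ if for all $u,v\in V$ either $\mathrm{dist}_G(u,v)=\infty$ or $\mathrm{dist}_H(u,v)\le \alpha\cdot \mathrm{dist}_G(u,v)+\beta$. In the Parameterized Minimum $(\alpha,\beta)$-Spanner Problem one is given a graph $G=(V,E)$ and a positive integer $k$ (the parameter), and has to find a set $E'\subseteq E$ with $|E'|\ge k$ such that $(V,E\setminus E')$ is an $(\alpha,\beta)$-spanner of $G$, or to conclude that no such $E'$ exists. Theorem. There is a fixed-parameter algorithm for this problem that runs in $(\alpha+\beta)^{O(k^2+(\alpha+\beta)k)}\,|V||E|$ time. Precisely: there are absolute constants $c, C$ and a single word-RAM program (independent of $\alpha,\beta,G,k$) such that for all reals $\alpha\ge 1$, $\beta\ge 0$, every graph $G$ given by $|V|$, $|E|$ and a list of its edges, every $k\ge 1$ and every word length $w \ge c\log_2(|V|+|E|+k+2)$, the program halts with a correct answer after at most $$C\,(\alpha+\beta)^{C(k^2+(\alpha+\beta)k)}\,(|V||E|+1)$$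 steps without overflow. Here the usual operations on words take one step each, and $\alpha$ and $\beta$ are accessed only through unit-cost tests "$x\le\alpha y+\beta$?" for words $x,y$. -/

import Mathlib

/-! ## Spanners and the parameterized problem -/

namespace Spanner

/-- `H` is an `(α, β)`-spanner of `G`: a spanning subgraph of `G` such that, for any vertices
`u` and `v`, either `dist_G(u, v) = ∞` or `dist_H(u, v) ≤ α * dist_G(u, v) + β`
(in particular `dist_H(u, v) < ∞` in the second case). -/
def IsSpanner {V : Type*} (α β : ℝ) (G H : SimpleGraph V) : Prop :=
  H ≤ G ∧ ∀ u v : V, G.Reachable u v →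
    H.Reachable u v ∧ (H.dist u v : ℝ) ≤ α * (G.dist u v : ℝ) + β

/-- `E'` is a solution of the instance `G` with parameter `k`: a set of at least `k` edges
of `G` whose removal leaves an `(α, β)`-spanner of `G`. -/
def IsSolution {V : Type*} (α β : ℝ) (G : SimpleGraph V) (k : ℕ) (E' : Set (Sym2 V)) : Prop :=
  E' ⊆ G.edgeSet ∧ k ≤ E'.ncard ∧ IsSpanner α β G (G.deleteEdges E')

/-- `e` lists the edges of `G`, each of them exactly once, in an arbitrary order and with
arbitrarily ordered endpoints. So `m` is the number of edges of `G`. -/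
def IsEdgeListing {n m : ℕ} (G : SimpleGraph (Fin n)) (e : Fin m → Fin n × Fin n) : Prop :=
  Function.Injective (fun i => s((e i).1, (e i).2)) ∧
    Set.range (fun i => s((e i).1, (e i).2)) = G.edgeSet

end Spanner

/-! ## Word RAM programs with a step count

A machine has registers and arrays (a program mentions only finitely many of either). Registers
and array cells hold words, i.e. natural numbers below `W`. The real numbers `α` and `β` are
accessible only through tests `x ≤ α * y + β` for words `x` and `y`. -/

namespace WordRAM

/-- An operand: a constant or the content of a register. -/
inductive Operand where
  | const (c : ℕ)
  | reg (r : ℕ)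

/-- Arithmetic on words. -/
inductive Arith where
  | add
  | sub
  | mul
  | div

/-- Conditions for branching and looping. -/
inductive Test where
  | le (x y : Operand)
  | eq (x y : Operand)
  /-- the test `x ≤ α * y + β` -/
  | stretch (x y : Operand)

/-- Programs. -/
inductive Prog where
  | skip
  /-- `R[r] := x` -/
  | set (r : ℕ) (x : Operand)
  /-- `R[r] := x op y` -/
  | arith (op : Arith) (r : ℕ) (x y : Operand)
  /-- `R[r] := A_a[x]` -/
  | load (r a : ℕ) (x : Operand)
  /-- `A_a[x] := y` -/
  | store (a : ℕ) (x y : Operand)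
  | seq (p q : Prog)
  | ite (b : Test) (p q : Prog)
  | loop (b : Test) (p : Prog)

/-- The contents of the registers and of the arrays. -/
structure State where
  reg : ℕ → ℕ
  arr : ℕ → ℕ → ℕ

/-- The value of an operand. -/
def Operand.val (s : State) : Operand → ℕ
  | .const c => c
  | .reg r => s.reg r

/-- The result of an operation; subtraction is truncated at `0`, division rounds down. -/
def Arith.eval : Arith → ℕ → ℕ → ℕ
  | .add, x, y => x + y
  | .sub, x, y => x - y
  | .mul, x, y => x * y
  | .div, x, y => x / y

/-- The truth of a test. -/
def Test.Holds (α β : ℝ) (s : State) : Test → Prop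
  | .le x y => x.val s ≤ y.val s
  | .eq x y => x.val s = y.val s
  | .stretch x y => (x.val s : ℝ) ≤ α * (y.val s : ℝ) + β

/-- Write `v` into register `r`. -/
def State.setReg (s : State) (r v : ℕ) : State :=
  { s with reg := Function.update s.reg r v }

/-- Write `v` into cell `i` of array `a`. -/
def State.setArr (s : State) (a i v : ℕ) : State :=
  { s with arr := Function.update s.arr a (Function.update (s.arr a) i v) }

/-- `Exec W α β p s T s'`: started in state `s`, the program `p` halts in state `s'` after
exactly `T` steps. Every elementary instruction and every evaluation of a test is one step. An
instruction that would write a number that is not a word, or use such a number as an address,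
has no execution, so that an overflow is a failure of the program. -/
inductive Exec (W : ℕ) (α β : ℝ) : Prog → State → ℕ → State → Prop
  | skip (s : State) : Exec W α β .skip s 1 s
  | set (s : State) (r : ℕ) (x : Operand) (hx : x.val s < W) :
      Exec W α β (.set r x) s 1 (s.setReg r (x.val s))
  | arith (s : State) (op : Arith) (r : ℕ) (x y : Operand)
      (h : op.eval (x.val s) (y.val s) < W) :
      Exec W α β (.arith op r x y) s 1 (s.setReg r (op.eval (x.val s) (y.val s)))
  | load (s : State) (r a : ℕ) (x : Operand) (hx : x.val s < W) :
      Exec W α β (.load r a x) s 1 (s.setReg r (s.arr a (x.val s)))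
  | store (s : State) (a : ℕ) (x y : Operand) (hx : x.val s < W) (hy : y.val s < W) :
      Exec W α β (.store a x y) s 1 (s.setArr a (x.val s) (y.val s))
  | seq {s s' s'' : State} {p q : Prog} {T T' : ℕ}
      (hp : Exec W α β p s T s') (hq : Exec W α β q s' T' s'') :
      Exec W α β (.seq p q) s (T + T') s''
  | ite_true {s s' : State} {b : Test} {p q : Prog} {T : ℕ}
      (hb : b.Holds α β s) (hp : Exec W α β p s T s') :
      Exec W α β (.ite b p q) s (1 + T) s'
  | ite_false {s s' : State} {b : Test} {p q : Prog} {T : ℕ}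
      (hb : ¬ b.Holds α β s) (hq : Exec W α β q s T s') :
      Exec W α β (.ite b p q) s (1 + T) s'
  | loop_true {s s' s'' : State} {b : Test} {p : Prog} {T T' : ℕ}
      (hb : b.Holds α β s) (hp : Exec W α β p s T s')
      (hl : Exec W α β (.loop b p) s' T' s'') :
      Exec W α β (.loop b p) s (1 + T + T') s''
  | loop_false {s : State} {b : Test} {p : Prog} (hb : ¬ b.Holds α β s) :
      Exec W α β (.loop b p) s 1 s

/-- The initial state: the numbers `n` of vertices and `m` of edges and the parameter `k` in
registers `0`, `1`, `2`, the endpoints of the `i`-th edge in cell `i` of the arrays `0` and `1`,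
and `0` everywhere else. -/
def input {n m : ℕ} (e : Fin m → Fin n × Fin n) (k : ℕ) : State where
  reg r := if r = 0 then n else if r = 1 then m else if r = 2 then k else 0
  arr a i :=
    if h : i < m then
      if a = 0 then ((e ⟨i, h⟩).1 : ℕ) else if a = 1 then ((e ⟨i, h⟩).2 : ℕ) else 0
    else 0

/-- The edge set marked by the final state: the `i`-th edge belongs to it if cell `i` of
array `2` is not `0`. -/
def markedEdges {n m : ℕ} (e : Fin m → Fin n × Fin n) (s : State) : Set (Sym2 (Fin n)) :=
  {x | ∃ i : Fin m, s.arr 2 i ≠ 0 ∧ s((e i).1, (e i).2) = x}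

/-- The final state `s` is a correct answer: either register `0` holds `1` and the marked edges
form a solution, or register `0` holds `0` and there is no solution. -/
def IsCorrectAnswer (α β : ℝ) {n m : ℕ} (G : SimpleGraph (Fin n)) (e : Fin m → Fin n × Fin n)
    (k : ℕ) (s : State) : Prop :=
  (s.reg 0 = 1 ∧ Spanner.IsSolution α β G k (markedEdges e s)) ∨
    (s.reg 0 = 0 ∧ ¬ ∃ E' : Set (Sym2 (Fin n)), Spanner.IsSolution α β G k E')

end WordRAM

/-!
Put `D = ⌊α + β⌋`. A deleted edge of a spanner has a detour of length at most `D`, so it lies on a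
closed trail of length at most `D + 1`, a short circuit. The algorithm collects short circuits. It
keeps the union `E` of their edge sets in a list and, whenever the list has grown, tries all
`k`-tuples of edges of `E`.

*Why the list stays short* (`card_biUnion_le_unionBound`). Suppose that no `k` edges of `E` can be
removed. If `E` contained many pairwise edge-disjoint short circuits, then a solution could be built
from them (`exists_spanner_of_disjoint`): one edge is chosen on each of `k` of the circuits in such
a way that its detour leads through a vertex `z` of the circuit, the hub, and that the paths to `z`
from the ends of the edges chosen before avoid all other chosen edges (`exists_greedy_choice`). A
shortest path that meets several deleted edges can then be rerouted through the hub of the one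
chosen last, at an additive cost of at most `D - 1`, which is within `α * dist + β` for distinct
vertices (`dist_deleteEdges_of_hubs`). The greedy choice needs that no tree path meets too many of
the circuits; if one does, then the circuits along this path, at sufficiently large gaps, serve
instead, with hubs on the path. So a maximal family of disjoint circuits is small, and all circuits
of `E` meet its vertices. Moreover, few edges of `E` lie on circuits through a given vertex `x`
(`card_edges_on_circuits_le`): edges outside of a breadth-first search tree `T` with root `x` whose
ends have total distance at most `D` from `x` can be removed all at once, because the detours in `T`
through `x` are short enough (`IsBFSTree.isSpanner_deleteEdges`), hence there are fewer than `k` of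
them, and the tree edges on circuits through `x` are on the tree paths from their ends to `x`.

*Why the list suffices* (`IsBFSTree.mem_of_captured`). For each root `x`, the algorithm closes up to
`k` edges outside of `T` to circuits along tree paths. If there are `k` of them, they form a
solution. Otherwise, every edge `f` at `x` on a short circuit is collected: if `f` belongs to `T`,
then its circuit contains an edge `g` outside of `T` that leaves the set of descendants of `f`, and
the circuit that closes `g` along the tree has to return into this set through `f`. After all
vertices have served as roots, `E` contains every edge on a short circuit, hence all solutions of
size `k`.

*Running time*. All searches scan the edge list in rounds, `min D n` of them when circuits are
collected, and `n` of them when a candidate is tested. The length of the list is at most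
`D ^ (23 * k)` (`lengthBound_le`), so that there are `D ^ O(k ^ 2)` candidates for each of the
`D ^ O(k)` lists. A candidate is tested only at the ends of its edges, which is enough by
`isSpanner_of_endpoints`. The tuples are enumerated digit by digit, since their numbers need not
be words.
-/


/-! ### Walks that avoid a set of edges -/

namespace Spanner

open SimpleGraph

variable {V : Type*} {G : SimpleGraph V}

/-- There is a walk of length at most `L` from `u` to `v` that avoids the edges in `F`. -/
def AvoidWalk (G : SimpleGraph V) (F : Set (Sym2 V)) (L : ℕ) (u v : V) : Prop :=
  ∃ p : G.Walk u v, p.length ≤ L ∧ ∀ e ∈ p.edges, e ∉ F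

theorem AvoidWalk.trans {F : Set (Sym2 V)} {L L' : ℕ} {u v w : V} (h : AvoidWalk G F L u v)
    (h' : AvoidWalk G F L' v w) : AvoidWalk G F (L + L') u w := by
  obtain ⟨p, hp, hpF⟩ := h
  obtain ⟨q, hq, hqF⟩ := h'
  refine ⟨p.append q, by rw [Walk.length_append]; omega, fun e he => ?_⟩
  rw [Walk.edges_append, List.mem_append] at he
  exact he.elim (hpF e) (hqF e)

theorem AvoidWalk.symm {F : Set (Sym2 V)} {L : ℕ} {u v : V} (h : AvoidWalk G F L u v) :
    AvoidWalk G F L v u := by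
  obtain ⟨p, hp, hpF⟩ := h
  exact ⟨p.reverse, by simpa using hp, fun e he => hpF e (by simpa using he)⟩

theorem AvoidWalk.mono {F : Set (Sym2 V)} {L L' : ℕ} {u v : V} (h : AvoidWalk G F L u v)
    (hL : L ≤ L') : AvoidWalk G F L' u v := by
  obtain ⟨p, hp, hpF⟩ := h
  exact ⟨p, hp.trans hL, hpF⟩

theorem AvoidWalk.reachable {F : Set (Sym2 V)} {L : ℕ} {u v : V} (h : AvoidWalk G F L u v) :
    (G.deleteEdges F).Reachable u v := by
  obtain ⟨p, hp, hpF⟩ := h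
  exact ⟨p.toDeleteEdges F hpF⟩

theorem AvoidWalk.dist_le {F : Set (Sym2 V)} {L : ℕ} {u v : V} (h : AvoidWalk G F L u v) :
    (G.deleteEdges F).dist u v ≤ L := by
  obtain ⟨p, hp, hpF⟩ := h
  refine (SimpleGraph.dist_le (p.toDeleteEdges F hpF)).trans ?_
  rwa [Walk.toDeleteEdges, Walk.length_transfer]

theorem avoidWalk_of_reachable {F : Set (Sym2 V)} {u v : V}
    (h : (G.deleteEdges F).Reachable u v) :
    AvoidWalk G F ((G.deleteEdges F).dist u v) u v := by
  obtain ⟨p, hp⟩ := h.exists_walk_length_eq_dist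
  refine ⟨p.mapLe (G.deleteEdges_le F), by simp [hp], fun e he heF => ?_⟩
  rw [Walk.edges_mapLe_eq_edges] at he
  have := p.edges_subset_edgeSet he
  rw [edgeSet_deleteEdges] at this
  exact this.2 heF

/-- A walk that uses an edge of `F` splits at its first edge in `F`. -/
theorem exists_first_edge (F : Set (Sym2 V)) {u v : V} (P : G.Walk u v)
    (h : ∃ e ∈ P.edges, e ∈ F) :
    ∃ (a b : V) (P₁ : G.Walk u a) (hab : G.Adj a b) (P₂ : G.Walk b v),
      P = P₁.append (.cons hab P₂) ∧ s(a, b) ∈ F ∧ ∀ e ∈ P₁.edges, e ∉ F := by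
  induction P with
  | nil => simp at h
  | @cons u w v huw P ih =>
    by_cases hF : s(u, w) ∈ F
    · exact ⟨u, w, .nil, huw, P, rfl, hF, by simp⟩
    · obtain ⟨a, b, P₁, hab, P₂, rfl, h1, h2⟩ := ih (by
        obtain ⟨e, he, heF⟩ := h
        rw [Walk.edges_cons, List.mem_cons] at he
        rcases he with rfl | he
        · exact absurd heF hF
        · exact ⟨e, he, heF⟩)
      refine ⟨a, b, .cons huw P₁, hab, P₂, rfl, h1, fun e he => ?_⟩
      rw [Walk.edges_cons, List.mem_cons] at he
      rcases he with rfl | he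
      · exact hF
      · exact h2 e he

/-- The part of a walk between the first and the last vertex at which it uses edges of `F`. -/
theorem exists_first_last (F : Set (Sym2 V)) {u v : V} (P : G.Walk u v)
    (h : ∃ e ∈ P.edges, e ∈ F) :
    ∃ (a d : V) (l₁ l₂ : ℕ) (Q : G.Walk a d), AvoidWalk G F l₁ u a ∧ AvoidWalk G F l₂ d v ∧
      l₁ + Q.length + l₂ = P.length ∧ (∃ e ∈ F, a ∈ e) ∧ (∃ e ∈ F, d ∈ e) := by
  obtain ⟨a, b, P₁, hab, P₂, rfl, h1, h2⟩ := exists_first_edge F P h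
  by_cases h3 : ∃ e ∈ P₂.reverse.edges, e ∈ F
  · obtain ⟨d, c, Q₁, hdc, Q₂, hQ, h4, h5⟩ := exists_first_edge F _ h3
    have hlen : P₂.length = Q₁.length + (Q₂.length + 1) := by
      rw [← Walk.length_reverse, hQ]; simp
    refine ⟨a, d, P₁.length, Q₁.length, .cons hab (Q₂.reverse.concat hdc.symm),
      ⟨P₁, le_rfl, h2⟩, AvoidWalk.symm ⟨Q₁, le_rfl, h5⟩, ?_, ⟨_, h1, by simp⟩,
      ⟨_, h4, by simp⟩⟩
    simp [hlen]; ring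
  · push Not at h3
    refine ⟨a, b, P₁.length, P₂.length, .cons hab .nil, ⟨P₁, le_rfl, h2⟩,
      ⟨P₂, le_rfl, fun e he => h3 e (by simpa using he)⟩, ?_, ⟨_, h1, by simp⟩, ⟨_, h1, by simp⟩⟩
    simp; ring

/-- It suffices to check the stretch between endpoints of deleted edges: on a shortest walk, only
the part from the first to the last deleted edge has to be replaced. -/
theorem isSpanner_of_endpoints {α β : ℝ} (hα : 1 ≤ α) (hβ : 0 ≤ β) {F : Set (Sym2 V)}
    (h : ∀ a d : V, (∃ e ∈ F, a ∈ e) → (∃ e ∈ F, d ∈ e) → G.Reachable a d →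
      (G.deleteEdges F).Reachable a d ∧
        ((G.deleteEdges F).dist a d : ℝ) ≤ α * (G.dist a d : ℝ) + β) :
    IsSpanner α β G (G.deleteEdges F) := by
  refine ⟨G.deleteEdges_le F, fun u v huv => ?_⟩
  obtain ⟨P, hP⟩ := huv.exists_walk_length_eq_dist
  by_cases hF : ∃ e ∈ P.edges, e ∈ F
  · obtain ⟨a, d, l₁, l₂, Q, h1, h2, hl, ha, hd⟩ := exists_first_last F P hF
    obtain ⟨hr, hs⟩ := h a d ha hd ⟨Q⟩
    have hw := (h1.trans (avoidWalk_of_reachable hr)).trans h2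
    refine ⟨hw.reachable, ?_⟩
    have h3 : ((G.deleteEdges F).dist u v : ℝ) ≤ l₁ + (G.deleteEdges F).dist a d + l₂ := by
      exact_mod_cast hw.dist_le
    have h4 : (G.dist a d : ℝ) ≤ Q.length := by exact_mod_cast SimpleGraph.dist_le Q
    have h5 : (G.dist u v : ℝ) = l₁ + Q.length + l₂ := by rw [← hP, ← hl]; push_cast; ring
    have h6 : (0 : ℝ) ≤ l₁ := by positivity
    have h7 : (0 : ℝ) ≤ l₂ := by positivity
    rw [h5]
    nlinarith
  · push Not at hF
    have hw : AvoidWalk G F P.length u v := ⟨P, le_rfl, hF⟩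
    refine ⟨hw.reachable, ?_⟩
    have h3 : ((G.deleteEdges F).dist u v : ℝ) ≤ G.dist u v := by
      rw [← hP]; exact_mod_cast hw.dist_le
    have h4 : (0 : ℝ) ≤ G.dist u v := by positivity
    nlinarith

/-- If a distance `d ≥ 1` grows by at most `D - 1`, where `D ≤ α + β`, then the new distance `h`
is within the allowed stretch. -/
theorem stretch_of_add_le {α β : ℝ} (hα : 1 ≤ α) {D d h : ℕ} (hD : (D : ℝ) ≤ α + β)
    (hd : 1 ≤ d) (hh : h + 1 ≤ d + D) : (h : ℝ) ≤ α * d + β := by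
  have h1 : (h : ℝ) + 1 ≤ d + D := by exact_mod_cast hh
  have h2 : (1 : ℝ) ≤ d := by exact_mod_cast hd
  nlinarith

/-- Deleting fewer edges keeps a spanner a spanner. -/
theorem IsSpanner.mono {α β : ℝ} {F F' : Set (Sym2 V)} (h : F' ⊆ F)
    (hF : IsSpanner α β G (G.deleteEdges F)) : IsSpanner α β G (G.deleteEdges F') := by
  refine ⟨G.deleteEdges_le F', fun u v huv => ?_⟩
  obtain ⟨h1, h2⟩ := hF.2 u v huv
  have hle : G.deleteEdges F ≤ G.deleteEdges F' := deleteEdges_anti h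
  refine ⟨h1.mono hle, le_trans ?_ h2⟩
  exact_mod_cast h1.dist_anti hle

/-! ### Breadth-first search trees -/

/-- `par` is the parent function of a breadth-first search tree of the component of `y`, with
root `y`. Its values at `y` and outside of the component of `y` are irrelevant. -/
def IsBFSTree (G : SimpleGraph V) (y : V) (par : V → V) : Prop :=
  ∀ v, G.Reachable y v → v ≠ y → G.Adj v (par v) ∧ G.dist y (par v) + 1 = G.dist y v

/-- The edges of a breadth-first search tree. -/
def treeEdges (G : SimpleGraph V) (y : V) (par : V → V) : Set (Sym2 V) :=
  {e | ∃ v, G.Reachable y v ∧ v ≠ y ∧ e = s(v, par v)}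

theorem exists_closer_neighbor {y v : V} (hv : G.Reachable y v) (hne : v ≠ y) :
    ∃ w, G.Adj v w ∧ G.dist y w + 1 = G.dist y v := by
  obtain ⟨p, hp⟩ := hv.symm.exists_walk_length_eq_dist
  cases p with
  | nil => exact absurd rfl hne
  | @cons _ w _ hvw p =>
    refine ⟨w, hvw, ?_⟩
    rw [Walk.length_cons, dist_comm] at hp
    have h1 := SimpleGraph.dist_le p
    have h2 := (hvw.symm.reachable.dist_triangle_right y)
    rw [dist_eq_one_iff_adj.2 hvw.symm] at h2
    rw [dist_comm] at h1
    omega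

/-- A partial breadth-first search tree extends to a full one. -/
theorem exists_isBFSTree_extending (y : V) (S : Set V) (par₀ : V → V)
    (h : ∀ v ∈ S, v ≠ y → G.Adj v (par₀ v) ∧ G.dist y (par₀ v) + 1 = G.dist y v) :
    ∃ par, IsBFSTree G y par ∧ ∀ v ∈ S, par v = par₀ v := by
  classical
  refine ⟨fun v => if hv : v ∈ S then par₀ v else
    if h : G.Reachable y v ∧ v ≠ y then (exists_closer_neighbor h.1 h.2).choose else v, ?_, ?_⟩
  · intro v hv hne
    by_cases hS : v ∈ S
    · simpa [hS] using h v hS hne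
    · have := (exists_closer_neighbor hv hne).choose_spec
      simpa [hS, hv, hne] using this
  · intro v hv
    simp [hv]

theorem IsBFSTree.reachable_par {y : V} {par : V → V} (hT : IsBFSTree G y par) {v : V}
    (hv : G.Reachable y v) (hne : v ≠ y) : G.Reachable y (par v) :=
  hv.trans (hT v hv hne).1.reachable

/-- The tree path from `v` to the root. -/
theorem IsBFSTree.exists_walk {y : V} {par : V → V} (hT : IsBFSTree G y par) {v : V}
    (hv : G.Reachable y v) :
    ∃ p : G.Walk v y, p.length = G.dist y v ∧ ∀ e ∈ p.edges, e ∈ treeEdges G y par := by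
  induction hd : G.dist y v generalizing v with
  | zero =>
    obtain rfl := (hv.dist_eq_zero_iff).1 hd
    exact ⟨.nil, by simp, by simp⟩
  | succ d ih =>
    have hne : v ≠ y := by rintro rfl; simp at hd
    obtain ⟨h1, h2⟩ := hT v hv hne
    obtain ⟨p, hp, hpe⟩ := ih (hT.reachable_par hv hne) (by omega)
    refine ⟨.cons h1 p, by simp [hp], fun e he => ?_⟩
    rw [Walk.edges_cons, List.mem_cons] at he
    rcases he with rfl | he
    · exact ⟨v, hv, hne, rfl⟩
    · exact hpe e he

/-- `Desc y par w v`: the vertex `v` is a descendant of `w`, or equal to `w`, in the tree `par`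
with root `y`. -/
inductive Desc (y : V) (par : V → V) (w : V) : V → Prop
  | refl : Desc y par w w
  | step {v : V} (hv : v ≠ y) (h : Desc y par w (par v)) : Desc y par w v

theorem desc_par_iff {y : V} {par : V → V} {w v : V} (hv : v ≠ y) (hw : v ≠ w) :
    Desc y par w (par v) ↔ Desc y par w v := by
  refine ⟨Desc.step hv, fun h => ?_⟩
  cases h with
  | refl => exact absurd rfl hw
  | step _ h => exact h

theorem IsBFSTree.dist_le_of_desc {y : V} {par : V → V} (hT : IsBFSTree G y par) {w v : V}
    (h : Desc y par w v) (hv : G.Reachable y v) : G.dist y w ≤ G.dist y v := by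
  induction h with
  | refl => rfl
  | step hne h ih =>
    have := ih (hT.reachable_par hv hne)
    have := (hT _ hv hne).2
    omega

theorem IsBFSTree.not_desc_par {y : V} {par : V → V} (hT : IsBFSTree G y par) {w : V}
    (hw : G.Reachable y w) (hne : w ≠ y) : ¬ Desc y par w (par w) := by
  intro h
  have h1 := hT.dist_le_of_desc h (hT.reachable_par hw hne)
  have h2 := (hT w hw hne).2
  omega

/-- A descendant climbs to its ancestor in a bounded number of steps. -/
theorem IsBFSTree.exists_iterate_of_desc {y : V} {par : V → V} (hT : IsBFSTree G y par) {w v : V}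
    (h : Desc y par w v) (hv : G.Reachable y v) : ∃ j ≤ G.dist y v, par^[j] v = w := by
  induction h with
  | refl => exact ⟨0, by simp, rfl⟩
  | step hne h ih =>
    obtain ⟨j, hj, hw⟩ := ih (hT.reachable_par hv hne)
    have := (hT _ hv hne).2
    exact ⟨j + 1, by omega, by simpa using hw⟩

/-- The only tree edge between the descendants of `w` and the other vertices is the one from `w`
to its parent. -/
theorem eq_of_mem_treeEdges_of_desc {y : V} {par : V → V} {w a b : V}
    (he : s(a, b) ∈ treeEdges G y par) (ha : Desc y par w a) (hb : ¬ Desc y par w b) :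
    s(a, b) = s(w, par w) := by
  obtain ⟨v, hv, hne, h⟩ := he
  by_cases hvw : v = w
  · rw [h, hvw]
  · have := desc_par_iff (par := par) hne hvw
    rw [Sym2.eq_iff] at h
    rcases h with ⟨rfl, rfl⟩ | ⟨rfl, rfl⟩ <;> tauto

/-! ### Closed trails -/

/-- `C` is the edge set of a closed trail of length between `1` and `D + 1`. -/
def IsShortCircuit (G : SimpleGraph V) (D : ℕ) (C : Finset (Sym2 V)) : Prop :=
  ∃ (v : V) (c : G.Walk v v), c.IsTrail ∧ 0 < c.length ∧ c.length ≤ D + 1 ∧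
    ∀ e, e ∈ C ↔ e ∈ c.edges

theorem IsShortCircuit.subset_edgeSet {D : ℕ} {C : Finset (Sym2 V)} (hC : IsShortCircuit G D C)
    {e : Sym2 V} (he : e ∈ C) : e ∈ G.edgeSet := by
  obtain ⟨v, c, -, -, -, h⟩ := hC
  exact c.edges_subset_edgeSet ((h e).1 he)

theorem IsShortCircuit.nonempty {D : ℕ} {C : Finset (Sym2 V)} (hC : IsShortCircuit G D C) :
    C.Nonempty := by
  obtain ⟨v, c, -, h0, -, h⟩ := hC
  rw [← Walk.length_edges] at h0
  obtain ⟨e, he⟩ := List.exists_mem_of_length_pos h0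
  exact ⟨e, (h e).2 he⟩

theorem IsShortCircuit.card_le {D : ℕ} {C : Finset (Sym2 V)} (hC : IsShortCircuit G D C) :
    C.card ≤ D + 1 := by
  classical
  obtain ⟨v, c, -, -, h1, h⟩ := hC
  have : C = c.edges.toFinset := by ext e; simp [h]
  rw [this]
  exact (List.toFinset_card_le _).trans (by simpa using h1)

/-- Deleting an edge `ab` from a closed trail leaves a detour from `a` to `b` through any given
vertex `z` of the trail. -/
theorem IsShortCircuit.exists_detour {D : ℕ} {C : Finset (Sym2 V)} (hC : IsShortCircuit G D C)
    {z a b : V} (hz : ∃ e ∈ C, z ∈ e) (hab : s(a, b) ∈ C) :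
    ∃ (p : G.Walk a z) (q : G.Walk z b), p.length + q.length ≤ D ∧
      (∀ e ∈ p.edges, e ∈ C ∧ e ≠ s(a, b)) ∧ (∀ e ∈ q.edges, e ∈ C ∧ e ≠ s(a, b)) := by
  classical
  obtain ⟨v, c, ht, h0, h1, h⟩ := hC
  obtain ⟨e, he, hze⟩ := hz
  have hzs : z ∈ c.support := by
    obtain ⟨z', rfl⟩ := Sym2.mem_iff_exists.1 hze
    exact c.fst_mem_support_of_mem_edges ((h _).1 he)
  have hmem : ∀ e, e ∈ (c.rotate z hzs).edges ↔ e ∈ C := fun e => by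
    rw [h, (c.rotate_edges z hzs).mem_iff]
  have hlen : (c.rotate z hzs).length ≤ D + 1 := by simpa using h1
  have htr := ht.rotate hzs
  generalize c.rotate z hzs = c' at hmem hlen htr
  obtain ⟨x, y, P₁, hxy, P₂, rfl, hF, -⟩ := exists_first_edge {s(a, b)} c'
    ⟨_, (hmem _).2 hab, rfl⟩
  rw [Walk.isTrail_def, Walk.edges_append, Walk.edges_cons, List.nodup_append] at htr
  obtain ⟨-, htr2, htr3⟩ := htr
  rw [List.nodup_cons] at htr2
  simp only [Walk.length_append, Walk.length_cons] at hlen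
  simp only [Walk.edges_append, Walk.edges_cons, List.mem_append, List.mem_cons] at hmem
  have hP1 : ∀ e ∈ P₁.edges, e ∈ C ∧ e ≠ s(x, y) := fun e he =>
    ⟨(hmem e).1 (.inl he), htr3 e he _ (by simp)⟩
  have hP2 : ∀ e ∈ P₂.edges, e ∈ C ∧ e ≠ s(x, y) := fun e he =>
    ⟨(hmem e).1 (.inr (.inr he)), fun h => htr2.1 (h ▸ he)⟩
  rw [Set.mem_singleton_iff] at hF
  rw [hF] at hP1 hP2
  rw [Sym2.eq_iff] at hF
  rcases hF with ⟨rfl, rfl⟩ | ⟨rfl, rfl⟩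
  · exact ⟨P₁.reverse, P₂.reverse, by simp; omega, by simpa using hP1, by simpa using hP2⟩
  · exact ⟨P₂, P₁, by omega, hP2, hP1⟩

/-- A closed trail that crosses a cut crosses it at least twice. -/
theorem IsShortCircuit.exists_other_crossing {D : ℕ} {C : Finset (Sym2 V)}
    (hC : IsShortCircuit G D C) {S : Set V} {a b : V} (hab : s(a, b) ∈ C) (ha : a ∈ S)
    (hb : b ∉ S) : ∃ c d, s(c, d) ∈ C ∧ s(c, d) ≠ s(a, b) ∧ c ∈ S ∧ d ∉ S := by
  obtain ⟨p, q, -, hp, hq⟩ := hC.exists_detour (z := a) ⟨_, hab, by simp⟩ hab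
  obtain ⟨d, hd, h1, h2⟩ := (p.append q).exists_boundary_dart S ha hb
  have hd' : d.edge ∈ (p.append q).edges := List.mem_map_of_mem hd
  rw [Walk.edges_append, List.mem_append] at hd'
  have := hd'.elim (hp _) (hq _)
  exact ⟨d.fst, d.snd, this.1, this.2, h1, h2⟩

/-- If a closed trail contains the tree edge from `w` to its parent, then it contains an edge
outside of the tree that leaves the set of descendants of `w`. -/
theorem IsBFSTree.exists_nontree_crossing {y : V} {par : V → V} (hT : IsBFSTree G y par) {D : ℕ}
    {C : Finset (Sym2 V)} (hC : IsShortCircuit G D C) {w : V} (hw : G.Reachable y w) (hne : w ≠ y)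
    (he : s(w, par w) ∈ C) :
    ∃ c d, s(c, d) ∈ C ∧ s(c, d) ∉ treeEdges G y par ∧ Desc y par w c ∧ ¬ Desc y par w d := by
  obtain ⟨c, d, h1, h2, h3, h4⟩ := hC.exists_other_crossing (S := {v | Desc y par w v}) he .refl
    (hT.not_desc_par hw hne)
  exact ⟨c, d, h1, fun h => h2 (eq_of_mem_treeEdges_of_desc h h3 h4), h3, h4⟩

/-- A closed trail is not contained in a tree. -/
theorem IsBFSTree.exists_notMem_treeEdges {y : V} {par : V → V} (hT : IsBFSTree G y par) {D : ℕ}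
    {C : Finset (Sym2 V)} (hC : IsShortCircuit G D C) : ∃ e ∈ C, e ∉ treeEdges G y par := by
  obtain ⟨e, he⟩ := hC.nonempty
  by_cases h : e ∈ treeEdges G y par
  · obtain ⟨w, hw, hne, rfl⟩ := h
    obtain ⟨c, d, h1, h2, -⟩ := hT.exists_nontree_crossing hC hw hne he
    exact ⟨_, h1, h2⟩
  · exact ⟨e, he, h⟩

/-- Two vertices of a closed trail have distance at most `D`. -/
theorem IsShortCircuit.dist_le {D : ℕ} {C : Finset (Sym2 V)} (hC : IsShortCircuit G D C)
    {z a : V} (hz : ∃ e ∈ C, z ∈ e) (ha : ∃ e ∈ C, a ∈ e) : G.Reachable a z ∧ G.dist a z ≤ D := by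
  obtain ⟨e, he, hae⟩ := ha
  obtain ⟨b, rfl⟩ := Sym2.mem_iff_exists.1 hae
  obtain ⟨p, q, h, -⟩ := hC.exists_detour hz he
  exact ⟨⟨p⟩, (SimpleGraph.dist_le p).trans (by omega)⟩

/-- The distances from a vertex `z` of a closed trail to the two ends of an edge of the trail. -/
theorem IsShortCircuit.dist_add_dist_le {D : ℕ} {C : Finset (Sym2 V)} (hC : IsShortCircuit G D C)
    {z a b : V} (hz : ∃ e ∈ C, z ∈ e) (hab : s(a, b) ∈ C) : G.dist z a + G.dist z b ≤ D := by
  obtain ⟨p, q, h, -⟩ := hC.exists_detour hz hab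
  have h1 := SimpleGraph.dist_le p
  have h2 := SimpleGraph.dist_le q
  rw [dist_comm] at h1
  omega

/-- Deleting edges outside of a breadth-first search tree with root `x` whose ends are close
to `x` leaves a spanner: the ends `a` of such edges satisfy `2 * dist x a ≤ D + 1`, so any two of
them that are not the ends of the same edge have a short detour through `x`. -/
theorem IsBFSTree.isSpanner_deleteEdges {α β : ℝ} (hα : 1 ≤ α) (hβ : 0 ≤ β) {D : ℕ}
    (hD : (D : ℝ) ≤ α + β) {x : V} {par : V → V} (hT : IsBFSTree G x par) {F : Set (Sym2 V)}
    (hF : F ⊆ G.edgeSet) (hFT : ∀ e ∈ F, e ∉ treeEdges G x par)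
    (hr : ∀ a b, s(a, b) ∈ F → G.Reachable x a)
    (hd : ∀ a b, s(a, b) ∈ F → G.dist x a + G.dist x b ≤ D) :
    IsSpanner α β G (G.deleteEdges F) := by
  have htree : ∀ v, G.Reachable x v → AvoidWalk G F (G.dist x v) v x := fun v hv => by
    obtain ⟨p, hp, hpe⟩ := hT.exists_walk hv
    exact ⟨p, hp.le, fun e he heF => hFT e heF (hpe e he)⟩
  have hhalf : ∀ a, (∃ e ∈ F, a ∈ e) → G.Reachable x a ∧ 2 * G.dist x a ≤ D + 1 := by
    rintro a ⟨e, he, hae⟩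
    obtain ⟨b, rfl⟩ := Sym2.mem_iff_exists.1 hae
    have h1 : G.Adj a b := hF he
    have h2 := h1.symm.reachable.dist_triangle_right x
    rw [dist_eq_one_iff_adj.2 h1.symm] at h2
    have := hd a b he
    exact ⟨hr a b he, by omega⟩
  refine isSpanner_of_endpoints hα hβ fun a d ha hd' had => ?_
  obtain ⟨hra, ha2⟩ := hhalf a ha
  obtain ⟨hrd, hd2⟩ := hhalf d hd'
  have hw := (htree a hra).trans (htree d hrd).symm
  refine ⟨hw.reachable, ?_⟩
  rcases Nat.eq_zero_or_pos (G.dist a d) with h0 | hpos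
  · obtain rfl := had.dist_eq_zero_iff.1 h0
    simpa using hβ
  · refine stretch_of_add_le hα hD hpos ?_
    by_cases h1 : G.dist a d = 1
    · by_cases hadF : s(a, d) ∈ F
      · have := hd a d hadF
        have := hw.dist_le
        omega
      · have hadj := dist_eq_one_iff_adj.1 h1
        have : AvoidWalk G F 1 a d := ⟨.cons hadj .nil, by simp, by simpa using hadF⟩
        have h2 := this.dist_le
        have h3 := hadj
        have hD1 : 1 ≤ D := by
          obtain ⟨e, he, hae⟩ := ha
          obtain ⟨b, rfl⟩ := Sym2.mem_iff_exists.1 hae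
          have h1 := hd a b he
          by_contra hD0
          have e1 : G.dist x a = 0 := by omega
          have e2 : G.dist x b = 0 := by omega
          have := hr b a (Sym2.eq_swap ▸ he)
          have e3 := hra.dist_eq_zero_iff.1 e1
          have e4 := this.dist_eq_zero_iff.1 e2
          have : G.Adj a b := hF he
          exact this.ne (e3 ▸ e4)
        omega
    · have := hw.dist_le
      omega

end Spanner


/-! ### Deleting edges with hubs -/

namespace Spanner

open SimpleGraph

variable {V : Type*} {G : SimpleGraph V}

/-- Let `P₁` be a shortest walk to `a` that can be prolonged to a shortest walk to `b`. If any
deleted edge on `P₁` has ends whose shortest walks to `z` avoid all deleted edges but `ab`, then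
`z` can be reached as fast as by following `P₁` and then a given walk from `a` to `z`. -/
theorem avoidWalk_to_hub {F : Set (Sym2 V)} {z a b : V} {X : Set V} {L : ℕ} (hab : G.Adj a b)
    (hX : ∀ x ∈ X, G.Reachable x z →
      ∃ p : G.Walk x z, p.length = G.dist x z ∧ ∀ e ∈ p.edges, e ∈ F → e = s(a, b))
    (hp : AvoidWalk G F L a z) {u : V} (P : G.Walk u a) (hPb : P.length + 1 ≤ G.dist u b)
    (hP : ∀ e ∈ P.edges, e ∈ F → ∀ x ∈ e, x ∈ X) : AvoidWalk G F (P.length + L) u z := by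
  classical
  induction P with
  | nil => simpa using hp
  | @cons u w a huw P ih =>
    rw [Walk.length_cons] at hPb ⊢
    by_cases huwF : s(u, w) ∈ F
    · have hr : G.Reachable u z := by
        obtain ⟨q, -⟩ := hp
        exact ⟨(Walk.cons huw P).append q⟩
      obtain ⟨W, hW, hWF⟩ := hX u (hP _ (by simp) huwF u (by simp)) hr
      by_cases hmem : s(a, b) ∈ W.edges
      · have ha : a ∈ W.support := W.fst_mem_support_of_mem_edges hmem
        have h1 : (W.takeUntil a ha).length = G.dist u a :=
          length_eq_dist_of_subwalk hW (W.isSubwalk_takeUntil ha)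
        have h2 : G.dist u a ≤ P.length + 1 := by
          simpa using SimpleGraph.dist_le (Walk.cons huw P)
        have hav : AvoidWalk G F (P.length + 1) u a := by
          refine ⟨W.takeUntil a ha, by omega, fun e he heF => ?_⟩
          have he' := hWF e (W.edges_takeUntil_subset_edges ha he) heF
          rw [he'] at he
          -- the walk to `a` cannot pass `b`, which is farther away
          have hb := (W.takeUntil a ha).snd_mem_support_of_mem_edges he
          have h3 := SimpleGraph.dist_le ((W.takeUntil a ha).takeUntil b hb)
          have h4 := (W.takeUntil a ha).length_takeUntil_lt_length hb hab.ne'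
          omega
        exact hav.trans hp
      · have h1 : G.dist u z ≤ P.length + 1 + L := by
          obtain ⟨q, hq, -⟩ := hp
          have := SimpleGraph.dist_le ((Walk.cons huw P).append q)
          simp at this
          omega
        exact ⟨W, by omega, fun e he heF => hmem (hWF e he heF ▸ he)⟩
    · have h1 : G.dist u b ≤ 1 + G.dist w b := by
        have := huw.reachable.dist_triangle_left b
        rwa [dist_eq_one_iff_adj.2 huw] at this
      have h2 := ih hab hX hp (by omega) fun e he heF => hP e (by simp [he]) heF
      have h3 : AvoidWalk G F 1 u w := ⟨.cons huw .nil, by simp, by simpa using huwF⟩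
      exact (h3.trans h2).mono (by omega)

/-- Edges `e j` with hubs `z j` can be deleted together if `e j` has a detour of length at most `D`
through `z j`, and each end of an earlier edge `e i` has a shortest walk to `z j` that avoids all
deleted edges but `e j`. For on a shortest walk from `u` to `v`, let `e j` be the last deleted edge
with respect to the indices. The detour of `e j` leads through `z j`, and the earlier deleted
edges on the way from `u` or `v` to `z j` are avoided by the shortest walks to `z j`. -/
theorem dist_deleteEdges_of_hubs {D k : ℕ} (hD : 1 ≤ D) (e : Fin k → Sym2 V) (z : Fin k → V)
    (h₁ : ∀ j a b, e j = s(a, b) → ∃ L₁ L₂, L₁ + L₂ ≤ D ∧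
      AvoidWalk G (Set.range e) L₁ a (z j) ∧ AvoidWalk G (Set.range e) L₂ (z j) b)
    (h₂ : ∀ i j, i < j → ∀ x ∈ e i, G.Reachable x (z j) →
      ∃ p : G.Walk x (z j), p.length = G.dist x (z j) ∧ ∀ f ∈ p.edges, f ∈ Set.range e → f = e j)
    {u v : V} (huv : G.Reachable u v) :
    (G.deleteEdges (Set.range e)).Reachable u v ∧
      (u ≠ v → (G.deleteEdges (Set.range e)).dist u v + 1 ≤ G.dist u v + D) := by
  classical
  obtain ⟨P, hP⟩ := huv.exists_walk_length_eq_dist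
  by_cases hF : ∃ f ∈ P.edges, f ∈ Set.range e
  · obtain ⟨_, hf, i₀, rfl⟩ := hF
    obtain ⟨j, hj, hmax⟩ := Finset.exists_max_image (Finset.univ.filter fun i => e i ∈ P.edges) id
      ⟨i₀, by simpa using hf⟩
    simp only [Finset.mem_filter, Finset.mem_univ, true_and, id] at hj hmax
    have hpath := (P.isPath_of_length_eq_dist hP).isTrail
    obtain ⟨a, b, P₁, hab, P₂, rfl, hej, -⟩ := exists_first_edge {e j} P ⟨_, hj, rfl⟩
    rw [Set.mem_singleton_iff] at hej
    rw [Walk.isTrail_def, Walk.edges_append, Walk.edges_cons, List.nodup_append] at hpath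
    obtain ⟨-, ht2, ht3⟩ := hpath
    rw [List.nodup_cons] at ht2
    simp only [Walk.edges_append, Walk.edges_cons, List.mem_append, List.mem_cons] at hmax
    simp only [Walk.length_append, Walk.length_cons] at hP
    obtain ⟨L₁, L₂, hL, hw1, hw2⟩ := h₁ j a b hej.symm
    let X : Set V := {x | ∃ i < j, x ∈ e i}
    have hX : ∀ x ∈ X, G.Reachable x (z j) → ∃ p : G.Walk x (z j), p.length = G.dist x (z j) ∧
        ∀ f ∈ p.edges, f ∈ Set.range e → f = s(a, b) := by
      rintro x ⟨i, hij, hx⟩ hr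
      rw [hej]
      exact h₂ i j hij x hx hr
    have hlt : ∀ f, (f ∈ P₁.edges ∨ f ∈ P₂.edges) → f ∈ Set.range e → ∀ x ∈ f, x ∈ X := by
      rintro _ hf ⟨i, rfl⟩ x hx
      refine ⟨i, lt_of_le_of_ne (hmax i (by tauto)) ?_, hx⟩
      rintro rfl
      rcases hf with hf | hf
      · exact ht3 _ hf _ (by simp) hej.symm
      · exact ht2.1 (hej ▸ hf)
    have hd1 : P₁.length + 1 ≤ G.dist u b := by
      have h1 := SimpleGraph.dist_le P₂
      have h2 := (show G.Reachable b v from ⟨P₂⟩).dist_triangle_right u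
      omega
    have hd2 : P₂.reverse.length + 1 ≤ G.dist v a := by
      have h1 := SimpleGraph.dist_le P₁
      have h2 := (show G.Reachable u a from ⟨P₁⟩).dist_triangle_left v
      rw [Walk.length_reverse, dist_comm]
      omega
    have r1 := avoidWalk_to_hub hab hX hw1 P₁ hd1 fun f hf hfe => hlt f (.inl hf) hfe
    have r2 := avoidWalk_to_hub hab.symm (by rwa [Sym2.eq_swap]) hw2.symm P₂.reverse hd2
      fun f hf hfe => hlt f (.inr (by simpa using hf)) hfe
    have r := r1.trans r2.symm
    refine ⟨r.reachable, fun _ => ?_⟩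
    have := r.dist_le
    rw [Walk.length_reverse] at this
    omega
  · push Not at hF
    have hw : AvoidWalk G (Set.range e) P.length u v := ⟨P, le_rfl, hF⟩
    refine ⟨hw.reachable, fun _ => ?_⟩
    have := hw.dist_le
    omega

end Spanner


/-! ### Choosing edges greedily -/

namespace Spanner

open SimpleGraph

variable {V : Type*} {G : SimpleGraph V}

/-- A greedy choice of `k` edges from a large family `J` of edge sets `C i` with hubs `z i`. Think
of `te y` as the edges of a breadth-first search tree with root `y`, and of `pe y x` as the edges
of its path from `x` to `y`. Treat the members of `J` by increasing `t`. From the current `C j`,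
take an edge outside of the trees `te (z l)` of as many other members `l` as possible, and
discard the other members, as well as the few ones that meet a path from an end of an edge chosen
before to `z j`. The set `X` holds the ends of the edges chosen before. -/
theorem exists_greedy_choice {ι : Type*} (C : ι → Finset (Sym2 V)) (z : ι → V)
    (te : V → Set (Sym2 V)) (pe : V → V → Set (Sym2 V)) (t : ι → ℕ) {D B K : ℕ}
    (hC : ∀ i y, ∃ e ∈ C i, e ∉ te y) (hcard : ∀ i, (C i).card ≤ D + 1) (k : ℕ) :
    ∀ (J : Finset ι) (X : Finset V), X.card + 2 * k ≤ 2 * K →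
      (∀ j ∈ J, ∀ x, (x ∈ X ∨ ∃ i ∈ J, i ≠ j ∧ t i ≤ t j ∧ ∃ e ∈ C i, x ∈ e) →
        {l | l ∈ J ∧ l ≠ j ∧ t j ≤ t l ∧ ∃ e ∈ C l, e ∈ pe (z j) x}.ncard ≤ B) →
      (2 * K * B + 1) * (2 * D + 3) ^ k ≤ J.card →
      ∃ (c : Fin k → ι) (e : Fin k → Sym2 V), c.Injective ∧ (∀ s, c s ∈ J) ∧
        (∀ s, e s ∈ C (c s)) ∧ (∀ s r, s < r → e s ∉ te (z (c r))) ∧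
        (∀ s r l, s < r → r < l → ∀ x ∈ e s, e l ∉ pe (z (c r)) x) ∧
        (∀ r l, r < l → ∀ x ∈ X, e l ∉ pe (z (c r)) x) := by
  classical
  induction k with
  | zero => exact fun J X _ _ _ => ⟨Fin.elim0, Fin.elim0, fun s => s.elim0, fun s => s.elim0,
      fun s => s.elim0, fun s => s.elim0, fun s => s.elim0, fun s => s.elim0⟩
  | succ k ih =>
    intro J X hX hits hJ
    set A := 2 * K * B + 1 with hA
    have hpow : 0 < A * (2 * D + 3) ^ k := by positivity
    have hJ0 : J.Nonempty := by
      rw [← Finset.card_pos]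
      refine lt_of_lt_of_le ?_ hJ
      positivity
    obtain ⟨j, hj, hmin⟩ := J.exists_min_image t hJ0
    choose φ hφ hφ' using fun l : ι => hC j (z l)
    have hCj : (C j).Nonempty := ⟨_, hφ j⟩
    obtain ⟨e₀, he₀, hfib⟩ := Finset.exists_le_card_fiber_of_mul_le_card_of_maps_to
      (s := J.erase j) (t := C j) (f := φ) (n := A * (2 * D + 3) ^ k + A - 1)
      (fun l _ => hφ l) hCj (by
        rw [Finset.card_erase_of_mem hj]
        refine (Nat.mul_le_mul_right _ (hcard j)).trans ?_
        rw [pow_succ] at hJ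
        have h1 : (D + 1) * (A * (2 * D + 3) ^ k + A - 1) + 1 ≤
            (D + 1) * (A * (2 * D + 3) ^ k + A) := by
          obtain ⟨q, hq⟩ : ∃ q, A * (2 * D + 3) ^ k + A = q + 1 :=
            ⟨A * (2 * D + 3) ^ k + A - 1, by omega⟩
          rw [hq]; simp only [Nat.add_sub_cancel]; nlinarith
        have h2 : (D + 1) * (A * (2 * D + 3) ^ k + A) ≤ A * ((2 * D + 3) ^ k * (2 * D + 3)) := by
          have h3 : A ≤ A * (2 * D + 3) ^ k := Nat.le_mul_of_pos_right _ (by positivity)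
          nlinarith
        omega)
    set J₁ := {l ∈ J.erase j | φ l = e₀} with hJ₁
    let bad : V → Finset ι := fun x =>
      J.filter fun l => l ≠ j ∧ t j ≤ t l ∧ ∃ e ∈ C l, e ∈ pe (z j) x
    have hbad : ∀ x ∈ X, (bad x).card ≤ B := fun x hx => by
      have := hits j hj x (.inl hx)
      rw [← Set.ncard_coe_finset]
      convert this using 2
      ext l; simp [bad]
    set J₂ := J₁ \ X.biUnion bad with hJ₂
    have hJ₂J : ∀ l ∈ J₂, l ∈ J ∧ l ≠ j ∧ φ l = e₀ ∧ ∀ x ∈ X, l ∉ bad x := by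
      intro l hl
      rw [hJ₂, Finset.mem_sdiff, hJ₁, Finset.mem_filter, Finset.mem_erase, Finset.mem_biUnion] at hl
      push Not at hl
      tauto
    have hcard₂ : A * (2 * D + 3) ^ k ≤ J₂.card := by
      have h1 : (X.biUnion bad).card ≤ X.card * B := Finset.card_biUnion_le_card_mul _ _ _ hbad
      have h2 : X.card * B ≤ 2 * K * B := Nat.mul_le_mul_right _ (by omega)
      have h3 := Finset.le_card_sdiff (X.biUnion bad) J₁
      rw [← hJ₂] at h3
      have h4 : A - 1 = 2 * K * B := by omega
      omega
    have hXcard : (X ∪ e₀.toFinset).card + 2 * k ≤ 2 * K := by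
      have h1 := Finset.card_union_le X e₀.toFinset
      have h2 : e₀.toFinset.card ≤ 2 := by
        rw [Sym2.card_toFinset]; split_ifs <;> omega
      omega
    obtain ⟨c, e, hc, hcJ, hce, hte, hpe, hpX⟩ := ih J₂ (X ∪ e₀.toFinset) hXcard (by
      intro i hi x hx
      refine le_trans (Set.ncard_le_ncard ?_ (J.finite_toSet.subset fun l hl => hl.1))
        (hits i (hJ₂J i hi).1 x ?_)
      · rintro l ⟨h1, h2⟩
        exact ⟨(hJ₂J l h1).1, h2⟩
      · rcases hx with hx | ⟨l, hl, h⟩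
        · rw [Finset.mem_union, Sym2.mem_toFinset] at hx
          rcases hx with hx | hx
          · exact .inl hx
          · exact .inr ⟨j, hj, (hJ₂J i hi).2.1.symm, hmin i (hJ₂J i hi).1, e₀, he₀, hx⟩
        · exact .inr ⟨l, (hJ₂J l hl).1, h⟩) hcard₂
    refine ⟨Fin.cons j c, Fin.cons e₀ e, ?_, ?_, ?_, ?_, ?_, ?_⟩
    · rw [Fin.cons_injective_iff]
      refine ⟨?_, hc⟩
      rintro ⟨s, hs⟩
      exact (hJ₂J _ (hcJ s)).2.1 hs
    · refine Fin.cases hj fun s => ?_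
      simpa using (hJ₂J _ (hcJ s)).1
    · refine Fin.cases (by simpa using he₀) fun s => ?_
      simpa using hce s
    · intro s r hsr
      induction r using Fin.cases with
      | zero => simp at hsr
      | succ r =>
        induction s using Fin.cases with
        | zero =>
          have := hφ' (c r)
          rw [(hJ₂J _ (hcJ r)).2.2.1] at this
          simpa using this
        | succ s => simpa using hte s r (by simpa using hsr)
    · intro s r l hsr hrl x hx
      induction r using Fin.cases with
      | zero => simp at hsr
      | succ r =>
        induction l using Fin.cases with
        | zero => simp at hrl
        | succ l =>
          induction s using Fin.cases with
          | zero =>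
            simpa using hpX r l (by simpa using hrl) x (by
              rw [Finset.mem_union, Sym2.mem_toFinset]; exact .inr (by simpa using hx))
          | succ s =>
            simpa using hpe s r l (by simpa using hsr) (by simpa using hrl) x (by simpa using hx)
    · intro r l hrl x hx
      induction l using Fin.cases with
      | zero => simp at hrl
      | succ l =>
        induction r using Fin.cases with
        | zero =>
          have h := (hJ₂J _ (hcJ l)).2.2.2 x hx
          intro hmem
          refine h (Finset.mem_filter.2 ⟨(hJ₂J _ (hcJ l)).1, (hJ₂J _ (hcJ l)).2.1,
            hmin _ (hJ₂J _ (hcJ l)).1, e l, hce l, by simpa using hmem⟩)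
        | succ r =>
          simpa using hpX r l (by simpa using hrl) x (Finset.mem_union_left _ hx)

end Spanner


/-! ### Many edge-disjoint closed trails contain a solution -/

namespace Spanner

open SimpleGraph

variable {V : Type*} {G : SimpleGraph V}

theorem dist_add_dist_of_mem_support {u v w : V} {p : G.Walk u w} (hp : p.length = G.dist u w)
    (hv : v ∈ p.support) : G.dist u v + G.dist v w = G.dist u w := by
  classical
  rw [← length_eq_dist_of_subwalk hp (p.isSubwalk_takeUntil hv),
    ← length_eq_dist_of_subwalk hp (p.isSubwalk_dropUntil hv), ← hp, ← Walk.length_append,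
    p.take_spec hv]

theorem dist_add_dist_of_mem_support₂ {u v v' w : V} {p : G.Walk u w} (hp : p.length = G.dist u w)
    (hv : v ∈ p.support) (hv' : v' ∈ p.support) (h : G.dist v w ≤ G.dist v' w) :
    G.dist v v' + G.dist v w = G.dist v' w := by
  classical
  have hs : v ∈ ((p.takeUntil v' hv').append (p.dropUntil v' hv')).support := by
    rwa [p.take_spec hv']
  rw [Walk.mem_support_append_iff] at hs
  rcases hs with hs | hs
  · have h1 := length_eq_dist_of_subwalk hp (p.isSubwalk_takeUntil hv')
    have h2 := dist_add_dist_of_mem_support h1 hs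
    have h3 := dist_add_dist_of_mem_support hp hv
    have h4 := dist_add_dist_of_mem_support hp hv'
    omega
  · have h1 := length_eq_dist_of_subwalk hp (p.isSubwalk_dropUntil hv')
    have h2 := dist_add_dist_of_mem_support h1 hs
    rw [dist_comm (u := v)]
    exact h2

/-- The path from `x` to the root `z` in the breadth-first search tree `par z`: its edges are
collected in `pe z x`. -/
def IsPathSystem (G : SimpleGraph V) (par : V → V → V) (pe : V → V → Set (Sym2 V)) : Prop :=
  (∀ z, IsBFSTree G z (par z)) ∧
    (∀ z x, ∀ f ∈ pe z x, G.Reachable x z ∧ f ∈ treeEdges G z (par z)) ∧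
    ∀ z x, G.Reachable x z → ∃ p : G.Walk x z, p.length = G.dist x z ∧ ∀ f, f ∈ p.edges ↔ f ∈ pe z x

theorem exists_isPathSystem (G : SimpleGraph V) : ∃ par pe, IsPathSystem G par pe := by
  classical
  choose par hpar _ using fun y => exists_isBFSTree_extending (G := G) y ∅ id (by simp)
  choose p hp hpe using fun z x (h : G.Reachable z x) => (hpar z).exists_walk h
  refine ⟨par, fun z x => {f | ∃ h : G.Reachable z x, f ∈ (p z x h).edges}, hpar, ?_, ?_⟩
  · rintro z x f ⟨h, hf⟩
    exact ⟨h.symm, hpe z x h f hf⟩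
  · intro z x h
    refine ⟨p z x h.symm, by rw [hp, dist_comm], fun f => ⟨fun hf => ⟨h.symm, hf⟩, ?_⟩⟩
    rintro ⟨_, hf⟩
    exact hf

/-- A greedy choice of edges from edge-disjoint closed trails satisfies the conditions on edges
with hubs. -/
theorem exists_spanner_of_hits {α β : ℝ} (hα : 1 ≤ α) (hβ : 0 ≤ β) {D : ℕ} (hD1 : 1 ≤ D)
    (hD : (D : ℝ) ≤ α + β) {par : V → V → V} {pe : V → V → Set (Sym2 V)}
    (hps : IsPathSystem G par pe) {ι : Type*} (C : ι → Finset (Sym2 V))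
    (hC : ∀ i, IsShortCircuit G D (C i)) (J : Finset ι)
    (hdisj : ∀ i ∈ J, ∀ j ∈ J, ∀ e, e ∈ C i → e ∈ C j → i = j) (z : ι → V)
    (hz : ∀ i ∈ J, ∃ e ∈ C i, z i ∈ e) (t : ι → ℕ) {B k : ℕ}
    (hits : ∀ j ∈ J, ∀ x, (∃ i ∈ J, i ≠ j ∧ t i ≤ t j ∧ ∃ e ∈ C i, x ∈ e) →
        {l | l ∈ J ∧ l ≠ j ∧ t j ≤ t l ∧ ∃ e ∈ C l, e ∈ pe (z j) x}.ncard ≤ B)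
    (hJ : (2 * k * B + 1) * (2 * D + 3) ^ k ≤ J.card) :
    ∃ F : Finset (Sym2 V), F.card = k ∧ (∀ e ∈ F, ∃ i ∈ J, e ∈ C i) ∧
      IsSpanner α β G (G.deleteEdges F) := by
  classical
  obtain ⟨hT, hpeT, hpe⟩ := hps
  obtain ⟨c, e, hc, hcJ, hce, h1, h2, -⟩ := exists_greedy_choice C z
    (fun y => treeEdges G y (par y)) pe t (K := k)
    (fun i y => (hT y).exists_notMem_treeEdges (hC i)) (fun i => (hC i).card_le) k J ∅ (by simp)
    (fun j hj x hx => hits j hj x (by simpa using hx)) hJ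
  have hcell : ∀ s r, e s ∈ C (c r) → s = r := fun s r h =>
    hc (hdisj _ (hcJ s) _ (hcJ r) _ (hce s) h)
  have he : e.Injective := fun s r h => hcell s r (h ▸ hce r)
  refine ⟨Finset.univ.image e, by simp [Finset.card_image_of_injective _ he], ?_, ?_⟩
  · simp only [Finset.mem_image, Finset.mem_univ, true_and, forall_exists_index,
      forall_apply_eq_imp_iff]
    exact fun s => ⟨c s, hcJ s, hce s⟩
  · have hrange : ((Finset.univ.image e : Finset (Sym2 V)) : Set (Sym2 V)) = Set.range e := by simp
    rw [hrange]
    have hh₁ : ∀ j a b, e j = s(a, b) → ∃ L₁ L₂, L₁ + L₂ ≤ D ∧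
        AvoidWalk G (Set.range e) L₁ a (z (c j)) ∧ AvoidWalk G (Set.range e) L₂ (z (c j)) b := by
      intro j a b hab
      obtain ⟨p, q, hpq, hp, hq⟩ := (hC (c j)).exists_detour (hz _ (hcJ j)) (hab ▸ hce j)
      refine ⟨p.length, q.length, hpq, ⟨p, le_rfl, ?_⟩, ⟨q, le_rfl, ?_⟩⟩
      · rintro f hf ⟨s, rfl⟩
        have := hp _ hf
        exact this.2 (by rw [← hab, hcell s j this.1])
      · rintro f hf ⟨s, rfl⟩
        have := hq _ hf
        exact this.2 (by rw [← hab, hcell s j this.1])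
    have hh₂ : ∀ i j, i < j → ∀ x ∈ e i, G.Reachable x (z (c j)) →
        ∃ p : G.Walk x (z (c j)), p.length = G.dist x (z (c j)) ∧
          ∀ f ∈ p.edges, f ∈ Set.range e → f = e j := by
      intro i j hij x hx hxz
      obtain ⟨p, hp, hpf⟩ := hpe _ _ hxz
      refine ⟨p, hp, ?_⟩
      rintro _ hf ⟨l, rfl⟩
      rw [hpf] at hf
      rcases lt_trichotomy l j with hl | rfl | hl
      · exact absurd (hpeT _ _ _ hf).2 (h1 l j hl)
      · rfl
      · exact absurd hf (h2 i j l hij hl x hx)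
    refine ⟨G.deleteEdges_le _, fun u v huv => ?_⟩
    obtain ⟨hr, hd⟩ := dist_deleteEdges_of_hubs hD1 e (z ∘ c) hh₁ hh₂ huv
    refine ⟨hr, ?_⟩
    by_cases huv' : u = v
    · subst huv'; simpa using hβ
    · exact stretch_of_add_le hα hD (huv.pos_dist_of_ne huv') (hd huv')

/-- If a tree path meets many of the closed trails, take hubs on it that are far apart, and treat
them in the order of the path. Then no short walk to an earlier hub meets a later closed trail. -/
theorem exists_spanner_of_path {α β : ℝ} (hα : 1 ≤ α) (hβ : 0 ≤ β) {D : ℕ} (hD1 : 1 ≤ D)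
    (hD : (D : ℝ) ≤ α + β) {par : V → V → V} {pe : V → V → Set (Sym2 V)}
    (hps : IsPathSystem G par pe) {ι : Type*} (C : ι → Finset (Sym2 V))
    (hC : ∀ i, IsShortCircuit G D (C i)) (J : Finset ι)
    (hdisj : ∀ i ∈ J, ∀ j ∈ J, ∀ e, e ∈ C i → e ∈ C j → i = j) {k : ℕ} {x₀ z₀ : V}
    (hxz : G.Reachable x₀ z₀) (hhit : ∀ i ∈ J, ∃ e ∈ C i, e ∈ pe z₀ x₀)
    (hJ : (3 * D + 1) * (2 * D + 3) ^ k ≤ J.card) :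
    ∃ F : Finset (Sym2 V), F.card = k ∧ (∀ e ∈ F, ∃ i ∈ J, e ∈ C i) ∧
      IsSpanner α β G (G.deleteEdges F) := by
  classical
  obtain ⟨p, hp, hpf⟩ := hps.2.2 z₀ x₀ hxz
  have hv : ∀ i, ∃ v, i ∈ J → v ∈ p.support ∧ s(v, par z₀ v) ∈ C i := by
    intro i
    by_cases hi : i ∈ J
    · obtain ⟨e, he, hep⟩ := hhit i hi
      obtain ⟨v, hv, hne, rfl⟩ := (hps.2.1 _ _ _ hep).2
      exact ⟨v, fun _ => ⟨p.fst_mem_support_of_mem_edges ((hpf _).2 hep), he⟩⟩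
    · exact ⟨x₀, fun h => absurd h hi⟩
  choose v hv using hv
  let t : ι → ℕ := fun i => G.dist (v i) z₀
  have hreach : ∀ i ∈ J, G.Reachable x₀ (v i) := fun i hi => ⟨p.takeUntil _ (hv i hi).1⟩
  have hdist : ∀ i ∈ J, ∀ j ∈ J, t i ≤ t j → G.dist (v i) (v j) + t i = t j :=
    fun i hi j hj h => dist_add_dist_of_mem_support₂ hp (hv i hi).1 (hv j hj).1 h
  have htinj : ∀ i ∈ J, ∀ j ∈ J, t i = t j → i = j := by
    intro i hi j hj h
    have h1 := hdist i hi j hj h.le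
    have h2 : v i = v j :=
      (((hreach i hi).symm.trans (hreach j hj)).dist_eq_zero_iff).1 (by omega)
    exact hdisj i hi j hj _ (hv i hi).2 (h2 ▸ (hv j hj).2)
  obtain ⟨ρ, -, hρ⟩ := Finset.exists_le_card_fiber_of_mul_le_card_of_maps_to
    (s := J) (t := Finset.range (3 * D + 1)) (f := fun i => t i % (3 * D + 1))
    (n := (2 * D + 3) ^ k) (fun i _ => Finset.mem_range.2 (Nat.mod_lt _ (Nat.succ_pos _)))
    ⟨0, by simp⟩
    (by simpa using hJ)
  obtain ⟨F, h1, h2, h3⟩ := exists_spanner_of_hits (k := k) hα hβ hD1 hD hps C hC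
    {i ∈ J | t i % (3 * D + 1) = ρ}
    (fun i hi j hj => hdisj i (Finset.mem_filter.1 hi).1 j (Finset.mem_filter.1 hj).1) v
    (fun i hi => ⟨_, (hv i (Finset.mem_filter.1 hi).1).2, by simp⟩) t (B := 0) (by
      rintro j hj x ⟨i, hi, hij, htij, e, he, hxe⟩
      rw [Nat.le_zero, Set.ncard_eq_zero ((J.finite_toSet).subset fun l hl =>
        (Finset.mem_filter.1 hl.1).1), Set.eq_empty_iff_forall_notMem]
      rintro l ⟨hl, hlj, htjl, f, hf, hfp⟩
      rw [Finset.mem_filter] at hi hj hl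
      have hlt : t j < t l := lt_of_le_of_ne htjl fun h => hlj (htinj l hl.1 j hj.1 h.symm)
      have hgap : t j + (3 * D + 1) ≤ t l := by
        have h1 := Nat.div_add_mod (t j) (3 * D + 1)
        have h2 := Nat.div_add_mod (t l) (3 * D + 1)
        have h3 : t j / (3 * D + 1) < t l / (3 * D + 1) := by
          by_contra h
          have := Nat.mul_le_mul_left (3 * D + 1) (not_lt.1 h)
          omega
        have := Nat.mul_le_mul_left (3 * D + 1) (Nat.succ_le_of_lt h3)
        rw [Nat.succ_eq_add_one, mul_add] at this
        omega
      obtain ⟨hxr, hxd⟩ := (hC i).dist_le ⟨_, (hv i hi.1).2, Sym2.mem_mk_left _ _⟩ ⟨e, he, hxe⟩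
      have hr1 : G.Reachable (v i) (v j) := (hreach i hi.1).symm.trans (hreach j hj.1)
      obtain ⟨q, hq, hqf⟩ := hps.2.2 (v j) x (hxr.trans hr1)
      obtain ⟨y, y', rfl⟩ : ∃ y y', f = s(y, y') := by
        induction f using Sym2.ind with | _ y y' => exact ⟨y, y', rfl⟩
      have hy := q.fst_mem_support_of_mem_edges ((hqf _).2 hfp)
      obtain ⟨hyr, hyd⟩ := (hC l).dist_le ⟨_, (hv l hl.1).2, Sym2.mem_mk_left _ _⟩
        ⟨_, hf, Sym2.mem_mk_left y y'⟩
      have d1 := dist_add_dist_of_mem_support hq hy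
      have d2 := hxr.dist_triangle_left (v j)
      have d3 := hxr.symm.dist_triangle_left (v l)
      have d4 := hyr.dist_triangle_right x
      have d5 := hdist i hi.1 j hj.1 htij
      have d6 := hdist i hi.1 l hl.1 (htij.trans htjl)
      rw [dist_comm (v := x) (u := v i)] at d3
      omega) (by simpa using hρ)
  exact ⟨F, h1, fun e he => by
    obtain ⟨i, hi, hei⟩ := h2 e he
    exact ⟨i, (Finset.mem_filter.1 hi).1, hei⟩, h3⟩

/-- The number of edge-disjoint closed trails that guarantees a solution with `k` edges. -/
def trailBound (D k : ℕ) : ℕ :=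
  (2 * k * ((3 * D + 1) * (2 * D + 3) ^ k) + 1) * (2 * D + 3) ^ k

/-- Sufficiently many edge-disjoint short closed trails contain `k` edges that can be deleted. -/
theorem exists_spanner_of_disjoint {α β : ℝ} (hα : 1 ≤ α) (hβ : 0 ≤ β) {D : ℕ} (hD1 : 1 ≤ D)
    (hD : (D : ℝ) ≤ α + β) {ι : Type*} (C : ι → Finset (Sym2 V))
    (hC : ∀ i, IsShortCircuit G D (C i)) (J : Finset ι)
    (hdisj : ∀ i ∈ J, ∀ j ∈ J, ∀ e, e ∈ C i → e ∈ C j → i = j) {k : ℕ}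
    (hJ : trailBound D k ≤ J.card) :
    ∃ F : Finset (Sym2 V), F.card = k ∧ (∀ e ∈ F, ∃ i ∈ J, e ∈ C i) ∧
      IsSpanner α β G (G.deleteEdges F) := by
  classical
  obtain ⟨par, pe, hps⟩ := exists_isPathSystem G
  by_cases h : ∃ x₀ z₀, (3 * D + 1) * (2 * D + 3) ^ k ≤
      {i ∈ J | G.Reachable x₀ z₀ ∧ ∃ e ∈ C i, e ∈ pe z₀ x₀}.card
  · obtain ⟨x₀, z₀, h⟩ := h
    have hne : {i ∈ J | G.Reachable x₀ z₀ ∧ ∃ e ∈ C i, e ∈ pe z₀ x₀}.Nonempty := by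
      rw [← Finset.card_pos]
      exact lt_of_lt_of_le (by positivity) h
    obtain ⟨F, h1, h2, h3⟩ := exists_spanner_of_path hα hβ hD1 hD hps C hC _
      (fun i hi j hj => hdisj i (Finset.mem_filter.1 hi).1 j (Finset.mem_filter.1 hj).1)
      (Finset.mem_filter.1 hne.choose_spec).2.1 (fun i hi => (Finset.mem_filter.1 hi).2.2) h
    exact ⟨F, h1, fun e he => by
      obtain ⟨i, hi, hei⟩ := h2 e he
      exact ⟨i, (Finset.mem_filter.1 hi).1, hei⟩, h3⟩
  · push Not at h
    have hz : ∀ i, ∃ z, ∃ e ∈ C i, z ∈ e := fun i => by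
      obtain ⟨e, he⟩ := (hC i).nonempty
      exact ⟨_, e, he, e.out_fst_mem⟩
    choose z hz using hz
    refine exists_spanner_of_hits hα hβ hD1 hD hps C hC J hdisj z (fun i _ => hz i)
      (fun _ => 0) (B := (3 * D + 1) * (2 * D + 3) ^ k) ?_ hJ
    intro j _ x _
    refine le_trans ?_ (h x (z j)).le
    rw [← Set.ncard_coe_finset]
    refine Set.ncard_le_ncard ?_ (Finset.finite_toSet _)
    rintro l ⟨hl, -, -, e, he, hep⟩
    exact Finset.mem_coe.2 (Finset.mem_filter.2 ⟨hl, (hps.2.1 _ _ _ hep).1, e, he, hep⟩)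

end Spanner


namespace Spanner

open SimpleGraph

variable {V : Type*} {G : SimpleGraph V}

/-- In a union `W` of short closed trails without a solution, few edges lie on a closed trail
through a given vertex `x`: fewer than `k` of them are outside of a breadth-first search tree with
root `x`, and the others are on the tree paths from the ends of those to `x`. -/
theorem card_edges_on_circuits_le [DecidableEq V] {α β : ℝ} (hα : 1 ≤ α) (hβ : 0 ≤ β) {D k : ℕ}
    (hD : (D : ℝ) ≤ α + β) {𝒞 : Finset (Finset (Sym2 V))} (h𝒞 : ∀ C ∈ 𝒞, IsShortCircuit G D C)
    (hno : ∀ F ⊆ 𝒞.biUnion id, F.card = k → ¬ IsSpanner α β G (G.deleteEdges (F : Set (Sym2 V))))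
    (x : V) {A : Finset (Sym2 V)} (hA : ∀ f ∈ A, ∃ C ∈ 𝒞, f ∈ C ∧ ∃ e ∈ C, x ∈ e) :
    A.card ≤ k * (2 * D + 3) := by
  classical
  obtain ⟨par, hT, -⟩ := exists_isBFSTree_extending (G := G) x ∅ id (by simp)
  let N : Finset (Sym2 V) := (𝒞.biUnion id).filter fun g =>
    g ∉ treeEdges G x par ∧ ∃ C ∈ 𝒞, g ∈ C ∧ ∃ e ∈ C, x ∈ e
  have hN : N.card < k := by
    by_contra hk
    obtain ⟨F, hFN, hF⟩ := Finset.exists_subset_card_eq (not_lt.1 hk)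
    refine hno F (hFN.trans (Finset.filter_subset _ _)) hF
      (hT.isSpanner_deleteEdges hα hβ hD ?_ ?_ ?_ ?_)
    · intro e he
      obtain ⟨C, hC, heC, -⟩ := (Finset.mem_filter.1 (hFN he)).2.2
      exact (h𝒞 C hC).subset_edgeSet heC
    · exact fun e he => (Finset.mem_filter.1 (hFN he)).2.1
    · intro a b he
      obtain ⟨C, hC, heC, hx⟩ := (Finset.mem_filter.1 (hFN he)).2.2
      exact ((h𝒞 C hC).dist_le hx ⟨_, heC, Sym2.mem_mk_left a b⟩).1.symm
    · intro a b he
      obtain ⟨C, hC, heC, hx⟩ := (Finset.mem_filter.1 (hFN he)).2.2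
      exact (h𝒞 C hC).dist_add_dist_le hx heC
  let P : Sym2 V → Finset (Sym2 V) := fun g =>
    g.toFinset.biUnion fun c => (Finset.range (D + 1)).image fun j => s(par^[j] c, par^[j + 1] c)
  have hP : ∀ g ∈ N, (P g).card ≤ 2 * (D + 1) := fun g _ => by
    refine (Finset.card_biUnion_le_card_mul _ _ (D + 1) fun c _ => ?_).trans
      (Nat.mul_le_mul_right _ ?_)
    · exact Finset.card_image_le.trans (by simp)
    · rw [Sym2.card_toFinset]; split_ifs <;> omega
  have hsub : A ⊆ N ∪ N.biUnion P := by
    intro f hf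
    obtain ⟨C, hC, hfC, hx⟩ := hA f hf
    have hmem : ∀ g ∈ C, g ∈ 𝒞.biUnion id := fun g hg => Finset.mem_biUnion.2 ⟨C, hC, hg⟩
    by_cases hft : f ∈ treeEdges G x par
    · obtain ⟨w, hw, hne, rfl⟩ := hft
      obtain ⟨c, d, h1, h2, h3, -⟩ := hT.exists_nontree_crossing (h𝒞 C hC) hw hne hfC
      have hcN : s(c, d) ∈ N := Finset.mem_filter.2 ⟨hmem _ h1, h2, C, hC, h1, hx⟩
      obtain ⟨hcr, hcd⟩ := (h𝒞 C hC).dist_le hx ⟨_, h1, Sym2.mem_mk_left c d⟩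
      obtain ⟨j, hj, hjw⟩ := hT.exists_iterate_of_desc h3 hcr.symm
      rw [dist_comm] at hj
      refine Finset.mem_union_right _ (Finset.mem_biUnion.2 ⟨_, hcN, Finset.mem_biUnion.2
        ⟨c, by simp, Finset.mem_image.2 ⟨j, by simp; omega, ?_⟩⟩⟩)
      rw [Function.iterate_succ_apply', hjw]
    · exact Finset.mem_union_left _ (Finset.mem_filter.2 ⟨hmem _ hfC, hft, C, hC, hfC, hx⟩)
  have h1 := Finset.card_le_card hsub
  have h2 := Finset.card_union_le N (N.biUnion P)
  have h3 := Finset.card_biUnion_le_card_mul N P _ hP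
  have h4 : N.card * (2 * (D + 1)) ≤ k * (2 * (D + 1)) := Nat.mul_le_mul_right _ hN.le
  nlinarith

/-- A bound for the number of edges in a union of short closed trails without a solution. -/
def unionBound (D k : ℕ) : ℕ := trailBound D k * ((D + 1) * 2) * (k * (2 * D + 3))

/-- A union of short closed trails that has many edges contains a solution. -/
theorem card_biUnion_le_unionBound [DecidableEq V] {α β : ℝ} (hα : 1 ≤ α) (hβ : 0 ≤ β) {D k : ℕ}
    (hD1 : 1 ≤ D) (hD : (D : ℝ) ≤ α + β) {𝒞 : Finset (Finset (Sym2 V))}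
    (h𝒞 : ∀ C ∈ 𝒞, IsShortCircuit G D C)
    (hno : ∀ F ⊆ 𝒞.biUnion id, F.card = k → ¬ IsSpanner α β G (G.deleteEdges (F : Set (Sym2 V)))) :
    (𝒞.biUnion id).card ≤ unionBound D k := by
  classical
  -- a maximal family of pairwise edge-disjoint closed trails
  obtain ⟨𝒟, h𝒟, hmax⟩ := Finset.exists_max_image
    (𝒞.powerset.filter fun 𝒟 => ∀ C ∈ 𝒟, ∀ C' ∈ 𝒟, ∀ e, e ∈ C → e ∈ C' → C = C') Finset.card
    ⟨∅, by simp⟩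
  rw [Finset.mem_filter, Finset.mem_powerset] at h𝒟
  obtain ⟨hsub, hdisj⟩ := h𝒟
  have hcard : 𝒟.card ≤ trailBound D k := by
    by_contra hlt
    let J : Finset {C // IsShortCircuit G D C} := 𝒟.subtype _
    have hJ : J.card = 𝒟.card := by
      rw [Finset.card_subtype, Finset.filter_true_of_mem fun C hC => h𝒞 C (hsub hC)]
    obtain ⟨F, h1, h2, h3⟩ := exists_spanner_of_disjoint (k := k) hα hβ hD1 hD
      (fun C : {C // IsShortCircuit G D C} => C.1) (fun C => C.2) J (fun C hC C' hC' e he he' =>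
        Subtype.ext (hdisj C.1 (Finset.mem_subtype.1 hC) C'.1 (Finset.mem_subtype.1 hC') e he he'))
      (by omega)
    refine hno F (fun e he => ?_) h1 h3
    obtain ⟨C, hC, heC⟩ := h2 e he
    exact Finset.mem_biUnion.2 ⟨C.1, hsub (Finset.mem_subtype.1 hC), heC⟩
  have hmeet : ∀ C ∈ 𝒞, ∃ C' ∈ 𝒟, ∃ e, e ∈ C ∧ e ∈ C' := by
    intro C hC
    by_contra hcon
    push Not at hcon
    have hCD : C ∉ 𝒟 := fun h => by
      obtain ⟨e, he⟩ := (h𝒞 C hC).nonempty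
      exact hcon C h e he he
    have := hmax (insert C 𝒟) (by
      rw [Finset.mem_filter, Finset.mem_powerset]
      refine ⟨Finset.insert_subset hC hsub, fun C₁ h₁ C₂ h₂ e he₁ he₂ => ?_⟩
      rw [Finset.mem_insert] at h₁ h₂
      rcases h₁ with rfl | h₁ <;> rcases h₂ with rfl | h₂
      · rfl
      · exact absurd he₂ (hcon _ h₂ e he₁)
      · exact absurd he₁ (hcon _ h₁ e he₂)
      · exact hdisj _ h₁ _ h₂ e he₁ he₂)
    rw [Finset.card_insert_of_notMem hCD] at this
    omega
  let X : Finset V := 𝒟.biUnion fun C => C.biUnion Sym2.toFinset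
  let A : V → Finset (Sym2 V) := fun x =>
    (𝒞.biUnion id).filter fun f => ∃ C ∈ 𝒞, f ∈ C ∧ ∃ e ∈ C, x ∈ e
  have hX : X.card ≤ trailBound D k * ((D + 1) * 2) := by
    refine (Finset.card_biUnion_le_card_mul _ _ ((D + 1) * 2) fun C hC => ?_).trans
      (Nat.mul_le_mul_right _ hcard)
    refine (Finset.card_biUnion_le_card_mul _ _ 2 fun e _ => ?_).trans
      (Nat.mul_le_mul_right _ (h𝒞 C (hsub hC)).card_le)
    rw [Sym2.card_toFinset]; split_ifs <;> omega
  have hcover : 𝒞.biUnion id ⊆ X.biUnion A := by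
    intro f hf
    obtain ⟨C, hC, hfC⟩ := Finset.mem_biUnion.1 hf
    obtain ⟨C', hC', e, he, he'⟩ := hmeet C hC
    refine Finset.mem_biUnion.2 ⟨e.out.1, Finset.mem_biUnion.2 ⟨C', hC', Finset.mem_biUnion.2
      ⟨e, he', Sym2.mem_toFinset.2 e.out_fst_mem⟩⟩,
      Finset.mem_filter.2 ⟨hf, C, hC, hfC, e, he, e.out_fst_mem⟩⟩
  refine (Finset.card_le_card hcover).trans ((Finset.card_biUnion_le_card_mul _ _ _ fun x _ =>
    card_edges_on_circuits_le hα hβ hD h𝒞 hno x fun f hf => (Finset.mem_filter.1 hf).2).trans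
    (Nat.mul_le_mul_right _ hX))

end Spanner


namespace Spanner

open SimpleGraph

variable {V : Type*} {G : SimpleGraph V}

/-- A deleted edge of a spanner has a detour, so it lies on a short closed trail. -/
theorem IsSpanner.exists_isShortCircuit {α β : ℝ} {F : Set (Sym2 V)} {D : ℕ}
    (hD : α + β < D + 1) (h : IsSpanner α β G (G.deleteEdges F)) {a b : V} (hab : G.Adj a b)
    (hF : s(a, b) ∈ F) : ∃ C, IsShortCircuit G D C ∧ s(a, b) ∈ C := by
  classical
  obtain ⟨hr, hd⟩ := h.2 a b hab.reachable
  rw [dist_eq_one_iff_adj.2 hab, Nat.cast_one, mul_one] at hd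
  have hd' : (G.deleteEdges F).dist a b ≤ D := by
    have : ((G.deleteEdges F).dist a b : ℝ) < (D : ℝ) + 1 := hd.trans_lt hD
    exact Nat.lt_succ_iff.1 (by exact_mod_cast this)
  obtain ⟨p, hp⟩ := hr.exists_walk_length_eq_dist
  have hpt := (p.isPath_of_length_eq_dist hp).isTrail
  have hedges : ∀ e ∈ p.edges, e ∉ F := fun e he heF => by
    have := p.edges_subset_edgeSet he
    rw [edgeSet_deleteEdges] at this
    exact this.2 heF
  let q : G.Walk a b := p.mapLe (G.deleteEdges_le F)
  have hq : q.edges = p.edges := Walk.edges_mapLe_eq_edges ..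
  let c : G.Walk b b := .cons hab.symm q
  have hc : c.edges = s(b, a) :: p.edges := by simp [c, hq]
  refine ⟨c.edges.toFinset, ⟨b, c, ?_, by simp [c], ?_, by simp⟩, ?_⟩
  · rw [Walk.isTrail_def, hc, List.nodup_cons]
    exact ⟨fun h => hedges _ h (Sym2.eq_swap ▸ hF), hpt.edges_nodup⟩
  · rw [← Walk.length_edges, hc, List.length_cons, Walk.length_edges]
    omega
  · rw [List.mem_toFinset, hc, Sym2.eq_swap]
    simp

end Spanner


/-! ### Reasoning about word RAM programs -/

namespace WordRAM

variable {W : ℕ} {α β : ℝ}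

/-- Started in `s`, the program `p` halts, and its number of steps and its final state
satisfy `Q`. -/
def Run (W : ℕ) (α β : ℝ) (p : Prog) (s : State) (Q : ℕ → State → Prop) : Prop :=
  ∃ T s', Exec W α β p s T s' ∧ Q T s'

@[simp] theorem setReg_reg (s : State) (r v r' : ℕ) :
    (s.setReg r v).reg r' = if r' = r then v else s.reg r' := by
  simp [State.setReg, Function.update_apply]

@[simp] theorem setReg_arr (s : State) (r v : ℕ) : (s.setReg r v).arr = s.arr := rfl

@[simp] theorem setArr_reg (s : State) (a i v : ℕ) : (s.setArr a i v).reg = s.reg := rfl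

@[simp] theorem setArr_arr (s : State) (a i v a' : ℕ) :
    (s.setArr a i v).arr a' = if a' = a then Function.update (s.arr a) i v else s.arr a' := by
  simp [State.setArr, Function.update_apply]

attribute [simp] Operand.val Arith.eval Test.Holds

theorem Run.mono {p : Prog} {s : State} {Q Q' : ℕ → State → Prop} (h : Run W α β p s Q)
    (hQ : ∀ T s', Q T s' → Q' T s') : Run W α β p s Q' := by
  obtain ⟨T, s', h1, h2⟩ := h
  exact ⟨T, s', h1, hQ _ _ h2⟩

@[simp] theorem run_skip {s : State} {Q : ℕ → State → Prop} : Run W α β .skip s Q ↔ Q 1 s :=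
  ⟨fun ⟨_, _, h, hQ⟩ => by cases h; exact hQ, fun h => ⟨_, _, .skip s, h⟩⟩

@[simp] theorem run_set {r : ℕ} {x : Operand} {s : State} {Q : ℕ → State → Prop} :
    Run W α β (.set r x) s Q ↔ x.val s < W ∧ Q 1 (s.setReg r (x.val s)) :=
  ⟨fun ⟨_, _, h, hQ⟩ => by cases h with | set _ _ _ hx => exact ⟨hx, hQ⟩,
    fun h => ⟨_, _, .set s r x h.1, h.2⟩⟩

@[simp] theorem run_arith {op : Arith} {r : ℕ} {x y : Operand} {s : State} {Q : ℕ → State → Prop} :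
    Run W α β (.arith op r x y) s Q ↔
      op.eval (x.val s) (y.val s) < W ∧ Q 1 (s.setReg r (op.eval (x.val s) (y.val s))) :=
  ⟨fun ⟨_, _, h, hQ⟩ => by cases h with | arith _ _ _ _ _ hx => exact ⟨hx, hQ⟩,
    fun h => ⟨_, _, .arith s op r x y h.1, h.2⟩⟩

@[simp] theorem run_load {r a : ℕ} {x : Operand} {s : State} {Q : ℕ → State → Prop} :
    Run W α β (.load r a x) s Q ↔ x.val s < W ∧ Q 1 (s.setReg r (s.arr a (x.val s))) :=
  ⟨fun ⟨_, _, h, hQ⟩ => by cases h with | load _ _ _ _ hx => exact ⟨hx, hQ⟩,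
    fun h => ⟨_, _, .load s r a x h.1, h.2⟩⟩

@[simp] theorem run_store {a : ℕ} {x y : Operand} {s : State} {Q : ℕ → State → Prop} :
    Run W α β (.store a x y) s Q ↔
      x.val s < W ∧ y.val s < W ∧ Q 1 (s.setArr a (x.val s) (y.val s)) :=
  ⟨fun ⟨_, _, h, hQ⟩ => by cases h with | store _ _ _ _ hx hy => exact ⟨hx, hy, hQ⟩,
    fun h => ⟨_, _, .store s a x y h.1 h.2.1, h.2.2⟩⟩

@[simp] theorem run_seq {p q : Prog} {s : State} {Q : ℕ → State → Prop} :
    Run W α β (.seq p q) s Q ↔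
      Run W α β p s fun T s' => Run W α β q s' fun T' s'' => Q (T + T') s'' := by
  constructor
  · rintro ⟨_, _, h, hQ⟩
    cases h with | seq hp hq => exact ⟨_, _, hp, _, _, hq, hQ⟩
  · rintro ⟨_, _, hp, _, _, hq, hQ⟩
    exact ⟨_, _, .seq hp hq, hQ⟩

theorem run_ite {b : Test} {p q : Prog} {s : State} {Q : ℕ → State → Prop} :
    Run W α β (.ite b p q) s Q ↔
      (b.Holds α β s → Run W α β p s fun T s' => Q (1 + T) s') ∧
      (¬ b.Holds α β s → Run W α β q s fun T s' => Q (1 + T) s') := by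
  constructor
  · rintro ⟨_, _, h, hQ⟩
    cases h with
    | ite_true hb hp => exact ⟨fun _ => ⟨_, _, hp, hQ⟩, fun h => absurd hb h⟩
    | ite_false hb hp => exact ⟨fun h => absurd h hb, fun _ => ⟨_, _, hp, hQ⟩⟩
  · rintro ⟨h1, h2⟩
    by_cases hb : b.Holds α β s
    · obtain ⟨_, _, hp, hQ⟩ := h1 hb
      exact ⟨_, _, .ite_true hb hp, hQ⟩
    · obtain ⟨_, _, hp, hQ⟩ := h2 hb
      exact ⟨_, _, .ite_false hb hp, hQ⟩

/-- A loop with invariant `I`, where `τ` bounds the number of steps that remain before the last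
evaluation of the test. -/
theorem run_loop {b : Test} {p : Prog} (I : State → Prop) (τ : State → ℕ)
    (hstep : ∀ s, I s → b.Holds α β s →
      Run W α β p s fun T s' => I s' ∧ 1 + T + τ s' ≤ τ s) {s : State} (hs : I s) :
    Run W α β (.loop b p) s fun T s' => T ≤ τ s + 1 ∧ I s' ∧ ¬ b.Holds α β s' := by
  induction hn : τ s using Nat.strong_induction_on generalizing s with
  | _ n ih =>
    by_cases hb : b.Holds α β s
    · obtain ⟨T, s', h1, h2, h3⟩ := hstep s hs hb
      obtain ⟨T', s'', h4, h5, h6⟩ := ih (τ s') (by omega) h2 rfl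
      exact ⟨_, _, .loop_true hb h1 h4, by omega, h6⟩
    · exact ⟨_, _, .loop_false hb, by omega, hs, hb⟩

/-- The program `p` may write register `r`. -/
def Prog.writesReg (r : ℕ) : Prog → Bool
  | .skip => false
  | .set r' _ => r == r'
  | .arith _ r' _ _ => r == r'
  | .load r' _ _ => r == r'
  | .store _ _ _ => false
  | .seq p q => p.writesReg r || q.writesReg r
  | .ite _ p q => p.writesReg r || q.writesReg r
  | .loop _ p => p.writesReg r

/-- The program `p` may write array `a`. -/
def Prog.writesArr (a : ℕ) : Prog → Bool
  | .skip => false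
  | .set _ _ => false
  | .arith _ _ _ _ => false
  | .load _ _ _ => false
  | .store a' _ _ => a == a'
  | .seq p q => p.writesArr a || q.writesArr a
  | .ite _ p q => p.writesArr a || q.writesArr a
  | .loop _ p => p.writesArr a

theorem Exec.reg_eq {p : Prog} {s s' : State} {T r : ℕ} (h : Exec W α β p s T s')
    (hr : p.writesReg r = false) : s'.reg r = s.reg r := by
  induction h with
  | skip => rfl
  | store => rfl
  | seq _ _ ih1 ih2 =>
    simp only [Prog.writesReg, Bool.or_eq_false_iff] at hr
    rw [ih2 hr.2, ih1 hr.1]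
  | ite_true _ _ ih =>
    simp only [Prog.writesReg, Bool.or_eq_false_iff] at hr
    exact ih hr.1
  | ite_false _ _ ih =>
    simp only [Prog.writesReg, Bool.or_eq_false_iff] at hr
    exact ih hr.2
  | loop_true _ _ _ ih1 ih2 => rw [ih2 hr, ih1 (by simpa [Prog.writesReg] using hr)]
  | loop_false => rfl
  | _ => simp_all [Prog.writesReg]

theorem Exec.arr_eq {p : Prog} {s s' : State} {T a : ℕ} (h : Exec W α β p s T s')
    (ha : p.writesArr a = false) : s'.arr a = s.arr a := by
  induction h with
  | seq _ _ ih1 ih2 =>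
    simp only [Prog.writesArr, Bool.or_eq_false_iff] at ha
    rw [ih2 ha.2, ih1 ha.1]
  | ite_true _ _ ih =>
    simp only [Prog.writesArr, Bool.or_eq_false_iff] at ha
    exact ih ha.1
  | ite_false _ _ ih =>
    simp only [Prog.writesArr, Bool.or_eq_false_iff] at ha
    exact ih ha.2
  | loop_true _ _ _ ih1 ih2 => rw [ih2 ha, ih1 (by simpa [Prog.writesArr] using ha)]
  | store => simp_all [Prog.writesArr]
  | _ => rfl

/-- `s'` agrees with `s` on all registers and arrays that `p` does not write. -/
def Frame (p : Prog) (s s' : State) : Prop :=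
  (∀ r, p.writesReg r = false → s'.reg r = s.reg r) ∧
    ∀ a, p.writesArr a = false → s'.arr a = s.arr a

/-- Facts about registers and arrays that a program does not write need no mention in its
specification. -/
theorem Run.frame {p : Prog} {s : State} {Q : ℕ → State → Prop} (h : Run W α β p s Q) :
    Run W α β p s fun T s' => Q T s' ∧ Frame p s s' := by
  obtain ⟨T, s', h1, h2⟩ := h
  exact ⟨T, s', h1, h2, fun r hr => h1.reg_eq hr, fun a ha => h1.arr_eq ha⟩

/-- Run `p` for the values `b - 1, …, 0` of register `i`. -/
def forDown (i : ℕ) (b : Operand) (p : Prog) : Prog :=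
  .seq (.set i b) (.loop (.le (.const 1) (.reg i)) (.seq (.arith .sub i (.reg i) (.const 1)) p))

theorem run_forDown {i N K : ℕ} {b : Operand} {p : Prog} {s : State} (I : ℕ → State → Prop)
    (hb : b.val s = N) (hN : N < W) (hi : p.writesReg i = false) (h0 : I N (s.setReg i N))
    (hstep : ∀ j < N, ∀ s', I (j + 1) s' → s'.reg i = j + 1 →
      Run W α β p (s'.setReg i j) fun T s'' => T ≤ K ∧ I j s'') :
    Run W α β (forDown i b p) s fun T s' => T ≤ N * (K + 2) + 2 ∧ I 0 s' := by
  rw [forDown, run_seq, run_set, hb]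
  refine ⟨hN, ?_⟩
  refine (run_loop (fun s' => s'.reg i ≤ N ∧ I (s'.reg i) s') (fun s' => s'.reg i * (K + 2)) ?_
    (s := s.setReg i N) ?_).mono ?_
  · rintro s' ⟨hle, hI⟩ htest
    simp only [Test.Holds, Operand.val] at htest
    obtain ⟨j, hj⟩ : ∃ j, s'.reg i = j + 1 := ⟨s'.reg i - 1, by omega⟩
    rw [run_seq, run_arith]
    simp only [Arith.eval, Operand.val, hj, Nat.add_sub_cancel]
    refine ⟨by omega, ?_⟩
    refine ((hstep j (by omega) s' (hj ▸ hI) hj).frame).mono fun T s'' h => ?_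
    obtain ⟨⟨hT, hI'⟩, hfr⟩ := h
    have := hfr.1 i hi
    simp only [setReg_reg, if_true] at this
    rw [this]
    exact ⟨⟨by omega, hI'⟩, by nlinarith⟩
  · simpa using h0
  · rintro T s' ⟨hT, ⟨_, hI⟩, htest⟩
    simp only [Test.Holds, Operand.val, not_le, Nat.lt_one_iff] at htest
    rw [htest] at hI
    refine ⟨?_, hI⟩
    simp only [setReg_reg, if_true] at hT
    omega

end WordRAM


/-! ### Breadth-first search -/

namespace WordRAM

open SimpleGraph

variable {W : ℕ} {α β : ℝ} {n m k : ℕ}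

/-- Sequential composition. -/
infixr:40 " ;; " => Prog.seq

/-- The state still holds the input. -/
structure Enc (e : Fin m → Fin n × Fin n) (k : ℕ) (s : State) : Prop where
  reg0 : s.reg 0 = n
  reg1 : s.reg 1 = m
  reg2 : s.reg 2 = k
  arr0 : ∀ i : Fin m, s.arr 0 i = (e i).1
  arr1 : ∀ i : Fin m, s.arr 1 i = (e i).2

theorem Enc.congr {e : Fin m → Fin n × Fin n} {s s' : State} (h : Enc e k s)
    (h0 : s'.reg 0 = s.reg 0) (h1 : s'.reg 1 = s.reg 1) (h2 : s'.reg 2 = s.reg 2)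
    (h3 : s'.arr 0 = s.arr 0) (h4 : s'.arr 1 = s.arr 1) : Enc e k s' :=
  ⟨h0 ▸ h.reg0, h1 ▸ h.reg1, h2 ▸ h.reg2, fun i => h3 ▸ h.arr0 i, fun i => h4 ▸ h.arr1 i⟩

/-- The vertices at which a search with root `x` may leave a value. -/
def Touched (e : Fin m → Fin n × Fin n) (x v : Fin n) : Prop :=
  v = x ∨ ∃ i, v = (e i).1 ∨ v = (e i).2

/-- `H` consists of the listed edges with mark `0`. -/
def Keeps (e : Fin m → Fin n × Fin n) (mask : ℕ → ℕ) (H : SimpleGraph (Fin n)) : Prop :=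
  ∀ u v, H.Adj u v ↔ ∃ i : Fin m, mask i = 0 ∧ s((e i).1, (e i).2) = s(u, v)

/-- A state of the search in the graph `H` with root `x`: the array `f` holds `dist x v + 1` for
each vertex `v` that has been found, and `0` for the others. All vertices at distance less than `t`
have been found. For each vertex that has been found, except for the root, the array `pa` holds the
index of an edge to a vertex that is closer to the root; the entry of the root is no such index. -/
structure SearchInv (H : SimpleGraph (Fin n)) (e : Fin m → Fin n × Fin n) (x : Fin n)
    (mask : ℕ → ℕ) (t : ℕ) (f pa : ℕ → ℕ) : Prop where
  pos : 1 ≤ t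
  root : f x = 1
  root_par : pa x = m
  sound : ∀ v : Fin n, Touched e x v → f v ≠ 0 → H.Reachable x v ∧ f v = H.dist x v + 1
  complete : ∀ v : Fin n, H.Reachable x v → H.dist x v < t → f v ≠ 0
  bound : ∀ v : Fin n, Touched e x v → f v ≤ t + 1
  par : ∀ v : Fin n, Touched e x v → v ≠ x → f v ≠ 0 → ∃ i : Fin m, pa v = i ∧ mask i = 0 ∧
    ∃ u : Fin n, s((e i).1, (e i).2) = s(u, v) ∧ f u ≠ 0 ∧ f u + 1 = f v

/-- The edges with index at least `j` have been scanned in round `t` of the search. -/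
def Scanned (e : Fin m → Fin n × Fin n) (mask : ℕ → ℕ) (t : ℕ) (f : ℕ → ℕ) (j : ℕ) : Prop :=
  ∀ i : Fin m, j ≤ i → mask i = 0 →
    (f (e i).1 = t → f (e i).2 ≠ 0) ∧ (f (e i).2 = t → f (e i).1 ≠ 0)

variable {H : SimpleGraph (Fin n)} {e : Fin m → Fin n × Fin n} {x : Fin n} {mask f pa : ℕ → ℕ}
  {t : ℕ}

theorem touched_of_edge {i : Fin m} {u v : Fin n} (h : s((e i).1, (e i).2) = s(u, v)) :
    Touched e x u := by
  rw [Sym2.eq_iff] at h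
  exact .inr ⟨i, by tauto⟩

theorem touched_of_reachable (hH : Keeps e mask H) {v : Fin n} (h : H.Reachable x v) :
    Touched e x v := by
  by_cases hv : v = x
  · exact .inl hv
  · obtain ⟨w, hw, -⟩ := Spanner.exists_closer_neighbor h hv
    obtain ⟨i, -, hi⟩ := (hH _ _).1 hw
    exact touched_of_edge hi

theorem SearchInv.init (hf : ∀ i, f (e i).1 = 0 ∧ f (e i).2 = 0) :
    SearchInv H e x mask 1 (Function.update f x 1) (Function.update pa x m) := by
  have h0 : ∀ v : Fin n, Touched e x v → v ≠ x → Function.update f (x : ℕ) 1 v = 0 := by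
    rintro v (rfl | ⟨i, rfl | rfl⟩) hv
    · exact absurd rfl hv
    · rw [Function.update_of_ne (by simpa [Fin.ext_iff] using hv)]; exact (hf i).1
    · rw [Function.update_of_ne (by simpa [Fin.ext_iff] using hv)]; exact (hf i).2
  refine ⟨le_rfl, by simp, by simp, ?_, ?_, ?_, ?_⟩
  · intro v hv hne
    by_cases h : v = x
    · subst h; simp
    · exact absurd (h0 v hv h) hne
  · intro v hv hd
    obtain rfl := hv.dist_eq_zero_iff.1 (Nat.lt_one_iff.1 hd)
    simp
  · intro v hv
    by_cases h : v = x
    · subst h; simp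
    · rw [h0 v hv h]; omega
  · exact fun v hv h hne => absurd (h0 v hv h) hne

/-- Scanning an edge from a vertex `u` of the current level to a new vertex `v`. -/
theorem SearchInv.update (hH : Keeps e mask H) (h : SearchInv H e x mask t f pa) {i : Fin m}
    (hi : mask i = 0) {u v : Fin n} (huv : s((e i).1, (e i).2) = s(u, v)) (hu : f u = t)
    (hv : f v = 0) :
    SearchInv H e x mask t (Function.update f v (t + 1)) (Function.update pa v i) := by
  have hpos := h.pos
  have hupd : ∀ (g : ℕ → ℕ) (c : ℕ) (w : Fin n), w ≠ v → Function.update g (v : ℕ) c w = g w :=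
    fun g c w hw => Function.update_of_ne (by simpa [Fin.ext_iff] using hw) _ _
  have hvx : x ≠ v := by rintro rfl; have := h.root; omega
  have huv' : u ≠ v := by rintro rfl; omega
  have hadj : H.Adj u v := (hH u v).2 ⟨i, hi, huv⟩
  obtain ⟨hur, hud⟩ := h.sound u (touched_of_edge huv) (by omega)
  have hvr := hur.trans hadj.reachable
  have hvd : H.dist x v = t := by
    have h1 := hadj.reachable.dist_triangle_right x
    rw [dist_eq_one_iff_adj.2 hadj] at h1
    have h2 : ¬ H.dist x v < t := fun hlt => h.complete v hvr hlt hv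
    omega
  refine ⟨hpos, by rw [hupd _ _ _ hvx, h.root], by rw [hupd _ _ _ hvx, h.root_par], ?_, ?_, ?_, ?_⟩
  · intro w hw hne
    by_cases hwv : w = v
    · subst hwv
      simp only [Function.update_self]
      exact ⟨hvr, by omega⟩
    · rw [hupd _ _ _ hwv] at hne ⊢
      exact h.sound w hw hne
  · intro w hw hlt
    by_cases hwv : w = v
    · subst hwv; simp
    · rw [hupd _ _ _ hwv]
      exact h.complete w hw hlt
  · intro w hw
    by_cases hwv : w = v
    · subst hwv; simp
    · rw [hupd _ _ _ hwv]
      exact h.bound w hw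
  · intro w hw hwx hne
    by_cases hwv : w = v
    · subst hwv
      exact ⟨i, by simp, hi, u, huv, by rw [hupd _ _ _ huv']; omega,
        by rw [hupd _ _ _ huv']; simp [hu]⟩
    · rw [hupd _ _ _ hwv] at hne ⊢
      obtain ⟨i', h1, h2, u', h3, h4, h5⟩ := h.par w hw hwx hne
      have hu' : u' ≠ v := by rintro rfl; exact h4 hv
      exact ⟨i', h1, h2, u', h3,
        by rwa [hupd _ _ _ hu'], by rwa [hupd _ _ _ hu', hupd _ _ _ hwv]⟩

theorem Scanned.update {j : ℕ} (h : Scanned e mask t f j) (v : ℕ) :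
    Scanned e mask t (Function.update f v (t + 1)) j := by
  intro i hi hm
  obtain ⟨h1, h2⟩ := h i hi hm
  simp only [Function.update_apply]
  split_ifs <;> simp_all

theorem SearchInv.next (hH : Keeps e mask H) (h : SearchInv H e x mask t f pa)
    (hs : Scanned e mask t f 0) : SearchInv H e x mask (t + 1) f pa := by
  have hpos := h.pos
  refine ⟨by omega, h.root, h.root_par, h.sound, fun v hv hlt => ?_,
    fun v hv => (h.bound v hv).trans (by omega), h.par⟩
  by_cases hd : H.dist x v < t
  · exact h.complete v hv hd
  · have hvx : v ≠ x := by rintro rfl; simp at hd; omega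
    obtain ⟨w, hw, hwd⟩ := Spanner.exists_closer_neighbor hv hvx
    have hwr := hv.trans hw.reachable
    have hw0 := h.complete w hwr (by omega)
    have hwf := (h.sound w (touched_of_reachable hH hwr) hw0).2
    obtain ⟨i, hi, hie⟩ := (hH v w).1 hw
    obtain ⟨h1, h2⟩ := hs i (Nat.zero_le _) hi
    rw [Sym2.eq_iff] at hie
    rcases hie with ⟨h3, h4⟩ | ⟨h3, h4⟩
    · rw [h3, h4] at h2; exact h2 (by omega)
    · rw [h3, h4] at h1; exact h1 (by omega)

/-- Set the entries of array `d` at all ends of edges to `0`. -/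
def clearEnds (d : ℕ) : Prog :=
  forDown 11 (.reg 1) (.load 12 0 (.reg 11) ;; .store d (.reg 12) (.const 0) ;;
    .load 12 1 (.reg 11) ;; .store d (.reg 12) (.const 0))

/-- Scan edge number `R[11]` in the round of the search given by `R[10]`; `R[17] = R[10] + 1`. -/
def scanEdge (d p q : ℕ) : Prog :=
  .load 12 0 (.reg 11) ;; .load 13 1 (.reg 11) ;; .load 14 d (.reg 12) ;; .load 15 d (.reg 13) ;;
  .load 16 q (.reg 11) ;;
  .ite (.eq (.reg 16) (.const 0))
    (.ite (.eq (.reg 14) (.reg 10))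
      (.ite (.eq (.reg 15) (.const 0))
        (.store d (.reg 13) (.reg 17) ;; .store p (.reg 13) (.reg 11)) .skip)
      (.ite (.eq (.reg 15) (.reg 10))
        (.ite (.eq (.reg 14) (.const 0))
          (.store d (.reg 12) (.reg 17) ;; .store p (.reg 12) (.reg 11)) .skip) .skip)) .skip

/-- Breadth-first search from the vertex in `R[8]`, in `R[9]` rounds, along the edges whose entry
in array `q` is `0`. Distances plus one are written to array `d`, indices of edges to parents to
array `p`. In each round, the whole edge list is scanned. -/
def bfs (d p q : ℕ) : Prog :=
  clearEnds d ;; .store d (.reg 8) (.const 1) ;; .store p (.reg 8) (.reg 1) ;;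
  .set 10 (.const 1) ;;
  .loop (.le (.reg 10) (.reg 9))
    (.arith .add 17 (.reg 10) (.const 1) ;; forDown 11 (.reg 1) (scanEdge d p q) ;;
      .set 10 (.reg 17))

theorem run_clearEnds {d : ℕ} (hd0 : d ≠ 0) (hd1 : d ≠ 1) {s : State} (hs : Enc e k s)
    (hW : 2 * (n + m + k + 2) ≤ W) :
    Run W α β (clearEnds d) s fun T s' => T ≤ 6 * m + 2 ∧
      ∀ i, s'.arr d (e i).1 = 0 ∧ s'.arr d (e i).2 = 0 := by
  refine ((run_forDown (N := m) (K := 4) (fun j s' => Enc e k s' ∧ ∀ i : Fin m, j ≤ i →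
    s'.arr d (e i).1 = 0 ∧ s'.arr d (e i).2 = 0) (by simpa [Operand.val] using hs.reg1)
    (by omega) (by simp [Prog.writesReg]) ?_ ?_)).mono ?_
  · exact ⟨hs.congr (by simp) (by simp) (by simp) rfl rfl, fun i hi => absurd i.2 (by omega)⟩
  · rintro j hj s' ⟨he, hI⟩ -
    have h0 := he.arr0 ⟨j, hj⟩
    have h1 := he.arr1 ⟨j, hj⟩
    have hb0 := (e ⟨j, hj⟩).1.2
    have hb1 := (e ⟨j, hj⟩).2.2
    simp only [] at h0 h1
    simp [h0, h1, hd1.symm]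
    refine ⟨by omega, by omega, by omega, by omega, by omega, by omega, ?_, ?_⟩
    · exact he.congr (by simp) (by simp) (by simp) (by simp [hd0.symm]) (by simp [hd1.symm])
    · intro i hi
      simp only [Function.update_apply]
      rcases Nat.eq_or_lt_of_le hi with rfl | hi
      · simp
      · have := hI i hi
        split_ifs <;> simp_all
  · rintro T s' ⟨hT, -, h⟩
    exact ⟨by omega, fun i => h i (Nat.zero_le _)⟩

theorem run_scanEdge {d p q : ℕ} (hdp : d ≠ p) (hH : Keeps e mask H) {s : State} (hs : Enc e k s)
    (hW : 2 * (n + m + k + 2) ≤ W) (i : Fin m) (hi : s.reg 11 = i) (hq : s.arr q = mask)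
    (ht : s.reg 10 = t) (ht' : s.reg 17 = t + 1) (htn : t ≤ n)
    (h : SearchInv H e x mask t (s.arr d) (s.arr p)) (hsc : Scanned e mask t (s.arr d) (i + 1)) :
    Run W α β (scanEdge d p q) s fun T s' => T ≤ 11 ∧
      SearchInv H e x mask t (s'.arr d) (s'.arr p) ∧ Scanned e mask t (s'.arr d) i := by
  have h0 := hs.arr0 i
  have h1 := hs.arr1 i
  have hb0 := (e i).1.2
  have hb1 := (e i).2.2
  have him := i.2
  have hpos := h.pos
  have hB0 := h.bound _ (.inr ⟨i, .inl rfl⟩)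
  have hB1 := h.bound _ (.inr ⟨i, .inr rfl⟩)
  have hsc' : ∀ f : ℕ → ℕ, Scanned e mask t f (i + 1) → (mask i = 0 →
      (f (e i).1 = t → f (e i).2 ≠ 0) ∧ (f (e i).2 = t → f (e i).1 ≠ 0)) →
      Scanned e mask t f i := by
    intro f hf hfi i' hi' hm
    rcases Nat.eq_or_lt_of_le hi' with h | h
    · obtain rfl := Fin.ext h
      exact hfi hm
    · exact hf i' h hm
  simp [scanEdge, h0, h1, hi, hq]
  refine ⟨by omega, by omega, by omega, by omega, ?_⟩
  rw [run_ite]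
  refine ⟨fun hm => ?_, fun hm => ?_⟩
  · simp at hm
    rw [run_ite]
    refine ⟨fun ha => ?_, fun ha => ?_⟩
    · simp at ha
      rw [run_ite]
      refine ⟨fun hb => ?_, fun hb => ?_⟩
      · simp at hb
        simp [hi, ht', hdp, hdp.symm]
        exact ⟨by omega, by omega, by omega, by omega, h.update hH hm rfl (ha.trans ht) hb,
          hsc' _ (hsc.update _) fun _ => by
            have hne : ((e i).1 : ℕ) ≠ (e i).2 := fun h' => by rw [h'] at ha; omega
            simp [hne]⟩
      · simp at hb
        simp
        exact ⟨h, hsc' _ hsc fun _ => ⟨fun _ => hb, fun _ => by omega⟩⟩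
    · simp at ha
      rw [run_ite]
      refine ⟨fun hb => ?_, fun hb => ?_⟩
      · simp at hb
        rw [run_ite]
        refine ⟨fun hc => ?_, fun hc => ?_⟩
        · simp at hc
          simp [hi, ht', hdp, hdp.symm]
          exact ⟨by omega, by omega, by omega, by omega,
            h.update hH hm Sym2.eq_swap (hb.trans ht) hc, hsc' _ (hsc.update _) fun _ => by
              have hne : ((e i).2 : ℕ) ≠ (e i).1 := fun h' => by rw [h'] at hb; omega
              simp [hne]⟩
        · simp at hc
          simp
          exact ⟨h, hsc' _ hsc fun _ => ⟨fun _ => by omega, fun _ => hc⟩⟩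
      · simp at hb
        simp
        exact ⟨h, hsc' _ hsc fun _ => ⟨fun _ => by omega, fun _ => by omega⟩⟩
  · simp at hm
    simp
    exact ⟨h, hsc' _ hsc fun h => absurd h hm⟩

/-- With `R` rounds, the search finds all vertices at distance at most `R`. -/
theorem run_bfs {d p q R : ℕ} (hd0 : d ≠ 0) (hd1 : d ≠ 1) (hp0 : p ≠ 0) (hp1 : p ≠ 1)
    (hdp : d ≠ p) (hqd : q ≠ d) (hqp : q ≠ p) {s : State} (hs : Enc e k s)
    (hW : 2 * (n + m + k + 2) ≤ W) (hH : Keeps e (s.arr q) H) (hx : s.reg 8 = x)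
    (hR : s.reg 9 = R) (hRn : R ≤ n) :
    Run W α β (bfs d p q) s fun T s' => T ≤ (R + 1) * (13 * m + 8) ∧
      SearchInv H e x (s.arr q) (R + 1) (s'.arr d) (s'.arr p) := by
  have hxn := x.2
  rw [bfs, run_seq]
  refine ((run_clearEnds hd0 hd1 hs hW).frame).mono ?_
  rintro T₁ s₁ ⟨⟨hT₁, hclear⟩, hfr⟩
  have e8 : s₁.reg 8 = x := (hfr.1 8 (by rfl)).trans hx
  have e9 : s₁.reg 9 = R := (hfr.1 9 (by rfl)).trans hR
  have eq' : s₁.arr q = s.arr q := hfr.2 q (by simp [clearEnds, forDown, Prog.writesArr, hqd])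
  have hs₁ : Enc e k s₁ := hs.congr (hfr.1 0 (by rfl)) (hfr.1 1 (by rfl)) (hfr.1 2 (by rfl))
    (hfr.2 0 (by simp [clearEnds, forDown, Prog.writesArr, hd0.symm]))
    (hfr.2 1 (by simp [clearEnds, forDown, Prog.writesArr, hd1.symm]))
  simp [e8, hs₁.reg1]
  refine ⟨by omega, by omega, by omega, by omega, by omega, ?_⟩
  refine (run_loop (fun s' => Enc e k s' ∧ s'.reg 9 = R ∧ s'.arr q = s.arr q ∧ s'.reg 10 ≤ R + 1 ∧
    SearchInv H e x (s.arr q) (s'.reg 10) (s'.arr d) (s'.arr p))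
    (fun s' => (R + 1 - s'.reg 10) * (13 * m + 6)) ?_ ?_).mono ?_
  · rintro s₂ ⟨hs₂, h9, hq, hle, hI⟩ htest
    simp [h9] at htest
    simp
    refine ⟨by omega, ?_⟩
    refine ((run_forDown (N := m) (K := 11) (fun j s' => Enc e k s' ∧ s'.arr q = s.arr q ∧
      s'.reg 10 = s₂.reg 10 ∧ s'.reg 17 = s₂.reg 10 + 1 ∧
      SearchInv H e x (s.arr q) (s₂.reg 10) (s'.arr d) (s'.arr p) ∧
      Scanned e (s.arr q) (s₂.reg 10) (s'.arr d) j) (by simpa using hs₂.reg1) (by omega) (by rfl)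
      ?_ ?_).frame).mono ?_
    · exact ⟨hs₂.congr (by simp) (by simp) (by simp) rfl rfl, hq, by simp, by simp, hI,
        fun i hi => absurd i.2 (by omega)⟩
    · rintro j hj s₃ ⟨h1, h2, h3, h4, h5, h6⟩ -
      refine ((run_scanEdge hdp hH (s := s₃.setReg 11 j)
        (h1.congr (by simp) (by simp) (by simp) rfl rfl) hW ⟨j, hj⟩ (by simp) h2
        (by simpa using h3) (by simpa using h4) (by omega) h5 h6).frame).mono ?_
      rintro T s₄ ⟨⟨hT, h7, h8⟩, hfr⟩
      refine ⟨hT, h1.congr ?_ ?_ ?_ ?_ ?_, ?_, ?_, ?_, h7, h8⟩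
      · exact hfr.1 0 (by rfl)
      · exact hfr.1 1 (by rfl)
      · exact hfr.1 2 (by rfl)
      · exact hfr.2 0 (by simp [scanEdge, Prog.writesArr, hd0.symm, hp0.symm])
      · exact hfr.2 1 (by simp [scanEdge, Prog.writesArr, hd1.symm, hp1.symm])
      · exact (hfr.2 q (by simp [scanEdge, Prog.writesArr, hqd, hqp])).trans h2
      · exact (hfr.1 10 (by rfl)).trans (by simpa using h3)
      · exact (hfr.1 17 (by rfl)).trans (by simpa using h4)
    · rintro T s₃ ⟨⟨hT, h1, h2, h3, h4, h5, h6⟩, hfr⟩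
      have e9' : s₃.reg 9 = R := (hfr.1 9 (by rfl)).trans (by simpa using h9)
      simp [h4, e9']
      refine ⟨by omega, ⟨h1.congr (by simp) (by simp) (by simp) rfl rfl, h2, by omega,
        h5.next hH h6⟩, ?_⟩
      obtain ⟨c, hc⟩ : ∃ c, R + 1 - s₂.reg 10 = c + 1 := ⟨R - s₂.reg 10, by omega⟩
      have hc' : R - s₂.reg 10 = c := by omega
      rw [hc, hc']
      nlinarith
  · refine ⟨hs₁.congr (by simp) (by simp) (by simp) (by simp [hd0.symm, hp0.symm])
      (by simp [hd1.symm, hp1.symm]), by simpa using e9, by simp [hqd, hqp, eq'],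
      by simp, ?_⟩
    simpa [hdp, hdp.symm] using SearchInv.init hclear
  · rintro T s₂ ⟨hT, ⟨h1, h2, h3, h4, h5⟩, htest⟩
    simp [h2] at htest
    simp at hT
    have : s₂.reg 10 = R + 1 := by omega
    rw [this] at h5
    refine ⟨by nlinarith, h5⟩

end WordRAM


/-! ### Closed trails from tree paths -/

namespace Spanner

open SimpleGraph

variable {V : Type*} {G : SimpleGraph V}

/-- `E` is a union of edge sets of short closed trails. -/
def IsCircuitUnion [DecidableEq V] (G : SimpleGraph V) (D : ℕ) (E : Finset (Sym2 V)) : Prop :=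
  ∃ 𝒞 : Finset (Finset (Sym2 V)), (∀ C ∈ 𝒞, IsShortCircuit G D C) ∧ 𝒞.biUnion id = E

theorem IsCircuitUnion.empty [DecidableEq V] (G : SimpleGraph V) (D : ℕ) :
    IsCircuitUnion G D ∅ := ⟨∅, by simp, by simp⟩

theorem IsCircuitUnion.union [DecidableEq V] {D : ℕ} {E C : Finset (Sym2 V)}
    (hE : IsCircuitUnion G D E) (hC : IsShortCircuit G D C) : IsCircuitUnion G D (E ∪ C) := by
  classical
  obtain ⟨𝒞, h, rfl⟩ := hE
  refine ⟨insert C 𝒞, fun C' h' => ?_, ?_⟩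
  · rcases Finset.mem_insert.1 h' with rfl | h'
    · exact hC
    · exact h C' h'
  · rw [Finset.biUnion_insert, Finset.union_comm]; rfl

/-- The edge `g` outside of the tree lies on a short closed trail within `E` whose other edges
belong to the tree. -/
def Captured (G : SimpleGraph V) (D : ℕ) (T : Set (Sym2 V)) (E : Finset (Sym2 V)) (g : Sym2 V) :
    Prop :=
  ∃ C ⊆ E, IsShortCircuit G D C ∧ g ∈ C ∧ ∀ g' ∈ C, g' ≠ g → g' ∈ T

theorem Captured.mono {D : ℕ} {T : Set (Sym2 V)} {E E' : Finset (Sym2 V)} {g : Sym2 V}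
    (h : Captured G D T E g) (hE : E ⊆ E') : Captured G D T E' g := by
  obtain ⟨C, h1, h2⟩ := h
  exact ⟨C, h1.trans hE, h2⟩

/-- If all edges outside of the tree whose ends have small total distance from the root `x` are
captured, then so are all edges at `x` on short closed trails: a tree edge at `x` is crossed by an
edge outside of the tree, whose closed trail has to return along the tree edge. -/
theorem IsBFSTree.mem_of_captured {x : V} {par : V → V} (hT : IsBFSTree G x par) {D : ℕ}
    {E : Finset (Sym2 V)}
    (hcap : ∀ c d, G.Adj c d → s(c, d) ∉ treeEdges G x par → G.Reachable x c →
      G.dist x c + G.dist x d ≤ D → Captured G D (treeEdges G x par) E s(c, d))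
    {C : Finset (Sym2 V)} (hC : IsShortCircuit G D C) {g : Sym2 V} (hxg : x ∈ g) (hg : g ∈ C) :
    g ∈ E := by
  have key : ∀ c d, s(c, d) ∈ C → s(c, d) ∉ treeEdges G x par →
      Captured G D (treeEdges G x par) E s(c, d) := fun c d h1 h2 =>
    hcap c d (hC.subset_edgeSet h1) h2 (hC.dist_le ⟨g, hg, hxg⟩ ⟨_, h1, by simp⟩).1.symm
      (hC.dist_add_dist_le ⟨g, hg, hxg⟩ h1)
  by_cases hgT : g ∈ treeEdges G x par
  · obtain ⟨w, hw, hne, rfl⟩ := hgT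
    obtain ⟨c, d, h1, h2, h3, h4⟩ := hT.exists_nontree_crossing hC hw hne hg
    obtain ⟨C', hE, hC', h5, h6⟩ := key c d h1 h2
    obtain ⟨c', d', h7, h8, h9, h10⟩ :=
      hC'.exists_other_crossing (S := {v | Desc x par w v}) h5 h3 h4
    rw [← eq_of_mem_treeEdges_of_desc (h6 _ h7 h8) h9 h10]
    exact hE h7
  · induction g with | _ c d
    obtain ⟨C', hE, -, h, -⟩ := key c d hg hgT
    exact hE h

/-- A state of the climb from the ends of the edge `g` outside of the tree to their closest common
ancestor: `E` is the edge set of a trail from `a` to `b` that consists of `g` and of tree edges from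
vertices that have been left. -/
def ClimbInv (G : SimpleGraph V) (x : V) (par : V → V) (g : Sym2 V) (N : ℕ) (a b : V)
    (E : Finset (Sym2 V)) : Prop :=
  ∃ q : G.Walk a b, q.IsTrail ∧ 0 < q.length ∧ q.length + G.dist x a + G.dist x b = N ∧
    (∀ h ∈ q.edges, h ≠ g → ∃ v, G.Reachable x v ∧ v ≠ x ∧ h = s(v, par v) ∧ v ≠ a ∧ v ≠ b ∧
      G.dist x a ≤ G.dist x v ∧ G.dist x b ≤ G.dist x v) ∧ g ∈ q.edges ∧ ∀ h, h ∈ E ↔ h ∈ q.edges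

theorem ClimbInv.init {x : V} (par : V → V) {a b : V} (hab : G.Adj a b) :
    ClimbInv G x par s(a, b) (G.dist x a + G.dist x b + 1) a b {s(a, b)} := by
  refine ⟨.cons hab .nil, by simp, by simp, by simp; omega, ?_, by simp, by simp⟩
  intro h h1 h2
  simp at h1
  exact absurd h1 h2

theorem ClimbInv.symm {x : V} {par : V → V} {g : Sym2 V} {N : ℕ} {a b : V} {E : Finset (Sym2 V)}
    (h : ClimbInv G x par g N a b E) : ClimbInv G x par g N b a E := by
  obtain ⟨q, h1, h2, h3, h4, h5, h6⟩ := h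
  refine ⟨q.reverse, by simpa using h1, by simpa using h2, by simp; omega, ?_, by simpa using h5,
    by simpa using h6⟩
  intro h hq hg
  obtain ⟨v, h7, h8, h9, h10, h11, h12, h13⟩ := h4 h (by simpa using hq) hg
  exact ⟨v, h7, h8, h9, h11, h10, h13, h12⟩

theorem ClimbInv.step [DecidableEq V] {x : V} {par : V → V} (hT : IsBFSTree G x par) {g : Sym2 V}
    (hg : g ∉ treeEdges G x par) {N : ℕ} {a b : V} {E : Finset (Sym2 V)}
    (h : ClimbInv G x par g N a b E) (ha : G.Reachable x a) (hab : a ≠ b) (hax : a ≠ x)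
    (hd : G.dist x b ≤ G.dist x a) :
    ClimbInv G x par g N (par a) b (insert s(a, par a) E) := by
  obtain ⟨q, h1, h2, h3, h4, h5, h6⟩ := h
  obtain ⟨h7, h8⟩ := hT a ha hax
  refine ⟨.cons h7.symm q, ?_, by simp, by simp; omega, ?_, by simp [h5], ?_⟩
  · rw [Walk.isTrail_cons]
    refine ⟨h1, fun hq => ?_⟩
    rw [Sym2.eq_swap] at hq
    obtain ⟨v, h9, h10, h11, h12, h13, h14, h15⟩ := h4 _ hq
      (by rintro rfl; exact hg ⟨a, ha, hax, rfl⟩)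
    rw [Sym2.eq_iff] at h11
    rcases h11 with ⟨h11, -⟩ | ⟨-, h11⟩
    · exact h12 h11.symm
    · rw [h11] at h8; omega
  · intro h hq hne
    rw [Walk.edges_cons, List.mem_cons] at hq
    rcases hq with rfl | hq
    · exact ⟨a, ha, hax, Sym2.eq_swap, h7.ne, hab, by omega, hd⟩
    · obtain ⟨v, h9, h10, h11, h12, h13, h14, h15⟩ := h4 h hq hne
      exact ⟨v, h9, h10, h11, by rintro rfl; omega, h13, by omega, h15⟩
  · intro h
    simp [h6, Sym2.eq_swap]

theorem ClimbInv.isShortCircuit {x : V} {par : V → V} {g : Sym2 V} {D N : ℕ} {a : V}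
    {E : Finset (Sym2 V)} (h : ClimbInv G x par g N a a E) (hN : N ≤ D + 1) :
    IsShortCircuit G D E ∧ g ∈ E ∧ ∀ g' ∈ E, g' ≠ g → g' ∈ treeEdges G x par := by
  obtain ⟨q, h1, h2, h3, h4, h5, h6⟩ := h
  refine ⟨⟨a, q, h1, h2, by omega, h6⟩, (h6 _).2 h5, fun g' h7 h8 => ?_⟩
  obtain ⟨v, h9, h10, h11, -⟩ := h4 g' ((h6 _).1 h7) h8
  exact ⟨v, h9, h10, h11⟩

end Spanner


/-! ### Collecting short closed trails -/

namespace WordRAM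

open SimpleGraph Spanner

variable {W : ℕ} {α β : ℝ} {n m k : ℕ} {e : Fin m → Fin n × Fin n} {G : SimpleGraph (Fin n)}

/-- The edge with number `i`. -/
def edge (e : Fin m → Fin n × Fin n) (i : Fin m) : Sym2 (Fin n) := s((e i).1, (e i).2)

/-- The first `len` entries of `l` are the numbers of the edges in `E`, and `fl` is nonzero exactly
for these numbers. -/
structure Lists (e : Fin m → Fin n × Fin n) (E : Finset (Sym2 (Fin n))) (len : ℕ) (l fl : ℕ → ℕ) :
    Prop where
  idx : ∀ j < len, ∃ i : Fin m, l j = i ∧ edge e i ∈ E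
  flag : ∀ i : Fin m, fl i ≠ 0 ↔ edge e i ∈ E
  surj : ∀ g ∈ E, ∃ j < len, ∃ i : Fin m, l j = i ∧ edge e i = g
  card : E.card = len

theorem Lists.len_le {E : Finset (Sym2 (Fin n))} {len : ℕ} {l fl : ℕ → ℕ}
    (h : Lists e E len l fl) : len ≤ m := by
  rw [← h.card]
  refine (Finset.card_le_card (t := Finset.univ.image (edge e)) fun g hg => ?_).trans
    (Finset.card_image_le.trans (by simp))
  obtain ⟨j, -, i, -, rfl⟩ := h.surj g hg
  simp

/-- Append the edge with number `R[r]` to the list in array `5`, unless it is there. -/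
def addEdge (r : ℕ) : Prog :=
  .load 22 6 (.reg r) ;; .ite (.eq (.reg 22) (.const 0))
    (.store 6 (.reg r) (.const 1) ;; .store 5 (.reg 5) (.reg r) ;;
      .arith .add 5 (.reg 5) (.const 1)) .skip

theorem run_addEdge {r : ℕ} (hr : r ≠ 22) {E : Finset (Sym2 (Fin n))} {s : State}
    (he : Function.Injective (edge e)) (h : Lists e E (s.reg 5) (s.arr 5) (s.arr 6)) (i : Fin m)
    (hi : s.reg r = i) (hW : 2 * (n + m + k + 2) ≤ W) :
    Run W α β (addEdge r) s fun T s' => T ≤ 5 ∧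
      Lists e (insert (edge e i) E) (s'.reg 5) (s'.arr 5) (s'.arr 6) := by
  have him := i.2
  have hlen := h.len_le
  simp [addEdge, hi]
  refine ⟨by omega, ?_⟩
  rw [run_ite]
  refine ⟨fun h0 => ?_, fun h0 => ?_⟩
  · simp at h0
    have hiE : edge e i ∉ E := fun h1 => (h.flag i).2 h1 h0
    have hupd : ∀ (g : ℕ → ℕ) (c : ℕ) (j : Fin m), j ≠ i → Function.update g (i : ℕ) c j = g j :=
      fun g c w hw => Function.update_of_ne (by simpa [Fin.ext_iff] using hw) _ _
    simp [hi, hr]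
    refine ⟨by omega, by omega, by omega, by omega, by omega, ?_, ?_, ?_, ?_⟩
    · intro j hj
      by_cases hj' : j = s.reg 5
      · exact ⟨i, by simp [hj'], by simp⟩
      · obtain ⟨i', h1, h2⟩ := h.idx j (by omega)
        exact ⟨i', by rw [Function.update_of_ne hj', h1], by simp [h2]⟩
    · intro i'
      by_cases hii : i' = i
      · simp [hii]
      · rw [hupd _ _ _ hii, h.flag, Finset.mem_insert, he.eq_iff]
        simp [hii]
    · intro g hg
      rcases Finset.mem_insert.1 hg with rfl | hg
      · exact ⟨s.reg 5, by omega, i, by simp, rfl⟩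
      · obtain ⟨j, h1, i', h2, h3⟩ := h.surj g hg
        exact ⟨j, by omega, i', by rw [Function.update_of_ne h1.ne, h2], h3⟩
    · rw [Finset.card_insert_of_notMem hiE, h.card]
  · simp at h0
    simp
    rwa [Finset.insert_eq_of_mem ((h.flag i).1 h0)]

/-- The outcome of the search with root `x` in `G` up to distance `R`. -/
structure IsSearchTree (G : SimpleGraph (Fin n)) (e : Fin m → Fin n × Fin n) (x : Fin n)
    (R : ℕ) (f pa : ℕ → ℕ) (par : Fin n → Fin n) : Prop where
  tree : IsBFSTree G x par
  root_par : pa x = m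
  sound : ∀ v : Fin n, Touched e x v → f v ≠ 0 → G.Reachable x v ∧ f v = G.dist x v + 1
  complete : ∀ v : Fin n, G.Reachable x v → G.dist x v ≤ R → f v ≠ 0
  bound : ∀ v : Fin n, Touched e x v → f v ≤ n
  par : ∀ v : Fin n, Touched e x v → v ≠ x → f v ≠ 0 → f (par v) ≠ 0 ∧
    ∃ i : Fin m, pa v = i ∧ edge e i = s(v, par v)

theorem SearchInv.exists_isSearchTree {x : Fin n} {R : ℕ} {f pa mask : ℕ → ℕ}
    (hH : Keeps e mask G) (h : SearchInv G e x mask (R + 1) f pa) :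
    ∃ par, IsSearchTree G e x R f pa par := by
  have hp : ∀ v : Fin n, ∃ u : Fin n, (Touched e x v ∧ f v ≠ 0) → v ≠ x →
      (G.Adj v u ∧ G.dist x u + 1 = G.dist x v) ∧ f u ≠ 0 ∧
        ∃ i : Fin m, pa v = i ∧ edge e i = s(v, u) := by
    intro v
    by_cases hv : (Touched e x v ∧ f v ≠ 0) ∧ v ≠ x
    · obtain ⟨⟨hv, h0⟩, hx⟩ := hv
      obtain ⟨i, h1, h2, u, h3, h4, h5⟩ := h.par v hv hx h0
      have h6 := (h.sound v hv h0).2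
      have h7 := (h.sound u (touched_of_edge h3) h4).2
      exact ⟨u, fun _ _ => ⟨⟨((hH u v).2 ⟨i, h2, h3⟩).symm, by omega⟩, h4, i, h1,
        h3.trans Sym2.eq_swap⟩⟩
    · exact ⟨v, fun h1 h2 => absurd ⟨h1, h2⟩ hv⟩
  choose par₀ hp using hp
  obtain ⟨par, hT, hpar⟩ := exists_isBFSTree_extending (G := G) x {v | Touched e x v ∧ f v ≠ 0} par₀
    (fun v hv hx => (hp v hv hx).1)
  refine ⟨par, hT, h.root_par, h.sound, fun v hv hd => h.complete v hv (by omega), ?_, ?_⟩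
  · intro v hv
    by_cases h0 : f v = 0
    · omega
    · obtain ⟨h1, h2⟩ := h.sound v hv h0
      obtain ⟨p, hp1, hp2⟩ := h1.exists_path_of_dist
      have := hp1.length_lt
      simp only [Fintype.card_fin] at this
      omega
  · intro v hv hx h0
    rw [hpar v ⟨hv, h0⟩]
    exact (hp v ⟨hv, h0⟩ hx).2

theorem IsSearchTree.touched_par {x : Fin n} {R : ℕ} {f pa : ℕ → ℕ} {par : Fin n → Fin n}
    (h : IsSearchTree G e x R f pa par) {v : Fin n} (hv : Touched e x v) (hx : v ≠ x)
    (h0 : f v ≠ 0) : Touched e x (par v) := by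
  obtain ⟨-, i, -, hi⟩ := h.par v hv hx h0
  exact touched_of_edge (hi.trans Sym2.eq_swap)

/-- `R[20] := |R[12] - R[13]|` -/
def diff : Prog :=
  .arith .sub 20 (.reg 12) (.reg 13) ;; .arith .sub 22 (.reg 13) (.reg 12) ;;
    .arith .add 20 (.reg 20) (.reg 22)

/-- Add the edge from the vertex in `R[r]` to its parent to the list, and go to the parent. -/
def climbStep (r : ℕ) : Prog :=
  .load 16 4 (.reg r) ;; addEdge 16 ;; .load 17 0 (.reg 16) ;; .load 22 1 (.reg 16) ;;
    .arith .add 17 (.reg 17) (.reg 22) ;; .arith .sub r (.reg 17) (.reg r)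

/-- From the vertices in `R[12]` and `R[13]`, climb to their closest common ancestor, adding the
edges to the list. -/
def climb : Prog :=
  diff ;; .loop (.le (.const 1) (.reg 20))
    (.load 14 3 (.reg 12) ;; .load 15 3 (.reg 13) ;;
      .ite (.le (.reg 15) (.reg 14)) (climbStep 12) (climbStep 13) ;; diff)

theorem run_diff {s : State} {a b : Fin n} (ha : s.reg 12 = a) (hb : s.reg 13 = b)
    (hW : 2 * (n + m + k + 2) ≤ W) :
    Run W α β diff s fun T s' => T = 3 ∧ (s'.reg 20 = 0 ↔ a = b) := by
  have ha' := a.2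
  have hb' := b.2
  simp [diff, ha, hb]
  rw [Fin.ext_iff]
  omega

theorem run_climbStep {r : ℕ} (hr : r = 12 ∨ r = 13) {E : Finset (Sym2 (Fin n))} {s : State}
    (he : Function.Injective (edge e)) (hs : Enc e k s)
    (h : Lists e E (s.reg 5) (s.arr 5) (s.arr 6)) {v w : Fin n} (hv : s.reg r = v) {i : Fin m}
    (hi : s.arr 4 v = i) (hvw : edge e i = s(v, w)) (hW : 2 * (n + m + k + 2) ≤ W) :
    Run W α β (climbStep r) s fun T s' => T ≤ 10 ∧ s'.reg r = w ∧
      Lists e (insert s(v, w) E) (s'.reg 5) (s'.arr 5) (s'.arr 6) := by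
  have hv' := v.2
  have him := i.2
  simp [climbStep, hv, hi]
  refine ⟨by omega, ?_⟩
  refine ((run_addEdge (r := 16) (k := k) (by decide) he (s := s.setReg 16 i) h i (by simp)
    hW).frame).mono ?_
  rintro T s₁ ⟨⟨hT, hL⟩, hfr⟩
  have h16 : s₁.reg 16 = i := (hfr.1 16 rfl).trans (by simp)
  have h0 : s₁.arr 0 i = (e i).1 := (congrFun (hfr.2 0 rfl) _).trans (hs.arr0 i)
  have h1 : s₁.arr 1 i = (e i).2 := (congrFun (hfr.2 1 rfl) _).trans (hs.arr1 i)
  have hr' : s₁.reg r = v := by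
    rcases hr with rfl | rfl
    · exact (hfr.1 12 rfl).trans (by simpa using hv)
    · exact (hfr.1 13 rfl).trans (by simpa using hv)
  have hb1 := (e i).1.2
  have hb2 := (e i).2.2
  have hr17 : r ≠ 17 ∧ r ≠ 22 ∧ 5 ≠ r := by omega
  have hsum : ((e i).1 : ℕ) + (e i).2 - v = w := by
    rw [edge, Sym2.eq_iff] at hvw
    rcases hvw with ⟨h2, h3⟩ | ⟨h2, h3⟩ <;> rw [h2, h3] <;> omega
  rw [hvw] at hL
  simp [h16, h0, h1, hr17, hr', hsum]
  exact ⟨by omega, by omega, by omega, by omega, hL⟩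

/-- The invariant of the loop of `climb`. -/
def ClimbState (e : Fin m → Fin n × Fin n) (k : ℕ) (G : SimpleGraph (Fin n)) (x : Fin n)
    (par : Fin n → Fin n) (f pa : ℕ → ℕ) (g : Sym2 (Fin n)) (N : ℕ) (E : Finset (Sym2 (Fin n)))
    (s : State) : Prop :=
  Enc e k s ∧ s.arr 3 = f ∧ s.arr 4 = pa ∧
    ∃ (a b : Fin n) (C : _), s.reg 12 = a ∧ s.reg 13 = b ∧ Touched e x a ∧ Touched e x b ∧
      f a ≠ 0 ∧ f b ≠ 0 ∧ ClimbInv G x par g (N + 1) a b C ∧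
      Lists e (E ∪ C) (s.reg 5) (s.arr 5) (s.arr 6) ∧ (s.reg 20 = 0 ↔ a = b)

/-- Every step lowers the distance of one of the two vertices from the root, whence the time
bound. -/
theorem run_climb {x : Fin n} {R : ℕ} {f pa : ℕ → ℕ} {par : Fin n → Fin n}
    (hT : IsSearchTree G e x R f pa par) {E C : Finset (Sym2 (Fin n))} {s : State}
    (he : Function.Injective (edge e)) (hs : Enc e k s) (h3 : s.arr 3 = f) (h4 : s.arr 4 = pa)
    {a b : Fin n} (ha : s.reg 12 = a) (hb : s.reg 13 = b) (hta : Touched e x a)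
    (htb : Touched e x b) (hfa : f a ≠ 0) (hfb : f b ≠ 0) {g : Sym2 (Fin n)}
    (hg : g ∉ treeEdges G x par) {N : ℕ} (hN : G.dist x a + G.dist x b ≤ N)
    (hC : ClimbInv G x par g (N + 1) a b C) (h : Lists e (E ∪ C) (s.reg 5) (s.arr 5) (s.arr 6))
    (hW : 2 * (n + m + k + 2) ≤ W) :
    Run W α β climb s fun T s' => T ≤ 17 * (N + 2) + 4 ∧
      ∃ C, Lists e (E ∪ C) (s'.reg 5) (s'.arr 5) (s'.arr 6) ∧ IsShortCircuit G N C ∧ g ∈ C ∧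
        ∀ g' ∈ C, g' ≠ g → g' ∈ treeEdges G x par := by
  rw [climb, run_seq]
  refine ((run_diff ha hb hW).frame).mono ?_
  rintro T₁ s₁ ⟨⟨rfl, h20⟩, hfr⟩
  refine (run_loop (ClimbState e k G x par f pa g N E)
    (fun s => 17 * (f (s.reg 12) + f (s.reg 13))) ?_ ?_).mono ?_
  · rintro s ⟨hs, h3, h4, a, b, C, ha, hb, hta, htb, hfa, hfb, hC, hL, h20⟩ htest
    simp at htest
    have hab : a ≠ b := fun h => by have := h20.2 h; omega
    have han := a.2
    have hbn := b.2
    obtain ⟨hra, hda⟩ := hT.sound a hta hfa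
    obtain ⟨hrb, hdb⟩ := hT.sound b htb hfb
    simp [ha, hb, h3]
    refine ⟨by omega, by omega, ?_⟩
    rw [run_ite]
    refine ⟨fun hle => ?_, fun hle => ?_⟩
    · simp at hle
      have hax : a ≠ x := by
        rintro rfl
        rw [SimpleGraph.dist_self] at hda
        have := hrb.dist_eq_zero_iff.1 (by omega : G.dist a b = 0)
        exact hab this
      obtain ⟨hfp, i, hi, hie⟩ := hT.par a hta hax hfa
      have hdp := (hT.sound _ (hT.touched_par hta hax hfa) hfp).2
      have hdp' := (hT.tree a hra hax).2
      refine ((run_climbStep (k := k) (r := 12) (.inl rfl) he (hs.congr ?_ ?_ ?_ ?_ ?_) (E := E ∪ C)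
        (v := a) ?_ ?_ (by simpa [h4] using hi) hie hW).frame).mono ?_ <;>
        try simp [ha, hL]
      rintro T₂ s₂ hT₂ h12 hL' hfr
      have h13 : s₂.reg 13 = b := (hfr.1 13 rfl).trans (by simpa using hb)
      refine ((run_diff h12 h13 hW).frame).mono ?_
      rintro T₃ s₃ ⟨⟨rfl, h20'⟩, hfr'⟩
      have e12 : s₃.reg 12 = par a := (hfr'.1 12 rfl).trans h12
      have e13 : s₃.reg 13 = b := (hfr'.1 13 rfl).trans h13
      refine ⟨⟨hs.congr ((hfr'.1 0 rfl).trans (hfr.1 0 rfl)) ((hfr'.1 1 rfl).trans (hfr.1 1 rfl))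
        ((hfr'.1 2 rfl).trans (hfr.1 2 rfl)) ((hfr'.2 0 rfl).trans (hfr.2 0 rfl))
        ((hfr'.2 1 rfl).trans (hfr.2 1 rfl)), ((hfr'.2 3 rfl).trans (hfr.2 3 rfl)).trans h3,
        ((hfr'.2 4 rfl).trans (hfr.2 4 rfl)).trans h4, par a, b, _, e12, e13,
        hT.touched_par hta hax hfa, htb, hfp, hfb,
        hC.step hT.tree hg hra hab hax (by omega), ?_, h20'⟩, ?_⟩
      · rw [hfr'.1 5 rfl, hfr'.2 5 rfl, hfr'.2 6 rfl, Finset.union_insert]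
        exact hL'
      · rw [e12, e13]; omega
    · simp at hle
      have hbx : b ≠ x := by
        rintro rfl
        rw [SimpleGraph.dist_self] at hdb
        omega
      obtain ⟨hfp, i, hi, hie⟩ := hT.par b htb hbx hfb
      have hdp := (hT.sound _ (hT.touched_par htb hbx hfb) hfp).2
      have hdp' := (hT.tree b hrb hbx).2
      refine ((run_climbStep (k := k) (r := 13) (.inr rfl) he (hs.congr ?_ ?_ ?_ ?_ ?_) (E := E ∪ C)
        (v := b) ?_ ?_ (by simpa [h4] using hi) hie hW).frame).mono ?_ <;>
        try simp [hb, hL]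
      rintro T₂ s₂ hT₂ h13 hL' hfr
      have h12 : s₂.reg 12 = a := (hfr.1 12 rfl).trans (by simpa using ha)
      refine ((run_diff h12 h13 hW).frame).mono ?_
      rintro T₃ s₃ ⟨⟨rfl, h20'⟩, hfr'⟩
      have e12 : s₃.reg 12 = a := (hfr'.1 12 rfl).trans h12
      have e13 : s₃.reg 13 = par b := (hfr'.1 13 rfl).trans h13
      refine ⟨⟨hs.congr ((hfr'.1 0 rfl).trans (hfr.1 0 rfl)) ((hfr'.1 1 rfl).trans (hfr.1 1 rfl))
        ((hfr'.1 2 rfl).trans (hfr.1 2 rfl)) ((hfr'.2 0 rfl).trans (hfr.2 0 rfl))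
        ((hfr'.2 1 rfl).trans (hfr.2 1 rfl)), ((hfr'.2 3 rfl).trans (hfr.2 3 rfl)).trans h3,
        ((hfr'.2 4 rfl).trans (hfr.2 4 rfl)).trans h4, a, par b, _, e12, e13, hta,
        hT.touched_par htb hbx hfb, hfa, hfp,
        (hC.symm.step hT.tree hg hrb hab.symm hbx (by omega)).symm, ?_, h20'⟩, ?_⟩
      · rw [hfr'.1 5 rfl, hfr'.2 5 rfl, hfr'.2 6 rfl, Finset.union_insert]
        exact hL'
      · rw [e12, e13]; omega
  · refine ⟨hs.congr (hfr.1 0 rfl) (hfr.1 1 rfl) (hfr.1 2 rfl) (hfr.2 0 rfl) (hfr.2 1 rfl),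
      (hfr.2 3 rfl).trans h3, (hfr.2 4 rfl).trans h4, a, b, C, (hfr.1 12 rfl).trans ha,
      (hfr.1 13 rfl).trans hb, hta, htb, hfa, hfb, hC, ?_, h20⟩
    rw [hfr.1 5 rfl, hfr.2 5 rfl, hfr.2 6 rfl]
    exact h
  · rintro T s' ⟨hT', ⟨-, -, -, a', b', C', -, -, -, -, -, -, hC', hL, h20'⟩, htest⟩
    simp at htest
    obtain rfl := h20'.1 htest
    refine ⟨?_, C', hL, hC'.isShortCircuit le_rfl⟩
    rw [hfr.1 12 rfl, hfr.1 13 rfl, ha, hb, (hT.sound a hta hfa).2, (hT.sound b htb hfb).2] at hT'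
    omega

end WordRAM


namespace WordRAM

open SimpleGraph Spanner

variable {W : ℕ} {α β : ℝ} {n m k D : ℕ} {e : Fin m → Fin n × Fin n} {G : SimpleGraph (Fin n)}

theorem edge_inj (hG : IsEdgeListing G e) : Function.Injective (edge e) := hG.1

theorem edge_mem (hG : IsEdgeListing G e) (i : Fin m) : edge e i ∈ G.edgeSet :=
  hG.2 ▸ Set.mem_range_self i

theorem exists_edge_eq (hG : IsEdgeListing G e) {g : Sym2 (Fin n)} (hg : g ∈ G.edgeSet) :
    ∃ i, edge e i = g := by
  rw [← hG.2] at hg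
  exact hg

theorem keeps_zero (hG : IsEdgeListing G e) {mask : ℕ → ℕ} (h : ∀ i : Fin m, mask i = 0) :
    Keeps e mask G := fun u v => by
  rw [← mem_edgeSet, ← hG.2]
  simp [h]

/-- The edge with number `i` is outside of the tree, and the total distance of its ends from the
root is at most `D`. -/
def Qualifies (e : Fin m → Fin n × Fin n) (D : ℕ) (f pa : ℕ → ℕ) (i : Fin m) : Prop :=
  f (e i).1 ≠ 0 ∧ f (e i).2 ≠ 0 ∧ pa (e i).1 ≠ i ∧ pa (e i).2 ≠ i ∧ f (e i).1 + f (e i).2 ≤ D + 2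

/-- The search tree does not contain a qualifying edge. -/
theorem IsSearchTree.of_qualifies {x : Fin n} {R : ℕ} {f pa : ℕ → ℕ} {par : Fin n → Fin n}
    (hG : IsEdgeListing G e) (hT : IsSearchTree G e x R f pa par) {i : Fin m}
    (h : Qualifies e D f pa i) : edge e i ∉ treeEdges G x par ∧ G.Reachable x (e i).1 ∧
      G.Reachable x (e i).2 ∧ G.dist x (e i).1 + G.dist x (e i).2 ≤ D := by
  obtain ⟨h1, h2, h3, h4, h5⟩ := h
  have ha := hT.sound _ (.inr ⟨i, .inl rfl⟩) h1
  have hb := hT.sound _ (.inr ⟨i, .inr rfl⟩) h2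
  refine ⟨?_, ha.1, hb.1, by omega⟩
  rintro ⟨v, hv, hvx, h⟩
  have hv' : v = (e i).1 ∨ v = (e i).2 := by
    rw [edge, Sym2.eq_iff] at h
    tauto
  have key : ∀ v : Fin n, f v ≠ 0 → Touched e x v → v ≠ x → edge e i = s(v, par v) → pa v = i := by
    intro v hv ht hvx h
    obtain ⟨-, j, hj, hje⟩ := hT.par v ht hvx hv
    rw [hj, edge_inj hG (hje.trans h.symm)]
  rcases hv' with rfl | rfl
  · exact h3 (key _ h1 (.inr ⟨i, .inl rfl⟩) hvx h)
  · exact h4 (key _ h2 (.inr ⟨i, .inr rfl⟩) hvx h)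

/-- A search up to distance `min D n` finds the ends of all edges with small total distance. -/
theorem IsSearchTree.qualifies {x : Fin n} {f pa : ℕ → ℕ} {par : Fin n → Fin n}
    (hT : IsSearchTree G e x (min D n) f pa par) {i : Fin m}
    (h : edge e i ∉ treeEdges G x par) (h1 : G.Reachable x (e i).1) (h2 : G.Reachable x (e i).2)
    (h3 : G.dist x (e i).1 + G.dist x (e i).2 ≤ D) : Qualifies e D f pa i := by
  have hn : ∀ v, G.Reachable x v → G.dist x v ≤ n := by
    intro v hv
    obtain ⟨p, hp1, hp2⟩ := hv.exists_path_of_dist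
    have := hp1.length_lt
    simp only [Fintype.card_fin] at this
    omega
  have ha := hT.complete _ h1 (le_min (by omega) (hn _ h1))
  have hb := hT.complete _ h2 (le_min (by omega) (hn _ h2))
  have ha' := hT.sound _ (.inr ⟨i, .inl rfl⟩) ha
  have hb' := hT.sound _ (.inr ⟨i, .inr rfl⟩) hb
  have key : ∀ v : Fin n, f v ≠ 0 → G.Reachable x v → Touched e x v → pa v = i →
      edge e i ∈ treeEdges G x par := by
    intro v hv hr ht hi
    by_cases hvx : v = x
    · subst hvx
      rw [hT.root_par] at hi
      exact absurd i.2 (by omega)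
    · obtain ⟨-, j, hj, hje⟩ := hT.par v ht hvx hv
      obtain rfl : j = i := Fin.ext (by omega)
      exact ⟨v, hr, hvx, hje⟩
  exact ⟨ha, hb, fun hi => h (key _ ha h1 (.inr ⟨i, .inl rfl⟩) hi),
    fun hi => h (key _ hb h2 (.inr ⟨i, .inr rfl⟩) hi), by omega⟩

/-- Set `R[21]` to `1` or `0` according to whether the edge with number `R[18]` qualifies, and load
its ends into `R[12]` and `R[13]`. -/
def classify : Prog :=
  .set 21 (.const 0) ;; .load 12 0 (.reg 18) ;; .load 13 1 (.reg 18) ;; .load 14 3 (.reg 12) ;;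
  .load 15 3 (.reg 13) ;; .load 16 4 (.reg 12) ;; .load 17 4 (.reg 13) ;;
  .ite (.eq (.reg 14) (.const 0)) .skip (.ite (.eq (.reg 15) (.const 0)) .skip
    (.ite (.eq (.reg 16) (.reg 18)) .skip (.ite (.eq (.reg 17) (.reg 18)) .skip
      (.arith .add 20 (.reg 14) (.reg 15) ;; .arith .sub 20 (.reg 20) (.const 2) ;;
        .ite (.stretch (.reg 20) (.const 1)) (.set 21 (.const 1)) .skip))))

theorem run_classify (hD : ∀ y : ℕ, (y : ℝ) ≤ α + β ↔ y ≤ D) {s : State} (hs : Enc e k s)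
    {f pa : ℕ → ℕ} (h3 : s.arr 3 = f) (h4 : s.arr 4 = pa)
    (hf : ∀ v : Fin n, (∃ i, v = (e i).1 ∨ v = (e i).2) → f v ≤ n) (i : Fin m)
    (hi : s.reg 18 = i) (hW : 2 * (n + m + k + 2) ≤ W) :
    Run W α β classify s fun T s' => T ≤ 15 ∧ s'.reg 12 = (e i).1 ∧ s'.reg 13 = (e i).2 ∧
      (s'.reg 21 ≠ 0 ↔ Qualifies e D f pa i) := by
  have h0 := hs.arr0 i
  have h1 := hs.arr1 i
  have hb0 := (e i).1.2
  have hb1 := (e i).2.2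
  have him := i.2
  have hf1 := hf _ ⟨i, .inl rfl⟩
  have hf2 := hf _ ⟨i, .inr rfl⟩
  simp [classify, h0, h1, h3, h4, hi, Qualifies]
  refine ⟨by omega, by omega, by omega, by omega, by omega, by omega, ?_⟩
  rw [run_ite]
  refine ⟨fun h => by simp at h; simp [h], fun h => ?_⟩
  simp at h
  rw [run_ite]
  refine ⟨fun h' => by simp at h'; simp [h'], fun h' => ?_⟩
  simp at h'
  rw [run_ite]
  refine ⟨fun h'' => by simp [hi] at h''; simp [h''], fun h'' => ?_⟩
  simp [hi] at h''
  rw [run_ite]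
  refine ⟨fun h5 => by simp [hi] at h5; simp [h5], fun h5 => ?_⟩
  simp [hi] at h5
  simp
  refine ⟨by omega, by omega, ?_⟩
  rw [run_ite]
  refine ⟨fun h6 => ?_, fun h6 => ?_⟩
  · rw [Test.Holds] at h6
    simp [-Nat.cast_add, -Nat.cast_sub, hD] at h6
    simp [h, h', h'', h5]
    omega
  · rw [Test.Holds] at h6
    simp [-Nat.cast_add, -Nat.cast_sub, hD] at h6
    simp [h, h', h'', h5]
    omega

/-- If the edge with number `R[18]` qualifies, add it and the tree paths from its ends to their
closest common ancestor to the list. The number of edges treated like this is kept in `R[19]` and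
is limited to `R[2]`. -/
def collectEdge : Prog :=
  .ite (.le (.reg 2) (.reg 19)) .skip
    (classify ;; .ite (.eq (.reg 21) (.const 0)) .skip
      (.arith .add 19 (.reg 19) (.const 1) ;; addEdge 18 ;; climb))

/-- Collect short closed trails from the edges outside of a search tree with root `R[4]`. -/
def collect : Prog :=
  .set 8 (.reg 4) ;; .set 9 (.reg 3) ;; bfs 3 4 9 ;; .set 19 (.const 0) ;;
    forDown 18 (.reg 1) collectEdge

/-- The invariant of the loop of `collect`: the edges with index at least `j` have been treated. -/
structure CollectInv (e : Fin m → Fin n × Fin n) (k D : ℕ) (G : SimpleGraph (Fin n)) (x : Fin n)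
    (par : Fin n → Fin n) (f pa : ℕ → ℕ) (E₀ : Finset (Sym2 (Fin n))) (j : ℕ) (s : State) :
    Prop where
  enc : Enc e k s
  arr3 : s.arr 3 = f
  arr4 : s.arr 4 = pa
  cnt : s.reg 19 ≤ k
  exists_union : ∃ E, IsCircuitUnion G D E ∧ E₀ ⊆ E ∧ Lists e E (s.reg 5) (s.arr 5) (s.arr 6) ∧
    E.card ≤ E₀.card + s.reg 19 * (D + 1) ∧
    (∃ N : Finset (Fin m), N.card = s.reg 19 ∧ ∀ i ∈ N, j ≤ i ∧ edge e i ∈ E ∧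
      Qualifies e D f pa i) ∧
    (s.reg 19 < k → ∀ i : Fin m, j ≤ i → Qualifies e D f pa i →
      Captured G D (treeEdges G x par) E (edge e i))

theorem run_collectEdge (hD : ∀ y : ℕ, (y : ℝ) ≤ α + β ↔ y ≤ D) (hG : IsEdgeListing G e)
    {x : Fin n} {R : ℕ} {f pa : ℕ → ℕ} {par : Fin n → Fin n} (hT : IsSearchTree G e x R f pa par)
    {E₀ : Finset (Sym2 (Fin n))} (i : Fin m) {s : State}
    (h : CollectInv e k D G x par f pa E₀ (i + 1) s) (hi : s.reg 18 = i)
    (hW : 2 * (n + m + k + 2) ≤ W) :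
    Run W α β collectEdge s fun T s' => T ≤ 17 * (D + 2) + 30 ∧
      CollectInv e k D G x par f pa E₀ i s' := by
  have hf := h.arr3
  obtain ⟨E, hE, hE₀, hL, hcard, ⟨N, hN, hNE⟩, hcap⟩ := h.exists_union
  have hcnt := h.cnt
  rw [collectEdge, run_ite]
  refine ⟨fun hk => ?_, fun hk => ?_⟩
  · simp [h.enc.reg2] at hk
    simp
    exact ⟨h.enc, h.arr3, h.arr4, h.cnt, E, hE, hE₀, hL, hcard,
      ⟨N, hN, fun i' hi' => ⟨by have := (hNE i' hi').1; omega, (hNE i' hi').2⟩⟩,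
      fun hlt => absurd hlt (by omega)⟩
  simp [h.enc.reg2] at hk
  rw [run_seq]
  refine ((run_classify hD h.enc h.arr3 h.arr4 (fun v hv => hT.bound v (.inr hv)) i hi
    hW).frame).mono ?_
  rintro T₁ s₁ ⟨⟨hT₁, h12, h13, h21⟩, hfr⟩
  have hs₁ : Enc e k s₁ := h.enc.congr (hfr.1 0 rfl) (hfr.1 1 rfl) (hfr.1 2 rfl) (hfr.2 0 rfl)
    (hfr.2 1 rfl)
  have e3 : s₁.arr 3 = f := (hfr.2 3 rfl).trans h.arr3
  have e4 : s₁.arr 4 = pa := (hfr.2 4 rfl).trans h.arr4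
  have e19 : s₁.reg 19 = s.reg 19 := hfr.1 19 rfl
  have e18 : s₁.reg 18 = i := (hfr.1 18 rfl).trans hi
  have hL₁ : Lists e E (s₁.reg 5) (s₁.arr 5) (s₁.arr 6) := by
    rwa [hfr.1 5 rfl, hfr.2 5 rfl, hfr.2 6 rfl]
  rw [run_ite]
  refine ⟨fun hq => ?_, fun hq => ?_⟩
  · simp at hq
    have hq' : ¬ Qualifies e D f pa i := fun h => h21.2 h hq
    simp
    refine ⟨by omega, hs₁, e3, e4, by omega, E, hE, hE₀, hL₁, by rwa [e19],
      ⟨N, by rwa [e19], fun i' hi' => ⟨by have := (hNE i' hi').1; omega, (hNE i' hi').2⟩⟩,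
      fun hlt i' hi' hQ => ?_⟩
    rcases Nat.eq_or_lt_of_le hi' with hii | hii
    · obtain rfl := Fin.ext hii
      exact absurd hQ hq'
    · exact hcap (by omega) i' hii hQ
  have hq' := h21.1 hq
  obtain ⟨hgT, hra, hrb, hdist⟩ := hT.of_qualifies hG hq'
  have hadj : G.Adj (e i).1 (e i).2 := edge_mem hG i
  simp
  refine ⟨by omega, ?_⟩
  refine ((run_addEdge (r := 18) (k := k) (by decide) (edge_inj hG)
    (s := s₁.setReg 19 (s₁.reg 19 + 1)) hL₁ i (by simpa using e18) hW).frame).mono ?_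
  rintro T₂ s₂ ⟨⟨hT₂, hL₂⟩, hfr₂⟩
  rw [Finset.insert_eq, Finset.union_comm] at hL₂
  have hs₂ : Enc e k s₂ := hs₁.congr (hfr₂.1 0 rfl) (hfr₂.1 1 rfl) (hfr₂.1 2 rfl) (hfr₂.2 0 rfl)
    (hfr₂.2 1 rfl)
  have e3' : s₂.arr 3 = f := (hfr₂.2 3 rfl).trans e3
  have e4' : s₂.arr 4 = pa := (hfr₂.2 4 rfl).trans e4
  refine ((run_climb hT (edge_inj hG) hs₂ e3' e4' ((hfr₂.1 12 rfl).trans h12)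
    ((hfr₂.1 13 rfl).trans h13) (.inr ⟨i, .inl rfl⟩) (.inr ⟨i, .inr rfl⟩) hq'.1 hq'.2.1 hgT le_rfl
    (ClimbInv.init par hadj) hL₂ hW).frame).mono ?_
  rintro T₃ s₃ ⟨⟨hT₃, C, hL₃, hC, hgC, hCT⟩, hfr₃⟩
  have hC' : IsShortCircuit G D C := by
    obtain ⟨v, c, h1, h2, h3, h4⟩ := hC
    exact ⟨v, c, h1, h2, by omega, h4⟩
  have e19' : s₃.reg 19 = s.reg 19 + 1 :=
    (hfr₃.1 19 rfl).trans ((hfr₂.1 19 rfl).trans (by simp [e19]))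
  have hcap' : Captured G D (treeEdges G x par) (E ∪ C) (edge e i) :=
    ⟨C, Finset.subset_union_right, hC', hgC, hCT⟩
  refine ⟨by nlinarith, hs₂.congr (hfr₃.1 0 rfl) (hfr₃.1 1 rfl) (hfr₃.1 2 rfl) (hfr₃.2 0 rfl)
    (hfr₃.2 1 rfl), (hfr₃.2 3 rfl).trans e3', (hfr₃.2 4 rfl).trans e4', by omega, E ∪ C,
    hE.union hC', hE₀.trans Finset.subset_union_left, hL₃, ?_, ⟨insert i N, ?_, ?_⟩, ?_⟩
  · have h1 := Finset.card_union_le E C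
    have h2 := hC'.card_le
    rw [e19']
    nlinarith
  · rw [Finset.card_insert_of_notMem (fun h => by have := (hNE i h).1; omega), hN, e19']
  · intro i' hi'
    rcases Finset.mem_insert.1 hi' with rfl | hi'
    · exact ⟨le_rfl, Finset.mem_union_right _ hgC, hq'⟩
    · obtain ⟨h1, h2, h3⟩ := hNE i' hi'
      exact ⟨by omega, Finset.mem_union_left _ h2, h3⟩
  · intro hlt i' hi' hQ
    rcases Nat.eq_or_lt_of_le hi' with hii | hii
    · obtain rfl := Fin.ext hii
      exact hcap'
    · exact (hcap (by omega) i' hii hQ).mono Finset.subset_union_left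

/-- The edges at `x` on short closed trails belong to `E`. -/
def Covers (G : SimpleGraph (Fin n)) (D : ℕ) (E : Finset (Sym2 (Fin n))) (x : Fin n) : Prop :=
  ∀ C, IsShortCircuit G D C → ∀ g ∈ C, x ∈ g → g ∈ E

/-- There are `k` edges in `E` whose removal leaves a spanner. -/
def HasSolutionIn (α β : ℝ) (G : SimpleGraph (Fin n)) (k : ℕ) (E : Finset (Sym2 (Fin n))) : Prop :=
  ∃ F ⊆ E, F.card = k ∧ IsSpanner α β G (G.deleteEdges (F : Set (Sym2 (Fin n))))

/-- After a run of `collect`, all edges at `x` on short closed trails are in the list, unless the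
limit of `k` edges outside of the search tree has been reached; these form a solution. -/
theorem run_collect (hα : 1 ≤ α) (hβ : 0 ≤ β) (hD : ∀ y : ℕ, (y : ℝ) ≤ α + β ↔ y ≤ D)
    (hG : IsEdgeListing G e) (x : Fin n) {E₀ : Finset (Sym2 (Fin n))} {s : State}
    (hs : Enc e k s) (h3 : s.reg 3 = min D n) (h4 : s.reg 4 = x) (h9 : ∀ i, s.arr 9 i = 0)
    (hE₀ : IsCircuitUnion G D E₀) (hL : Lists e E₀ (s.reg 5) (s.arr 5) (s.arr 6))
    (hW : 2 * (n + m + k + 2) ≤ W) :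
    Run W α β collect s fun T s' => T ≤ (D + 2) * (62 * m + 62) ∧
      ∃ E, IsCircuitUnion G D E ∧ E₀ ⊆ E ∧ Lists e E (s'.reg 5) (s'.arr 5) (s'.arr 6) ∧
        E.card ≤ E₀.card + k * (D + 1) ∧ (Covers G D E x ∨ HasSolutionIn α β G k E) := by
  have hx := x.2
  have hR : min D n ≤ n := min_le_right _ _
  have hR' : min D n ≤ D := min_le_left _ _
  simp [collect, h4, h3]
  refine ⟨by omega, by omega, ?_⟩
  refine ((run_bfs (d := 3) (p := 4) (q := 9) (R := min D n) (H := G) (x := x) (by decide)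
    (by decide) (by decide) (by decide) (by decide) (by decide) (by decide)
    (s := (s.setReg 8 x).setReg 9 (min D n)) (hs.congr (by simp) (by simp) (by simp) rfl rfl) hW
    (keeps_zero hG fun i => h9 i) (by simp) (by simp) hR).frame).mono ?_
  rintro T₁ s₁ ⟨⟨hT₁, hI⟩, hfr⟩
  obtain ⟨par, hT⟩ := hI.exists_isSearchTree (keeps_zero hG fun i => h9 i)
  have hs₁ : Enc e k s₁ := hs.congr ((hfr.1 0 rfl).trans (by simp)) ((hfr.1 1 rfl).trans (by simp))
    ((hfr.1 2 rfl).trans (by simp)) (hfr.2 0 rfl) (hfr.2 1 rfl)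
  have hL₁ : Lists e E₀ (s₁.reg 5) (s₁.arr 5) (s₁.arr 6) := by
    have h5 : s₁.reg 5 = s.reg 5 := (hfr.1 5 rfl).trans (by simp)
    have h6 : s₁.arr 5 = s.arr 5 := hfr.2 5 rfl
    have h7 : s₁.arr 6 = s.arr 6 := hfr.2 6 rfl
    rwa [h5, h6, h7]
  refine ⟨by omega, ?_⟩
  refine (run_forDown (N := m) (K := 17 * (D + 2) + 30)
    (CollectInv e k D G x par (s₁.arr 3) (s₁.arr 4) E₀) (by simpa using hs₁.reg1) (by omega)
    (by rfl) ?_ ?_).mono ?_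
  · exact ⟨hs₁.congr (by simp) (by simp) (by simp) rfl rfl, rfl, rfl, by simp, E₀, hE₀, subset_rfl,
      hL₁, by simp, ⟨∅, by simp, by simp⟩, fun _ i hi => absurd i.2 (by omega)⟩
  · rintro j hj s₂ h2 -
    refine run_collectEdge hD hG hT ⟨j, hj⟩ ⟨h2.enc.congr (by simp) (by simp) (by simp) rfl rfl,
      h2.arr3, h2.arr4, by simpa using h2.cnt, ?_⟩ (by simp) hW
    simpa using h2.exists_union
  · rintro T s₂ ⟨hT₂, h2⟩
    obtain ⟨E, hE, hE₀, hL, hcard, ⟨N, hN, hNE⟩, hcap⟩ := h2.exists_union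
    have hcnt := h2.cnt
    refine ⟨?_, E, hE, hE₀, hL, hcard.trans ?_, ?_⟩
    · have h1 : (min D n + 1) * (13 * m + 8) ≤ (D + 2) * (13 * m + 8) :=
        Nat.mul_le_mul_right _ (by omega)
      nlinarith
    · gcongr
    · by_cases hk : s₂.reg 19 < k
      · left
        intro C hC g hg hxg
        refine hT.tree.mem_of_captured (fun c d hcd h5 h6 h7 => ?_) hC hxg hg
        obtain ⟨i, hi⟩ := exists_edge_eq hG ((mem_edgeSet G).2 hcd)
        rw [← hi] at h5 ⊢
        refine hcap hk i (Nat.zero_le _) (hT.qualifies h5 ?_ ?_ ?_) <;>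
          (rw [edge, Sym2.eq_iff] at hi; rcases hi with ⟨h8, h9⟩ | ⟨h8, h9⟩) <;>
          simp only [h8, h9]
        · exact h6
        · exact h6.trans hcd.reachable
        · exact h6.trans hcd.reachable
        · exact h6
        · exact h7
        · omega
      · right
        refine ⟨N.image (edge e), ?_, ?_, ?_⟩
        · intro g hg
          obtain ⟨i, hi, rfl⟩ := Finset.mem_image.1 hg
          exact (hNE i hi).2.1
        · rw [Finset.card_image_of_injective _ (edge_inj hG)]
          omega
        · have hq : ∀ a b, s(a, b) ∈ ((N.image (edge e) : Finset _) : Set (Sym2 (Fin n))) →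
              G.Reachable x a ∧ G.dist x a + G.dist x b ≤ D := by
            intro a b hab
            obtain ⟨i, hi, h5⟩ := Finset.mem_image.1 (Finset.mem_coe.1 hab)
            obtain ⟨-, h6, h7, h8⟩ := hT.of_qualifies hG (hNE i hi).2.2
            rw [edge, Sym2.eq_iff] at h5
            rcases h5 with ⟨h5, h9⟩ | ⟨h5, h9⟩ <;> rw [h5] at h6 h8 <;> rw [h9] at h7 h8
            · exact ⟨h6, h8⟩
            · exact ⟨h7, by omega⟩
          refine hT.tree.isSpanner_deleteEdges hα hβ ((hD D).2 le_rfl) ?_ ?_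
            (fun a b h => (hq a b h).1) (fun a b h => (hq a b h).2)
          · intro g hg
            obtain ⟨i, hi, rfl⟩ := Finset.mem_image.1 (Finset.mem_coe.1 hg)
            exact edge_mem hG i
          · intro g hg
            obtain ⟨i, hi, rfl⟩ := Finset.mem_image.1 (Finset.mem_coe.1 hg)
            exact (hT.of_qualifies hG (hNE i hi).2.2).1

end WordRAM


/-! ### Testing a candidate -/

namespace WordRAM

open SimpleGraph Spanner

variable {W : ℕ} {α β : ℝ} {n m k : ℕ} {e : Fin m → Fin n × Fin n} {G H : SimpleGraph (Fin n)}

/-- The entries of array `5` at the indices in array `7` are the numbers `c 0, …, c (k - 1)`. -/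
structure Chosen (e : Fin m → Fin n × Fin n) (c : Fin k → Fin m) (s : State) : Prop where
  enc : Enc e k s
  lt : ∀ j : Fin k, s.arr 7 j < m
  eq : ∀ j : Fin k, s.arr 5 (s.arr 7 j) = c j

theorem Chosen.congr {c : Fin k → Fin m} {s s' : State} (h : Chosen e c s)
    (h0 : s'.reg 0 = s.reg 0) (h1 : s'.reg 1 = s.reg 1) (h2 : s'.reg 2 = s.reg 2)
    (h3 : s'.arr 0 = s.arr 0) (h4 : s'.arr 1 = s.arr 1) (h5 : s'.arr 5 = s.arr 5)
    (h7 : s'.arr 7 = s.arr 7) : Chosen e c s' :=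
  ⟨h.enc.congr h0 h1 h2 h3 h4, h7 ▸ h.lt, by rw [h5, h7]; exact h.eq⟩

/-- Mark the chosen edges in array `2`, and count them in `R[24]`. -/
def markChosen : Prog :=
  forDown 23 (.reg 1) (.store 2 (.reg 23) (.const 0)) ;; .set 24 (.const 0) ;;
  forDown 23 (.reg 2) (.load 25 7 (.reg 23) ;; .load 26 5 (.reg 25) ;; .load 27 2 (.reg 26) ;;
    .ite (.eq (.reg 27) (.const 0))
      (.store 2 (.reg 26) (.const 1) ;; .arith .add 24 (.reg 24) (.const 1)) .skip)

theorem run_markChosen {c : Fin k → Fin m} {s : State} (hs : Chosen e c s)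
    (hW : 2 * (n + m + k + 2) ≤ W) :
    Run W α β markChosen s fun T s' => T ≤ 3 * m + 8 * k + 5 ∧
      (∀ i : Fin m, s'.arr 2 i ≠ 0 ↔ ∃ j, c j = i) ∧
      (s'.reg 24 = k ↔ Function.Injective c) := by
  rw [markChosen, run_seq]
  refine ((run_forDown (N := m) (K := 1) (fun j s => ∀ i : Fin m, j ≤ i → s.arr 2 i = 0)
    (by simpa using hs.enc.reg1) (by omega) (by rfl) (fun i hi => absurd i.2 (by omega))
    ?_).frame).mono ?_
  · intro j hj s' h _
    simp
    refine ⟨by omega, by omega, fun i hi => ?_⟩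
    by_cases hij : (i : ℕ) = j
    · simp [hij]
    · rw [Function.update_of_ne hij]
      exact h i (by omega)
  rintro T₁ s₁ ⟨⟨hT₁, hz⟩, hfr⟩
  have hs₁ : Chosen e c s₁ := hs.congr (hfr.1 0 rfl) (hfr.1 1 rfl) (hfr.1 2 rfl) (hfr.2 0 rfl)
    (hfr.2 1 rfl) (hfr.2 5 rfl) (hfr.2 7 rfl)
  simp
  refine ⟨by omega, ?_⟩
  refine ((run_forDown (N := k) (K := 6) (fun j s => Chosen e c s ∧
    s.reg 24 = ((Finset.univ.filter fun i : Fin k => j ≤ i).image c).card ∧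
    ∀ i : Fin m, s.arr 2 i ≠ 0 ↔ ∃ j' : Fin k, j ≤ j' ∧ c j' = i)
    (by simpa using hs₁.enc.reg2) (by omega) (by rfl) ?_ ?_)).mono ?_
  · refine ⟨hs₁.congr (by simp) (by simp) (by simp) rfl rfl rfl rfl, ?_, fun i => ?_⟩
    · rw [Finset.filter_false_of_mem (fun i _ => by omega)]
      simp
    · simp [hz i (Nat.zero_le _)]
  · rintro j hj s₂ ⟨h1, h2, h3⟩ -
    have h7 := h1.lt ⟨j, hj⟩
    have h5 := h1.eq ⟨j, hj⟩
    have hc := (c ⟨j, hj⟩).2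
    have hfilter : (Finset.univ.filter fun i : Fin k => j ≤ i).image c =
        insert (c ⟨j, hj⟩) ((Finset.univ.filter fun i : Fin k => j + 1 ≤ i).image c) := by
      rw [← Finset.image_insert]
      congr 1
      ext i
      simp [Fin.ext_iff]
      omega
    have hex : ∀ i : Fin m, (∃ j' : Fin k, j ≤ j' ∧ c j' = i) ↔
        c ⟨j, hj⟩ = i ∨ ∃ j' : Fin k, j + 1 ≤ j' ∧ c j' = i := by
      intro i
      constructor
      · rintro ⟨j', h4, h5⟩
        rcases Nat.eq_or_lt_of_le h4 with h6 | h6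
        · obtain rfl : (⟨j, hj⟩ : Fin k) = j' := Fin.ext h6
          exact .inl h5
        · exact .inr ⟨j', h6, h5⟩
      · rintro (h4 | ⟨j', h4, h5⟩)
        · exact ⟨⟨j, hj⟩, le_rfl, h4⟩
        · exact ⟨j', by omega, h5⟩
    have hle : ((Finset.univ.filter fun i : Fin k => j + 1 ≤ i).image c).card ≤ k :=
      Finset.card_image_le.trans ((Finset.card_filter_le _ _).trans (by simp))
    simp only [] at h7 h5
    simp [h5]
    refine ⟨by omega, by omega, by omega, ?_⟩
    rw [run_ite]
    refine ⟨fun h0 => ?_, fun h0 => ?_⟩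
    · simp at h0
      have hnot : c ⟨j, hj⟩ ∉ (Finset.univ.filter fun i : Fin k => j + 1 ≤ i).image c := by
        intro hmem
        obtain ⟨j', h4, h6⟩ := Finset.mem_image.1 hmem
        exact (h3 (c ⟨j, hj⟩)).2 ⟨j', by simpa using h4, h6⟩ h0
      simp
      refine ⟨by omega, by omega, by omega, h1.congr (by simp) (by simp) (by simp) (by simp)
        (by simp) (by simp) (by simp), ?_, fun i => ?_⟩
      · rw [hfilter, Finset.card_insert_of_notMem hnot, h2]
      · rw [hex, ← h3]
        by_cases hi : i = c ⟨j, hj⟩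
        · simp [hi]
        · rw [Function.update_of_ne (by simpa [Fin.ext_iff] using hi)]
          simp [Ne.symm hi]
    · simp at h0
      have hmem := (h3 (c ⟨j, hj⟩)).1 h0
      simp
      refine ⟨h1.congr (by simp) (by simp) (by simp) rfl rfl rfl rfl, ?_, fun i => ?_⟩
      · rw [hfilter, Finset.insert_eq_of_mem, h2]
        obtain ⟨j', h4, h6⟩ := hmem
        exact Finset.mem_image.2 ⟨j', by simpa using h4, h6⟩
      · rw [hex, ← ne_eq, h3]
        constructor
        · exact .inr
        · rintro (rfl | h)
          · exact hmem
          · exact h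
  · rintro T₂ s₂ ⟨hT₂, h1, h2, h3⟩
    refine ⟨by omega, by simpa using h3, ?_⟩
    rw [h2]
    simp only [Nat.zero_le, Finset.filter_true]
    have := Finset.card_image_iff (s := (Finset.univ : Finset (Fin k))) (f := c)
    simp only [Finset.card_univ, Fintype.card_fin, Finset.coe_univ, Set.injOn_univ] at this
    exact this

/-- The distance of `a` and `d` in `H` is as the definition of a spanner demands. -/
def PairOK (α β : ℝ) (G H : SimpleGraph (Fin n)) (a d : Fin n) : Prop :=
  G.Reachable a d → H.Reachable a d ∧ (H.dist a d : ℝ) ≤ α * G.dist a d + β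

/-- Set `R[28]` to `0` unless the distances from the root to the vertex in `R[31]` in the arrays `3`
and `8` are as the definition of a spanner demands. -/
def checkEnd : Prog :=
  .load 32 3 (.reg 31) ;; .load 33 8 (.reg 31) ;;
  .ite (.eq (.reg 32) (.const 0)) .skip
    (.ite (.eq (.reg 33) (.const 0)) (.set 28 (.const 0))
      (.arith .sub 32 (.reg 32) (.const 1) ;; .arith .sub 33 (.reg 33) (.const 1) ;;
        .ite (.stretch (.reg 33) (.reg 32)) .skip (.set 28 (.const 0))))

/-- Check the vertex in `R[8]` together with all ends of chosen edges. -/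
def checkRoot : Prog :=
  .set 9 (.reg 0) ;; bfs 3 4 9 ;; bfs 8 10 2 ;;
  forDown 29 (.reg 2) (.load 30 7 (.reg 29) ;; .load 30 5 (.reg 30) ;; .load 31 0 (.reg 30) ;;
    checkEnd ;; .load 31 1 (.reg 30) ;; checkEnd)

/-- Set `R[28]` to `1` or `0` according to whether the chosen edges are distinct and their removal
leaves a spanner. -/
def testChosen : Prog :=
  markChosen ;;
  (.set 28 (.const 0) ;; .ite (.eq (.reg 24) (.reg 2)) (.set 28 (.const 1)) .skip) ;;
  forDown 23 (.reg 2) (.load 25 7 (.reg 23) ;; .load 26 5 (.reg 25) ;; .load 8 0 (.reg 26) ;;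
    checkRoot ;; .load 8 1 (.reg 26) ;; checkRoot)

theorem SearchInv.ne_zero_iff {x : Fin n} {mask f pa : ℕ → ℕ}
    (h : SearchInv H e x mask (n + 1) f pa) {v : Fin n} (hv : Touched e x v) :
    f v ≠ 0 ↔ H.Reachable x v := by
  refine ⟨fun h0 => (h.sound v hv h0).1, fun hr => h.complete v hr ?_⟩
  obtain ⟨p, hp1, hp2⟩ := hr.exists_path_of_dist
  have := hp1.length_lt
  simp only [Fintype.card_fin] at this
  omega

theorem run_checkEnd {a y : Fin n} (hy : Touched e a y) {mask₁ mask₂ f₁ f₂ pa₁ pa₂ : ℕ → ℕ}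
    (h₁ : SearchInv G e a mask₁ (n + 1) f₁ pa₁) (h₂ : SearchInv H e a mask₂ (n + 1) f₂ pa₂)
    {s : State} (h3 : s.arr 3 = f₁) (h8 : s.arr 8 = f₂) (h31 : s.reg 31 = y)
    (hW : 2 * (n + m + k + 2) ≤ W) :
    Run W α β checkEnd s fun T s' => T ≤ 8 ∧
      (s'.reg 28 ≠ 0 ↔ s.reg 28 ≠ 0 ∧ PairOK α β G H a y) := by
  have hyn := y.2
  have e1 := h₁.ne_zero_iff hy
  have e2 := h₂.ne_zero_iff hy
  have e3 := h₁.sound y hy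
  have e4 := h₂.sound y hy
  have b1 := h₁.bound y hy
  have b2 := h₂.bound y hy
  simp [checkEnd, h3, h8, h31]
  refine ⟨by omega, ?_⟩
  rw [run_ite]
  refine ⟨fun h => ?_, fun h => ?_⟩
  · simp at h
    have : ¬ G.Reachable a y := fun hr => e1.2 hr h
    simp [PairOK, this]
  simp at h
  obtain ⟨hr, hd⟩ := e3 h
  rw [run_ite]
  refine ⟨fun h' => ?_, fun h' => ?_⟩
  · simp at h'
    have : ¬ H.Reachable a y := fun hr => e2.2 hr h'
    simp [PairOK, this, hr]
    omega
  simp at h'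
  obtain ⟨hr', hd'⟩ := e4 h'
  simp
  refine ⟨by omega, by omega, ?_⟩
  rw [run_ite]
  refine ⟨fun h5 => ?_, fun h5 => ?_⟩
  · simp [hd, hd'] at h5
    simp [PairOK, hr, hr', h5]
  · simp [hd, hd'] at h5
    simp [PairOK, hr, hr', h5]
    omega

theorem run_checkRoot (hG : IsEdgeListing G e) {c : Fin k → Fin m} {a : Fin n} {s : State}
    (hs : Chosen e c s) (h8 : s.reg 8 = a) (h9 : ∀ i, s.arr 9 i = 0) (hH : Keeps e (s.arr 2) H)
    (hkm : k ≤ m) (hW : 2 * (n + m + k + 2) ≤ W) :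
    Run W α β checkRoot s fun T s' => T ≤ (n + 1) * (50 * m + 19) ∧
      (s'.reg 28 ≠ 0 ↔ s.reg 28 ≠ 0 ∧
        ∀ j, PairOK α β G H a (e (c j)).1 ∧ PairOK α β G H a (e (c j)).2) := by
  simp [checkRoot, hs.enc.reg0]
  refine ⟨by omega, ?_⟩
  refine ((run_bfs (d := 3) (p := 4) (q := 9) (R := n) (H := G) (x := a) (by decide)
    (by decide) (by decide) (by decide) (by decide) (by decide) (by decide)
    (s := s.setReg 9 n) (hs.enc.congr (by simp) (by simp) (by simp) rfl rfl) hW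
    (keeps_zero hG fun i => h9 i) (by simpa using h8) (by simp) le_rfl).frame).mono ?_
  rintro T₁ s₁ ⟨⟨hT₁, hI₁⟩, hfr₁⟩
  have hs₁ : Chosen e c s₁ := hs.congr ((hfr₁.1 0 rfl).trans (by simp))
    ((hfr₁.1 1 rfl).trans (by simp)) ((hfr₁.1 2 rfl).trans (by simp)) (hfr₁.2 0 rfl) (hfr₁.2 1 rfl)
    (hfr₁.2 5 rfl) (hfr₁.2 7 rfl)
  have e2 : s₁.arr 2 = s.arr 2 := hfr₁.2 2 rfl
  refine ((run_bfs (d := 8) (p := 10) (q := 2) (R := n) (H := H) (x := a) (by decide)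
    (by decide) (by decide) (by decide) (by decide) (by decide) (by decide)
    hs₁.enc hW (by rwa [e2]) ((hfr₁.1 8 rfl).trans (by simpa using h8))
    ((hfr₁.1 9 rfl).trans (by simp)) le_rfl).frame).mono ?_
  rintro T₂ s₂ ⟨⟨hT₂, hI₂⟩, hfr₂⟩
  have hs₂ : Chosen e c s₂ := hs₁.congr (hfr₂.1 0 rfl) (hfr₂.1 1 rfl) (hfr₂.1 2 rfl) (hfr₂.2 0 rfl)
    (hfr₂.2 1 rfl) (hfr₂.2 5 rfl) (hfr₂.2 7 rfl)
  have e3 : s₂.arr 3 = s₁.arr 3 := hfr₂.2 3 rfl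
  have e28 : s₂.reg 28 = s.reg 28 := (hfr₂.1 28 rfl).trans ((hfr₁.1 28 rfl).trans (by simp))
  refine (run_forDown (N := k) (K := 20) (fun j s' => Chosen e c s' ∧ s'.arr 3 = s₁.arr 3 ∧
    s'.arr 8 = s₂.arr 8 ∧ (s'.reg 28 ≠ 0 ↔ s.reg 28 ≠ 0 ∧ ∀ j' : Fin k, j ≤ j' →
      PairOK α β G H a (e (c j')).1 ∧ PairOK α β G H a (e (c j')).2))
    (by simpa using hs₂.enc.reg2) (by omega) (by rfl) ?_ ?_).mono ?_
  · exact ⟨hs₂.congr (by simp) (by simp) (by simp) rfl rfl rfl rfl, e3, rfl, by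
      simp only [setReg_reg]
      rw [if_neg (by decide), e28]
      exact ⟨fun h => ⟨h, fun j hj => absurd j.2 (by omega)⟩, fun h => h.1⟩⟩
  · rintro j hj s₃ ⟨h1, h2, h3, h4⟩ -
    have l7 := h1.lt ⟨j, hj⟩
    have l5 := h1.eq ⟨j, hj⟩
    have l0 := h1.enc.arr0 (c ⟨j, hj⟩)
    have l1 := h1.enc.arr1 (c ⟨j, hj⟩)
    have hc := (c ⟨j, hj⟩).2
    simp only [] at l7 l5
    simp [l5, l0]
    refine ⟨by omega, by omega, by omega, ?_⟩
    refine ((run_checkEnd (k := k) (y := (e (c ⟨j, hj⟩)).1) (.inr ⟨_, .inl rfl⟩) hI₁ hI₂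
      (by simpa using h2) (by simpa using h3) (by simp) hW).frame).mono ?_
    rintro T₄ s₄ ⟨⟨hT₄, h5⟩, hfr₄⟩
    have l30 : s₄.reg 30 = c ⟨j, hj⟩ := (hfr₄.1 30 rfl).trans (by simp)
    have l1' : s₄.arr 1 (c ⟨j, hj⟩) = (e (c ⟨j, hj⟩)).2 := (congrFun (hfr₄.2 1 rfl) _).trans l1
    have hs₄ : Chosen e c s₄ := h1.congr ((hfr₄.1 0 rfl).trans (by simp))
      ((hfr₄.1 1 rfl).trans (by simp)) ((hfr₄.1 2 rfl).trans (by simp)) (hfr₄.2 0 rfl)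
      (hfr₄.2 1 rfl) (hfr₄.2 5 rfl) (hfr₄.2 7 rfl)
    simp [l30, l1']
    refine ⟨by omega, ?_⟩
    refine ((run_checkEnd (k := k) (y := (e (c ⟨j, hj⟩)).2) (.inr ⟨_, .inr rfl⟩) hI₁ hI₂
      (by simpa using (hfr₄.2 3 rfl).trans h2) (by simpa using (hfr₄.2 8 rfl).trans h3) (by simp)
      hW).frame).mono ?_
    rintro T₅ s₅ ⟨⟨hT₅, h6⟩, hfr₅⟩
    refine ⟨by omega, hs₄.congr ((hfr₅.1 0 rfl).trans (by simp)) ((hfr₅.1 1 rfl).trans (by simp))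
      ((hfr₅.1 2 rfl).trans (by simp)) (hfr₅.2 0 rfl) (hfr₅.2 1 rfl) (hfr₅.2 5 rfl) (hfr₅.2 7 rfl),
      (hfr₅.2 3 rfl).trans ((hfr₄.2 3 rfl).trans h2),
      (hfr₅.2 8 rfl).trans ((hfr₄.2 8 rfl).trans h3), ?_⟩
    simp at h5 h6 h4
    simp [h6, h5, h4]
    constructor
    · rintro ⟨⟨⟨h7, h8⟩, h9⟩, h10⟩
      refine ⟨h7, fun j' hj' => ?_⟩
      rcases Nat.eq_or_lt_of_le hj' with h11 | h11
      · obtain rfl : (⟨j, hj⟩ : Fin k) = j' := Fin.ext h11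
        exact ⟨h9, h10⟩
      · exact h8 j' h11
    · rintro ⟨h7, h8⟩
      exact ⟨⟨⟨h7, fun j' hj' => h8 j' (by omega)⟩, (h8 ⟨j, hj⟩ le_rfl).1⟩, (h8 ⟨j, hj⟩ le_rfl).2⟩
  · rintro T₃ s₃ ⟨hT₃, -, -, -, h4⟩
    refine ⟨?_, by simpa using h4⟩
    nlinarith

theorem run_testChosen (hα : 1 ≤ α) (hβ : 0 ≤ β) (hG : IsEdgeListing G e) {c : Fin k → Fin m}
    {s : State} (hs : Chosen e c s) (h9 : ∀ i, s.arr 9 i = 0) (hk : 1 ≤ k) (hkm : k ≤ m)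
    (hW : 2 * (n + m + k + 2) ≤ W) :
    Run W α β testChosen s fun T s' => T ≤ k * ((n + 1) * (120 * m + 60)) ∧
      (∀ i : Fin m, s'.arr 2 i ≠ 0 ↔ ∃ j, c j = i) ∧
      (s'.reg 28 ≠ 0 ↔ Function.Injective c ∧
        IsSpanner α β G (G.deleteEdges (Set.range fun j => edge e (c j)))) := by
  set H := G.deleteEdges (Set.range fun j => edge e (c j)) with hHdef
  rw [testChosen, run_seq]
  refine ((run_markChosen hs hW).frame).mono ?_
  rintro T₁ s₁ ⟨⟨hT₁, hmask, h24⟩, hfr₁⟩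
  have hs₁ : Chosen e c s₁ := hs.congr (hfr₁.1 0 rfl) (hfr₁.1 1 rfl) (hfr₁.1 2 rfl) (hfr₁.2 0 rfl)
    (hfr₁.2 1 rfl) (hfr₁.2 5 rfl) (hfr₁.2 7 rfl)
  have hH : Keeps e (s₁.arr 2) H := by
    intro u v
    rw [hHdef, deleteEdges_adj, ← mem_edgeSet, ← hG.2]
    constructor
    · rintro ⟨⟨i, hi⟩, h2⟩
      refine ⟨i, ?_, hi⟩
      by_contra h0
      obtain ⟨j, rfl⟩ := (hmask i).1 h0
      exact h2 ⟨j, hi⟩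
    · rintro ⟨i, h0, hi⟩
      refine ⟨⟨i, hi⟩, ?_⟩
      rintro ⟨j, hj⟩
      exact (hmask i).2 ⟨j, edge_inj hG (hj.trans hi.symm)⟩ h0
  have hinit : Run W α β (.set 28 (.const 0) ;;
      .ite (.eq (.reg 24) (.reg 2)) (.set 28 (.const 1)) .skip) s₁ fun T s' => T ≤ 3 ∧
        (s'.reg 28 ≠ 0 ↔ Function.Injective c) := by
    simp
    refine ⟨by omega, ?_⟩
    rw [run_ite]
    refine ⟨fun h => ?_, fun h => ?_⟩
    · simp [hs₁.enc.reg2] at h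
      simp [h24.1 h]
      omega
    · simp [hs₁.enc.reg2] at h
      simp
      exact fun hi => h (h24.2 hi)
  rw [run_seq]
  refine (hinit.frame).mono ?_
  rintro T₂ s₂ ⟨⟨hT₂, h28⟩, hfr₂⟩
  have hs₂ : Chosen e c s₂ := hs₁.congr (hfr₂.1 0 rfl) (hfr₂.1 1 rfl) (hfr₂.1 2 rfl) (hfr₂.2 0 rfl)
    (hfr₂.2 1 rfl) (hfr₂.2 5 rfl) (hfr₂.2 7 rfl)
  have e2 : s₂.arr 2 = s₁.arr 2 := hfr₂.2 2 rfl
  have e9 : s₂.arr 9 = s.arr 9 := (hfr₂.2 9 rfl).trans (hfr₁.2 9 rfl)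
  refine (run_forDown (N := k) (K := (n + 1) * (100 * m + 43)) (fun j s' => Chosen e c s' ∧
    s'.arr 2 = s₁.arr 2 ∧ s'.arr 9 = s.arr 9 ∧
    (s'.reg 28 ≠ 0 ↔ Function.Injective c ∧ ∀ j' : Fin k, j ≤ j' → ∀ j'' : Fin k,
      (PairOK α β G H (e (c j')).1 (e (c j'')).1 ∧ PairOK α β G H (e (c j')).1 (e (c j'')).2) ∧
      (PairOK α β G H (e (c j')).2 (e (c j'')).1 ∧ PairOK α β G H (e (c j')).2 (e (c j'')).2)))
    (by simpa using hs₂.enc.reg2) (by omega) (by rfl) ?_ ?_).mono ?_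
  · refine ⟨hs₂.congr (by simp) (by simp) (by simp) rfl rfl rfl rfl, e2, e9, ?_⟩
    simp only [setReg_reg]
    rw [if_neg (by decide), h28]
    exact ⟨fun h => ⟨h, fun j hj => absurd j.2 (by omega)⟩, fun h => h.1⟩
  · rintro j hj s₃ ⟨h1, h2, h3, h4⟩ -
    have l7 := h1.lt ⟨j, hj⟩
    have l5 := h1.eq ⟨j, hj⟩
    have l0 := h1.enc.arr0 (c ⟨j, hj⟩)
    have l1 := h1.enc.arr1 (c ⟨j, hj⟩)
    have hc := (c ⟨j, hj⟩).2
    simp only [] at l7 l5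
    simp [l5, l0]
    refine ⟨by omega, by omega, by omega, ?_⟩
    refine ((run_checkRoot (H := H) hG (a := (e (c ⟨j, hj⟩)).1) (h1.congr ?_ ?_ ?_ ?_ ?_ ?_ ?_)
      (by simp)
      (by simpa [h3] using h9) (by simpa [h2] using hH) hkm hW).frame).mono ?_ <;> try simp
    rintro T₄ s₄ hT₄ h5 hfr₄
    have l26 : s₄.reg 26 = c ⟨j, hj⟩ := (hfr₄.1 26 rfl).trans (by simp)
    have l1' : s₄.arr 1 (c ⟨j, hj⟩) = (e (c ⟨j, hj⟩)).2 := (congrFun (hfr₄.2 1 rfl) _).trans l1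
    have hs₄ : Chosen e c s₄ := h1.congr ((hfr₄.1 0 rfl).trans (by simp))
      ((hfr₄.1 1 rfl).trans (by simp)) ((hfr₄.1 2 rfl).trans (by simp)) (hfr₄.2 0 rfl)
      (hfr₄.2 1 rfl) (hfr₄.2 5 rfl) (hfr₄.2 7 rfl)
    have m2 : s₄.arr 2 = s₁.arr 2 := (hfr₄.2 2 rfl).trans h2
    have m9 : s₄.arr 9 = s.arr 9 := (hfr₄.2 9 rfl).trans h3
    simp [l26, l1']
    refine ⟨by omega, ?_⟩
    refine ((run_checkRoot (H := H) hG (a := (e (c ⟨j, hj⟩)).2) (hs₄.congr ?_ ?_ ?_ ?_ ?_ ?_ ?_)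
      (by simp)
      (by simpa [m9] using h9) (by simpa [m2] using hH) hkm hW).frame).mono ?_ <;> try simp
    rintro T₅ s₅ hT₅ h6 hfr₅
    refine ⟨by nlinarith, hs₄.congr ((hfr₅.1 0 rfl).trans (by simp))
      ((hfr₅.1 1 rfl).trans (by simp)) ((hfr₅.1 2 rfl).trans (by simp)) (hfr₅.2 0 rfl)
      (hfr₅.2 1 rfl) (hfr₅.2 5 rfl) (hfr₅.2 7 rfl), (hfr₅.2 2 rfl).trans m2,
      (hfr₅.2 9 rfl).trans m9, ?_⟩
    simp at h4
    rw [h6, h5, h4]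
    constructor
    · rintro ⟨⟨⟨h7, h8⟩, h9⟩, h10⟩
      refine ⟨h7, fun j' hj' j'' => ?_⟩
      rcases Nat.eq_or_lt_of_le hj' with h11 | h11
      · obtain rfl : (⟨j, hj⟩ : Fin k) = j' := Fin.ext h11
        exact ⟨h9 j'', h10 j''⟩
      · exact h8 j' h11 j''
    · rintro ⟨h7, h8⟩
      exact ⟨⟨⟨h7, fun j' hj' => h8 j' (by omega)⟩, fun j'' => (h8 ⟨j, hj⟩ le_rfl j'').1⟩,
        fun j'' => (h8 ⟨j, hj⟩ le_rfl j'').2⟩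
  · rintro T₅ s₅ ⟨hT₅, h1, h2, h3, h4⟩
    refine ⟨?_, by rwa [h2], ?_⟩
    · have h5 : 3 * m + 8 * k + 10 ≤ k * ((n + 1) * (11 * m + 10)) :=
        le_trans (by omega) ((Nat.le_mul_of_pos_left (11 * m + 10) (Nat.succ_pos n)).trans
          (Nat.le_mul_of_pos_left _ hk))
      have h6 : k * ((n + 1) * (100 * m + 43) + 2) ≤ k * ((n + 1) * (100 * m + 45)) := by
        gcongr; nlinarith
      nlinarith
    · rw [h4]
      refine and_congr_right fun _ => ⟨fun h => ?_, fun h j' _ j'' => ?_⟩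
      · refine isSpanner_of_endpoints hα hβ ?_
        rintro a d ⟨_, ⟨j, rfl⟩, ha⟩ ⟨_, ⟨j', rfl⟩, hd⟩ hr
        have h5 := h j (Nat.zero_le _) j'
        simp only [edge, Sym2.mem_iff] at ha hd
        rcases ha with rfl | rfl <;> rcases hd with rfl | rfl
        · exact h5.1.1 hr
        · exact h5.1.2 hr
        · exact h5.2.1 hr
        · exact h5.2.2 hr
      · exact ⟨⟨h.2 _ _, h.2 _ _⟩, ⟨h.2 _ _, h.2 _ _⟩⟩

end WordRAM


/-! ### Exhaustive search -/

namespace WordRAM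

open SimpleGraph Spanner

variable {W : ℕ} {α β : ℝ} {n m k len : ℕ} {e : Fin m → Fin n × Fin n} {G H : SimpleGraph (Fin n)}

/-- The number with the base `len` digits `t 0, …, t (j - 1)`, most significant digit first. -/
def tupleValue (len : ℕ) (t : ℕ → ℕ) : ℕ → ℕ
  | 0 => 0
  | j + 1 => tupleValue len t j * len + t j

theorem tupleValue_lt {t : ℕ → ℕ} {k : ℕ} (h : ∀ j < k, t j < len) :
    tupleValue len t k < len ^ k := by
  induction k with
  | zero => simp [tupleValue]
  | succ k ih =>
    have h1 := ih fun j hj => h j (by omega)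
    have h2 := h k (by omega)
    rw [tupleValue, pow_succ]
    nlinarith

theorem eq_of_tupleValue_eq {t t' : ℕ → ℕ} {k : ℕ} (h : ∀ j < k, t j < len)
    (h' : ∀ j < k, t' j < len) (heq : tupleValue len t k = tupleValue len t' k) :
    ∀ j < k, t j = t' j := by
  induction k with
  | zero => intro j hj; omega
  | succ k ih =>
    have h1 := h k (by omega)
    have h2 := h' k (by omega)
    rw [tupleValue, tupleValue] at heq
    have h3 : t k = t' k := by
      have := congrArg (· % len) heq
      simpa [Nat.mod_eq_of_lt h1, Nat.mod_eq_of_lt h2] using this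
    have h4 : tupleValue len t k = tupleValue len t' k :=
      Nat.eq_of_mul_eq_mul_right (by omega : 0 < len) (by omega)
    intro j hj
    rcases Nat.eq_or_lt_of_le (Nat.lt_succ_iff.1 hj) with rfl | hj
    · exact h3
    · exact ih (fun j hj => h j (by omega)) (fun j hj => h' j (by omega)) h4 j hj

theorem tupleValue_update_of_le {t : ℕ → ℕ} {j k v : ℕ} (h : k ≤ j) :
    tupleValue len (Function.update t j v) k = tupleValue len t k := by
  induction k with
  | zero => rfl
  | succ k ih =>
    rw [tupleValue, tupleValue, ih (by omega), Function.update_of_ne (by omega)]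

/-- Replacing digit `j` of `j + 1 + d` digits. -/
theorem tupleValue_update {t : ℕ → ℕ} {j d v : ℕ} :
    tupleValue len (Function.update t j v) (j + 1 + d) + t j * len ^ d =
      tupleValue len t (j + 1 + d) + v * len ^ d := by
  induction d with
  | zero =>
    simp [tupleValue, tupleValue_update_of_le]
    ring
  | succ d ih =>
    rw [← add_assoc, tupleValue, tupleValue, Function.update_of_ne (by omega), pow_succ]
    linear_combination len * ih

/-- Replace the tuple in array `7` by the next one; `R[35]` is the carry. -/
def advance : Prog :=
  .set 35 (.const 1) ;; forDown 23 (.reg 2) (.ite (.eq (.reg 35) (.const 0)) .skip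
    (.load 25 7 (.reg 23) ;; .arith .add 25 (.reg 25) (.const 1) ;;
      .ite (.eq (.reg 25) (.reg 5)) (.store 7 (.reg 23) (.const 0))
        (.store 7 (.reg 23) (.reg 25) ;; .set 35 (.const 0))))

/-- The carry `R[35]` is `0` or `1`, and the value of the tuple grows by `1` modulo `len ^ k`. The
digits are treated from the last one to the first one. -/
theorem run_advance {s : State} {t : ℕ → ℕ} (h2 : s.reg 2 = k) (h5 : s.reg 5 = len)
    (ht : s.arr 7 = t) (hlt : ∀ j < k, t j < len) (hlen : len ≤ m)
    (hW : 2 * (n + m + k + 2) ≤ W) :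
    Run W α β advance s fun T s' => T ≤ 8 * k + 3 ∧ s'.reg 35 ≤ 1 ∧
      (∀ j < k, s'.arr 7 j < len) ∧
      tupleValue len (s'.arr 7) k + s'.reg 35 * len ^ k = tupleValue len t k + 1 := by
  rw [advance, run_seq]
  simp
  refine ⟨by omega, ?_⟩
  refine (run_forDown (N := k) (K := 6) (fun j s => s.reg 5 = len ∧ s.reg 35 ≤ 1 ∧
    (∀ j < k, s.arr 7 j < len) ∧
    tupleValue len (s.arr 7) k + s.reg 35 * len ^ (k - j) = tupleValue len t k + 1)
    (by simpa using h2) (by omega) (by rfl) ?_ ?_).mono ?_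
  · simp [h5, ht]
    exact hlt
  · rintro j hj s₁ ⟨i1, i2, i3, i4⟩ -
    rw [run_ite]
    refine ⟨fun h => ?_, fun h => ?_⟩
    · simp at h
      simp [h, i1]
      refine ⟨i3, by simpa [h] using i4⟩
    · simp at h
      have h35 : s₁.reg 35 = 1 := by omega
      have hj' := i3 j hj
      simp
      refine ⟨by omega, by omega, ?_⟩
      obtain ⟨d, rfl⟩ : ∃ d, k = j + 1 + d := ⟨k - (j + 1), by omega⟩
      have hd : j + 1 + d - (j + 1) = d := by omega
      have hd' : j + 1 + d - j = d + 1 := by omega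
      rw [hd, h35] at i4
      rw [run_ite]
      refine ⟨fun h6 => ?_, fun h6 => ?_⟩
      · simp [i1] at h6
        simp [i1, h35]
        refine ⟨by omega, by omega, fun j' hj' => ?_, ?_⟩
        · rw [Function.update_apply]
          split_ifs
          · omega
          · exact i3 j' hj'
        · have := tupleValue_update (len := len) (t := s₁.arr 7) (j := j) (d := d) (v := 0)
          rw [hd', pow_succ]
          have h7 : s₁.arr 7 j * len ^ d + len ^ d = len ^ d * len := by rw [← h6]; ring
          omega
      · simp [i1] at h6
        simp [i1]
        refine ⟨by omega, by omega, by omega, fun j' hj' => ?_, ?_⟩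
        · rw [Function.update_apply]
          split_ifs
          · omega
          · exact i3 j' hj'
        · have := tupleValue_update (len := len) (t := s₁.arr 7) (j := j) (d := d)
            (v := s₁.arr 7 j + 1)
          have h7 : (s₁.arr 7 j + 1) * len ^ d = s₁.arr 7 j * len ^ d + len ^ d := by ring
          omega
  · rintro T s' ⟨hT, -, i2, i3, i4⟩
    exact ⟨by omega, i2, i3, by simpa using i4⟩

/-- Test all `k`-tuples of entries of the list in array `5`. The outcome is written to `R[7]`. -/
def searchAll : Prog :=
  forDown 23 (.reg 2) (.store 7 (.reg 23) (.const 0)) ;; .set 7 (.const 0) ;;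
  .set 34 (.const 1) ;;
  .loop (.le (.const 1) (.reg 34))
    (testChosen ;; .ite (.eq (.reg 28) (.const 0))
      (advance ;; .arith .sub 34 (.const 1) (.reg 35))
      (.set 7 (.const 1) ;; .set 34 (.const 0)))

/-- The tuple `t` of indices into the list `l` selects a solution. -/
def IsGood (α β : ℝ) (G : SimpleGraph (Fin n)) (e : Fin m → Fin n × Fin n) (k : ℕ) (l t : ℕ → ℕ) :
    Prop :=
  ∃ c : Fin k → Fin m, (∀ j : Fin k, l (t j) = c j) ∧ Function.Injective c ∧
    IsSpanner α β G (G.deleteEdges (Set.range fun j => edge e (c j)))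

theorem HasSolutionIn.exists_isGood {E : Finset (Sym2 (Fin n))} {l fl : ℕ → ℕ}
    (hL : Lists e E len l fl) (h : HasSolutionIn α β G k E) :
    ∃ t : ℕ → ℕ, (∀ j < k, t j < len) ∧ IsGood α β G e k l t := by
  obtain ⟨F, hF, hk, hsp⟩ := h
  let φ := (Finset.equivFinOfCardEq hk).symm
  choose pos hpos c hc hce using fun j : Fin k => hL.surj _ (hF (φ j).2)
  refine ⟨fun j => if h : j < k then pos ⟨j, h⟩ else 0,
    fun j hj => by simpa [hj] using hpos ⟨j, hj⟩,
    c, fun j => by simpa using hc j, fun j j' h => ?_, ?_⟩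
  · apply φ.injective
    apply Subtype.ext
    rw [← hce, ← hce, h]
  · convert hsp
    ext g
    simp only [Set.mem_range, hce, Finset.mem_coe]
    exact ⟨fun ⟨j, hj⟩ => hj ▸ (φ j).2, fun hg => ⟨φ.symm ⟨g, hg⟩, by simp⟩⟩

theorem isSolution_markedEdges (hG : IsEdgeListing G e) {c : Fin k → Fin m}
    (hc : Function.Injective c)
    (hsp : IsSpanner α β G (G.deleteEdges (Set.range fun j => edge e (c j)))) {s : State}
    (hs : ∀ i : Fin m, s.arr 2 i ≠ 0 ↔ ∃ j, c j = i) :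
    IsSolution α β G k (markedEdges e s) := by
  have h : markedEdges e s = Set.range fun j => edge e (c j) := by
    ext g
    constructor
    · rintro ⟨i, h1, h2⟩
      obtain ⟨j, rfl⟩ := (hs i).1 h1
      exact ⟨j, h2⟩
    · rintro ⟨j, rfl⟩
      exact ⟨c j, (hs _).2 ⟨j, rfl⟩, rfl⟩
  rw [h]
  refine ⟨?_, ?_, hsp⟩
  · rintro _ ⟨j, rfl⟩
    exact edge_mem hG _
  · rw [← Set.image_univ, Set.ncard_image_of_injective _ fun j j' h => hc (edge_inj hG h)]
    simp

/-- The invariant of the loop of `searchAll`. -/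
def SearchAllInv (α β : ℝ) (G : SimpleGraph (Fin n)) (e : Fin m → Fin n × Fin n) (k len : ℕ)
    (l : ℕ → ℕ) (s : State) : Prop :=
  Enc e k s ∧ (∀ i, s.arr 9 i = 0) ∧ s.arr 5 = l ∧ s.reg 5 = len ∧ (∀ j < k, s.arr 7 j < len) ∧
    ((s.reg 34 = 1 ∧ s.reg 7 = 0 ∧ ∀ t, (∀ j < k, t j < len) →
        tupleValue len t k < tupleValue len (s.arr 7) k → ¬ IsGood α β G e k l t) ∨
      (s.reg 34 = 0 ∧ s.reg 7 = 1 ∧ IsSolution α β G k (markedEdges e s)) ∨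
      (s.reg 34 = 0 ∧ s.reg 7 = 0 ∧ ∀ t, (∀ j < k, t j < len) → ¬ IsGood α β G e k l t))

theorem run_searchAll (hα : 1 ≤ α) (hβ : 0 ≤ β) (hG : IsEdgeListing G e)
    {E : Finset (Sym2 (Fin n))} {s : State} (hs : Enc e k s) (h9 : ∀ i, s.arr 9 i = 0)
    (hL : Lists e E (s.reg 5) (s.arr 5) (s.arr 6)) (hk : 1 ≤ k) (hkm : k ≤ m)
    (hpos : 1 ≤ s.reg 5) (hW : 2 * (n + m + k + 2) ≤ W) :
    Run W α β searchAll s fun T s' =>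
      T ≤ (s.reg 5 ^ k + 1) * (k * ((n + 1) * (140 * m + 70))) ∧
      ((s'.reg 7 = 1 ∧ IsSolution α β G k (markedEdges e s')) ∨
        (s'.reg 7 = 0 ∧ ¬ HasSolutionIn α β G k E)) := by
  have hlen := hL.len_le
  have hkn : k ≤ k * ((n + 1) * m) :=
    Nat.le_mul_of_pos_right k (Nat.mul_pos (Nat.succ_pos n) (by omega))
  have hkn1 : 1 ≤ k * ((n + 1) * 1) := by
    rw [mul_one]; exact Nat.mul_pos hk (Nat.succ_pos n)
  obtain ⟨K, hK⟩ : ∃ K, k * ((n + 1) * (128 * m + 68)) = K := ⟨_, rfl⟩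
  have hcost : k * ((n + 1) * (120 * m + 60)) + 8 * k + 8 ≤ K := by
    have : K = k * ((n + 1) * (120 * m + 60)) + 8 * (k * ((n + 1) * m)) +
      8 * (k * ((n + 1) * 1)) := by rw [← hK]; ring
    omega
  have hcost' : K + 2 ≤ k * ((n + 1) * (140 * m + 70)) := by
    have : k * ((n + 1) * (140 * m + 70)) = K + 12 * (k * ((n + 1) * m)) +
      2 * (k * ((n + 1) * 1)) := by rw [← hK]; ring
    omega
  rw [searchAll, run_seq]
  refine ((run_forDown (N := k) (K := 1) (fun i s' => ∀ j, i ≤ j → j < k → s'.arr 7 j = 0)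
    (by simpa using hs.reg2) (by omega) (by rfl) (fun j hj hj' => by omega) ?_).frame).mono ?_
  · intro j hj s' h _
    simp
    refine ⟨by omega, by omega, fun i hi hik => ?_⟩
    by_cases hij : i = j
    · simp [hij]
    · rw [Function.update_of_ne hij]
      exact h i (by omega) hik
  rintro T₁ s₁ ⟨⟨hT₁, hz⟩, hfr⟩
  have hs₁ : Enc e k s₁ := hs.congr (hfr.1 0 rfl) (hfr.1 1 rfl) (hfr.1 2 rfl) (hfr.2 0 rfl)
    (hfr.2 1 rfl)
  have e5 : s₁.arr 5 = s.arr 5 := hfr.2 5 rfl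
  have e5' : s₁.reg 5 = s.reg 5 := hfr.1 5 rfl
  have e9 : s₁.arr 9 = s.arr 9 := hfr.2 9 rfl
  have hz0 : tupleValue (s.reg 5) (s₁.arr 7) k = 0 := by
    have : ∀ k' ≤ k, tupleValue (s.reg 5) (s₁.arr 7) k' = 0 := by
      intro k' hk'
      induction k' with
      | zero => rfl
      | succ k' ih => rw [tupleValue, ih (by omega), hz k' (Nat.zero_le _) (by omega)]; simp
    exact this k le_rfl
  simp
  refine ⟨by omega, by omega, ?_⟩
  refine (run_loop (SearchAllInv α β G e k (s.reg 5) (s.arr 5))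
    (fun s' => s'.reg 34 * ((s.reg 5 ^ k - tupleValue (s.reg 5) (s'.arr 7) k) * K))
    ?_ ?_).mono ?_
  · rintro s₂ ⟨i1, i2, i3, i4, i5, i6⟩ htest
    simp at htest
    obtain ⟨j34, j7, jno⟩ : s₂.reg 34 = 1 ∧ s₂.reg 7 = 0 ∧ ∀ t, (∀ j < k, t j < s.reg 5) →
        tupleValue (s.reg 5) t k < tupleValue (s.reg 5) (s₂.arr 7) k →
          ¬ IsGood α β G e k (s.arr 5) t := by
      rcases i6 with h | h | h
      · exact h
      · omega
      · omega
    choose c hc hcE using fun j : Fin k => hL.idx (s₂.arr 7 j) (i5 j j.2)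
    have hch : Chosen e c s₂ := ⟨i1, fun j => (i5 j j.2).trans_le hlen, fun j => i3 ▸ hc j⟩
    have hval := tupleValue_lt i5
    rw [run_seq]
    refine ((run_testChosen hα hβ hG hch i2 hk hkm hW).frame).mono ?_
    rintro T₃ s₃ ⟨⟨hT₃, hm, h28⟩, hfr₃⟩
    have hs₃ : Enc e k s₃ := i1.congr (hfr₃.1 0 rfl) (hfr₃.1 1 rfl) (hfr₃.1 2 rfl) (hfr₃.2 0 rfl)
      (hfr₃.2 1 rfl)
    have l5 : s₃.arr 5 = s.arr 5 := (hfr₃.2 5 rfl).trans i3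
    have l5' : s₃.reg 5 = s.reg 5 := (hfr₃.1 5 rfl).trans i4
    have l9 : s₃.arr 9 = s₂.arr 9 := hfr₃.2 9 rfl
    have l7 : s₃.arr 7 = s₂.arr 7 := hfr₃.2 7 rfl
    have l7' : s₃.reg 7 = 0 := (hfr₃.1 7 rfl).trans j7
    have hstep : 1 ≤ s.reg 5 ^ k - tupleValue (s.reg 5) (s₂.arr 7) k := by omega
    rw [run_ite]
    refine ⟨fun hb => ?_, fun hb => ?_⟩
    · simp at hb
      have hbad : ¬ IsGood α β G e k (s.arr 5) (s₂.arr 7) := by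
        rintro ⟨c', h1, h2⟩
        obtain rfl : c' = c := funext fun j => Fin.ext ((h1 j).symm.trans (hc j))
        exact h28.2 h2 hb
      have hno : ∀ t, (∀ j < k, t j < s.reg 5) →
          tupleValue (s.reg 5) t k < tupleValue (s.reg 5) (s₂.arr 7) k + 1 →
          ¬ IsGood α β G e k (s.arr 5) t := by
        intro t ht hlt
        rcases Nat.eq_or_lt_of_le (Nat.lt_succ_iff.1 hlt) with heq | hlt
        · rintro ⟨c', h1, h2⟩
          refine hbad ⟨c', fun j => ?_, h2⟩
          rw [← eq_of_tupleValue_eq ht i5 heq j j.2, h1]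
        · exact jno t ht hlt
      rw [run_seq]
      refine ((run_advance hs₃.reg2 l5' l7 i5 hlen hW).frame).mono ?_
      rintro T₄ s₄ ⟨⟨hT₄, h35, hlt, hv⟩, hfr₄⟩
      have hs₄ : Enc e k s₄ := hs₃.congr (hfr₄.1 0 rfl) (hfr₄.1 1 rfl) (hfr₄.1 2 rfl)
        (hfr₄.2 0 rfl) (hfr₄.2 1 rfl)
      have n9 : s₄.arr 9 = s₂.arr 9 := (hfr₄.2 9 rfl).trans l9
      simp
      refine ⟨by omega, ⟨hs₄.congr (by simp) (by simp) (by simp) rfl rfl, by simpa [n9] using i2,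
        (hfr₄.2 5 rfl).trans l5, (hfr₄.1 5 rfl).trans l5', hlt, ?_⟩, ?_⟩
      · have n7 : s₄.reg 7 = 0 := (hfr₄.1 7 rfl).trans l7'
        rcases Nat.le_one_iff_eq_zero_or_eq_one.1 h35 with h | h
        · rw [h] at hv
          left
          refine ⟨by simp [h], by simpa using n7, fun t ht hlt => hno t ht ?_⟩
          simp only [setReg_arr] at hlt
          omega
        · rw [h] at hv
          right; right
          refine ⟨by simp [h], by simpa using n7, fun t ht => hno t ht ?_⟩
          have := tupleValue_lt ht
          omega
      · rw [j34]
        rcases Nat.le_one_iff_eq_zero_or_eq_one.1 h35 with h | h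
        · rw [h] at hv ⊢
          obtain ⟨q, hq⟩ : ∃ q, s.reg 5 ^ k - tupleValue (s.reg 5) (s₂.arr 7) k = q + 1 :=
            ⟨_, (Nat.sub_add_cancel hstep).symm⟩
          have hq' : s.reg 5 ^ k - tupleValue (s.reg 5) (s₄.arr 7) k = q := by omega
          rw [hq, hq', add_one_mul q]
          omega
        · rw [h, Nat.sub_self, zero_mul]
          have := Nat.mul_le_mul_right K hstep
          omega
    · simp at hb
      have hgood := h28.1 hb
      simp
      refine ⟨by omega, by omega, ⟨hs₃.congr (by simp) (by simp) (by simp) rfl rfl,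
        by simpa [l9] using i2, l5, l5', by simpa [l7] using i5, ?_⟩, ?_⟩
      · right; left
        exact ⟨by simp, by simp, isSolution_markedEdges hG hgood.1 hgood.2 (by simpa using hm)⟩
      · rw [j34]
        have := Nat.mul_le_mul_right K hstep
        omega
  · refine ⟨hs₁.congr (by simp) (by simp) (by simp) rfl rfl, by simpa [e9] using h9, e5, e5',
      fun j hj => by simp [hz j (Nat.zero_le _) hj]; omega, ?_⟩
    left
    refine ⟨by simp, by simp, fun t _ ht => ?_⟩
    simp [hz0] at ht
  · rintro T₂ s₂ ⟨hT₂, ⟨-, -, -, -, -, i6⟩, htest⟩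
    simp at htest
    simp [hz0] at hT₂
    refine ⟨?_, ?_⟩
    · have := Nat.mul_le_mul_left (s.reg 5 ^ k) (Nat.le_of_add_right_le hcost')
      rw [Nat.succ_mul]
      omega
    · rcases i6 with h | h | h
      · omega
      · exact .inl h.2
      · refine .inr ⟨h.2.1, fun hsol => ?_⟩
        obtain ⟨t, ht, hg⟩ := hsol.exists_isGood hL
        exact h.2.2 t ht hg

end WordRAM


/-! ### The algorithm -/

namespace WordRAM

open SimpleGraph Spanner

variable {W : ℕ} {α β : ℝ} {n m k D : ℕ} {e : Fin m → Fin n × Fin n} {G : SimpleGraph (Fin n)}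

/-- Compute the minimum of `R[0]` and the integer part of `α + β`. -/
def computeRounds : Prog :=
  .set 3 (.reg 0) ;; forDown 4 (.reg 0) (.arith .add 8 (.reg 4) (.const 1) ;;
    .ite (.stretch (.reg 8) (.const 1)) .skip (.set 3 (.reg 4)))

/-- Collect short closed trails with all vertices as roots, and search for a solution whenever the
list of their edges has grown. -/
def searchRoots : Prog :=
  .set 4 (.reg 0) ;; .loop (.le (.const 1) (.reg 4))
    (.arith .sub 4 (.reg 4) (.const 1) ;; .set 6 (.reg 5) ;; collect ;;
      .ite (.eq (.reg 5) (.reg 6)) .skip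
        (searchAll ;; .ite (.eq (.reg 7) (.const 0)) .skip (.set 4 (.const 0))))

/-- The algorithm. There is no solution if `m < k` or `α + β < 2`.

Apart from the input, the registers `3`, …, `7` hold the number of rounds of the short searches,
the root, the length of the list, its length before the current root, and whether a solution has
been found; the other registers are temporary. The arrays `5` and `6` hold the list and the flags of
its members, array `7` a tuple of indices into the list, and array `2` the marks of its edges. The
arrays `3`, `4` and `8`, `10` hold the distances and parents of searches in the graph and in the
candidate for a spanner. Array `9` is never written; it is the empty mask of searches in the
graph. -/
def spannerProg : Prog :=
  .ite (.le (.reg 2) (.reg 1))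
    (.ite (.stretch (.const 2) (.const 1)) (computeRounds ;; searchRoots ;; .set 0 (.reg 7))
      (.set 0 (.const 0))) (.set 0 (.const 0))

theorem run_computeRounds (hD : ∀ y : ℕ, (y : ℝ) ≤ α + β ↔ y ≤ D) {s : State} (h0 : s.reg 0 = n)
    (hW : 2 * (n + m + k + 2) ≤ W) :
    Run W α β computeRounds s fun T s' => T ≤ 5 * n + 3 ∧ s'.reg 3 = min D n := by
  simp [computeRounds, h0]
  refine ⟨by omega, ?_⟩
  refine (run_forDown (N := n) (K := 3) (fun j s' => s'.reg 3 = min n (max D j))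
    (by simpa using h0) (by omega) (by rfl) (by simp) ?_).mono ?_
  · intro j hj s' h _
    simp
    refine ⟨by omega, ?_⟩
    rw [run_ite]
    refine ⟨fun hb => ?_, fun hb => ?_⟩
    · rw [Test.Holds] at hb
      simp [-Nat.cast_add, hD] at hb
      simp [h]
      omega
    · rw [Test.Holds] at hb
      simp [-Nat.cast_add, hD] at hb
      simp
      omega
  · rintro T s' ⟨hT, h⟩
    exact ⟨by omega, by omega⟩

/-- The number of edges that may be collected before a solution is found. -/
def lengthBound (D k : ℕ) : ℕ := unionBound D k + k * (D + 1)

/-- The invariant of the loop of `searchRoots`. -/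
def RootsInv (α β : ℝ) (G : SimpleGraph (Fin n)) (e : Fin m → Fin n × Fin n) (k D : ℕ) (s : State) :
    Prop :=
  Enc e k s ∧ (∀ i, s.arr 9 i = 0) ∧ s.reg 3 = min D n ∧
    ((s.reg 4 = 0 ∧ s.reg 7 = 1 ∧ IsSolution α β G k (markedEdges e s)) ∨
      (s.reg 4 ≤ n ∧ s.reg 7 = 0 ∧ ∃ E, IsCircuitUnion G D E ∧
        Lists e E (s.reg 5) (s.arr 5) (s.arr 6) ∧ ¬ HasSolutionIn α β G k E ∧
        ∀ y : Fin n, s.reg 4 ≤ y → Covers G D E y))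

theorem card_le_unionBound (hα : 1 ≤ α) (hβ : 0 ≤ β) (hD1 : 1 ≤ D) (hD : (D : ℝ) ≤ α + β)
    {E : Finset (Sym2 (Fin n))} (hE : IsCircuitUnion G D E) (h : ¬ HasSolutionIn α β G k E) :
    E.card ≤ unionBound D k := by
  obtain ⟨𝒞, h𝒞, rfl⟩ := hE
  exact card_biUnion_le_unionBound hα hβ hD1 hD h𝒞 fun F hF hk hsp => h ⟨F, hF, hk, hsp⟩

/-- The closed trails through all vertices contain a solution if there is one. -/
theorem hasSolutionIn_of_covers (hD : α + β < D + 1)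
    {E : Finset (Sym2 (Fin n))} (hcov : ∀ y, Covers G D E y) {E' : Set (Sym2 (Fin n))}
    (h : IsSolution α β G k E') : HasSolutionIn α β G k E := by
  obtain ⟨h1, h2, h3⟩ := h
  obtain ⟨F, hF, hFk⟩ := Set.exists_subset_card_eq h2
  have hfin : F.Finite := Set.toFinite F
  have hsp := h3.mono hF
  refine ⟨hfin.toFinset, fun g hg => ?_, ?_, by simpa using hsp⟩
  · rw [Set.Finite.mem_toFinset] at hg
    induction g with | _ a b
    obtain ⟨C, hC, hab⟩ := hsp.exists_isShortCircuit hD (h1 (hF hg)) hg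
    exact hcov a C hC _ hab (by simp)
  · rw [← hFk, Set.ncard_eq_toFinset_card F hfin]

/-- A bound for the number of steps with one root, except for those of `searchAll`. -/
def rootCost (m D : ℕ) : ℕ := (D + 2) * (62 * m + 62) + 10

/-- A bound for the number of steps of one run of `searchAll`. -/
def searchCost (n m k D : ℕ) : ℕ := (lengthBound D k ^ k + 1) * (k * ((n + 1) * (140 * m + 70)))

theorem run_searchRoots (hα : 1 ≤ α) (hβ : 0 ≤ β) (hD : ∀ y : ℕ, (y : ℝ) ≤ α + β ↔ y ≤ D)
    (hD1 : 1 ≤ D) (hG : IsEdgeListing G e) {s : State} (hs : Enc e k s) (h3 : s.reg 3 = min D n)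
    (h5 : s.reg 5 = 0) (h7 : s.reg 7 = 0) (h6 : ∀ i, s.arr 6 i = 0) (h9 : ∀ i, s.arr 9 i = 0)
    (hk : 1 ≤ k) (hkm : k ≤ m) (hW : 2 * (n + m + k + 2) ≤ W) :
    Run W α β searchRoots s fun T s' =>
      T ≤ n * rootCost m D + lengthBound D k * searchCost n m k D + 2 ∧
      ((s'.reg 7 = 1 ∧ IsSolution α β G k (markedEdges e s')) ∨
        (s'.reg 7 = 0 ∧ ¬ ∃ E', IsSolution α β G k E')) := by
  have hDr : (D : ℝ) ≤ α + β := (hD D).2 le_rfl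
  have hDr' : α + β < D + 1 := by
    by_contra h
    have := (hD (D + 1)).1 (by push_cast; exact not_lt.1 h)
    omega
  simp [searchRoots, hs.reg0]
  refine ⟨by omega, ?_⟩
  refine (run_loop (RootsInv α β G e k D) (fun s' => s'.reg 4 * rootCost m D +
    (lengthBound D k - s'.reg 5) * searchCost n m k D) ?_ ?_).mono ?_
  · rintro s₁ ⟨i1, i2, i3, i4⟩ htest
    simp at htest
    obtain ⟨j4, j7, E, hE, hL, hno, hcov⟩ : s₁.reg 4 ≤ n ∧ s₁.reg 7 = 0 ∧ ∃ E,
        IsCircuitUnion G D E ∧ Lists e E (s₁.reg 5) (s₁.arr 5) (s₁.arr 6) ∧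
        ¬ HasSolutionIn α β G k E ∧ ∀ y : Fin n, s₁.reg 4 ≤ y → Covers G D E y := by
      rcases i4 with h | h
      · omega
      · exact h
    obtain ⟨x, hx⟩ : ∃ x, s₁.reg 4 = x + 1 := ⟨s₁.reg 4 - 1, by omega⟩
    have hlen := hL.len_le
    have hcard := card_le_unionBound hα hβ hD1 hDr hE hno
    simp [hx]
    refine ⟨by omega, by omega, ?_⟩
    refine ((run_collect hα hβ hD hG ⟨x, by omega⟩ (i1.congr ?_ ?_ ?_ ?_ ?_) ?_ ?_ ?_ hE ?_
      hW).frame).mono ?_ <;> try simp [i3, i2, hL]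
    rintro T₂ s₂ hT₂ E' hE' hEE' hL' hcard' hor hfr
    have hs₂ : Enc e k s₂ := i1.congr ((hfr.1 0 rfl).trans (by simp))
      ((hfr.1 1 rfl).trans (by simp)) ((hfr.1 2 rfl).trans (by simp)) (hfr.2 0 rfl) (hfr.2 1 rfl)
    have m9 : s₂.arr 9 = s₁.arr 9 := hfr.2 9 rfl
    have m3 : s₂.reg 3 = min D n := (hfr.1 3 rfl).trans (by simpa using i3)
    have m4 : s₂.reg 4 = x := (hfr.1 4 rfl).trans (by simp)
    have m6 : s₂.reg 6 = s₁.reg 5 := (hfr.1 6 rfl).trans (by simp)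
    have m7 : s₂.reg 7 = 0 := (hfr.1 7 rfl).trans (by simpa using j7)
    have hlen' := hL'.len_le
    have hB : s₂.reg 5 ≤ lengthBound D k := by
      rw [← hL'.card, lengthBound]; omega
    have hmono : s₁.reg 5 ≤ s₂.reg 5 := by
      rw [← hL'.card, ← hL.card]; exact Finset.card_le_card hEE'
    have hcov' : ¬ HasSolutionIn α β G k E' → ∀ y : Fin n, x ≤ y → Covers G D E' y := by
      intro hno' y hy
      rcases Nat.eq_or_lt_of_le hy with rfl | hy
      · exact hor.resolve_right hno'
      · exact fun C hC g hg hyg => hEE' (hcov y (by omega) C hC g hg hyg)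
    have hroot : (x + 1) * rootCost m D = x * rootCost m D + ((D + 2) * (62 * m + 62) + 10) := by
      rw [add_one_mul]; rfl
    rw [run_ite]
    refine ⟨fun hb => ?_, fun hb => ?_⟩
    -- the list has not grown, so it still contains no solution
    · simp [m6] at hb
      have hEq : E = E' := Finset.eq_of_subset_of_card_le hEE' (by rw [hL'.card, hL.card, hb])
      have hno' : ¬ HasSolutionIn α β G k E' := hEq ▸ hno
      simp
      refine ⟨⟨hs₂, by simpa [m9] using i2, m3, .inr ⟨by omega, m7, E', hE', hL', hno', ?_⟩⟩, ?_⟩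
      · rw [m4]; exact hcov' hno'
      · rw [m4, hb, hroot]
        omega
    -- the growth of the list pays for the exhaustive search
    · simp [m6] at hb
      have hBF : (lengthBound D k - s₂.reg 5) * searchCost n m k D + searchCost n m k D ≤
          (lengthBound D k - s₁.reg 5) * searchCost n m k D := by
        rw [← add_one_mul]
        exact Nat.mul_le_mul_right _ (by omega)
      rw [run_seq]
      refine ((run_searchAll hα hβ hG hs₂ (by simpa [m9] using i2) hL' hk hkm (by omega)
        hW).frame).mono ?_
      rintro T₃ s₃ ⟨⟨hT₃, hres⟩, hfr₃⟩
      have hs₃ : Enc e k s₃ := hs₂.congr (hfr₃.1 0 rfl) (hfr₃.1 1 rfl) (hfr₃.1 2 rfl)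
        (hfr₃.2 0 rfl) (hfr₃.2 1 rfl)
      have n9 : s₃.arr 9 = s₁.arr 9 := (hfr₃.2 9 rfl).trans m9
      have n3 : s₃.reg 3 = min D n := (hfr₃.1 3 rfl).trans m3
      have n4 : s₃.reg 4 = x := (hfr₃.1 4 rfl).trans m4
      have n5 : s₃.reg 5 = s₂.reg 5 := hfr₃.1 5 rfl
      have hT₃' : T₃ ≤ searchCost n m k D := by
        refine hT₃.trans (Nat.mul_le_mul_right _ (Nat.succ_le_succ (Nat.pow_le_pow_left hB k)))
      rw [run_ite]
      refine ⟨fun hc => ?_, fun hc => ?_⟩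
      -- no solution within the list, so the next root follows
      · simp at hc
        have hno' : ¬ HasSolutionIn α β G k E' := by
          rcases hres with h | h
          · omega
          · exact h.2
        simp
        refine ⟨⟨hs₃, by simpa [n9] using i2, n3, .inr ⟨by omega, hc, E', hE', ?_, hno', ?_⟩⟩, ?_⟩
        · rwa [n5, hfr₃.2 5 rfl, hfr₃.2 6 rfl]
        · rw [n4]; exact hcov' hno'
        · rw [n4, n5, hroot]
          omega
      · simp at hc
        have hres' := hres.resolve_right fun h => hc h.1
        simp
        refine ⟨by omega, ⟨hs₃.congr (by simp) (by simp) (by simp) rfl rfl,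
          by simpa [n9] using i2, by simpa using n3, .inl ⟨by simp, by simpa using hres'.1,
            hres'.2⟩⟩, ?_⟩
        rw [n5, hroot]
        omega
  · refine ⟨hs.congr (by simp) (by simp) (by simp) rfl rfl, h9, by simpa using h3,
      .inr ⟨by simp, by simpa using h7, ∅, .empty G D, ?_, ?_, fun y hy => ?_⟩⟩
    · refine ⟨?_, ?_, by simp, by simp [h5]⟩
      · simp [h5]
      · simp [h6]
    · rintro ⟨F, hF, hFk, -⟩
      rw [Finset.subset_empty.1 hF] at hFk
      simp at hFk
      omega
    · simp at hy
      exact absurd y.2 (by omega)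
  · rintro T s₁ ⟨hT, ⟨-, -, -, i4⟩, htest⟩
    simp at htest
    simp [h5] at hT
    refine ⟨by omega, ?_⟩
    rcases i4 with h | ⟨-, h7, E, -, -, hno, hcov⟩
    · exact .inl h.2
    · exact .inr ⟨h7, fun E' hE' => hno (hasSolutionIn_of_covers hDr'
        (fun y => hcov y (by omega)) hE')⟩

/-- If `α + β < 2`, then no edge can be removed. -/
theorem not_isSolution_of_lt_two (h : α + β < 2) (hk : 1 ≤ k) :
    ¬ ∃ E', IsSolution α β G k E' := by
  rintro ⟨E', h1, h2, h3⟩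
  obtain ⟨g, hg⟩ : E'.Nonempty := by
    rw [Set.nonempty_iff_ne_empty]
    rintro rfl
    simp at h2
    omega
  induction g with | _ a b
  have hab : G.Adj a b := h1 hg
  obtain ⟨hr, hd⟩ := h3.2 a b hab.reachable
  rw [dist_eq_one_iff_adj.2 hab, Nat.cast_one, mul_one] at hd
  have hlt : (G.deleteEdges E').dist a b < 2 := by exact_mod_cast hd.trans_lt h
  have h0 : (G.deleteEdges E').dist a b ≠ 0 := fun h => hab.ne (hr.dist_eq_zero_iff.1 h)
  have := dist_eq_one_iff_adj.1 (show (G.deleteEdges E').dist a b = 1 by omega)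
  rw [deleteEdges_adj] at this
  exact this.2 hg

theorem not_isSolution_of_lt (hG : IsEdgeListing G e) (h : m < k) :
    ¬ ∃ E', IsSolution α β G k E' := by
  rintro ⟨E', h1, h2, -⟩
  have h3 := Set.ncard_le_ncard h1 (Set.toFinite _)
  rw [← hG.2, ← Set.image_univ] at h3
  have h4 := Set.ncard_image_le (f := fun i => s((e i).1, (e i).2)) (Set.toFinite Set.univ)
  simp at h4 h3
  omega

theorem run_spannerProg (hα : 1 ≤ α) (hβ : 0 ≤ β) (hG : IsEdgeListing G e) (hk : 1 ≤ k)
    (hW : 2 * (n + m + k + 2) ≤ W) :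
    Run W α β spannerProg (input e k) fun T s => IsCorrectAnswer α β G e k s ∧
      (T ≤ 3 ∨ 2 ≤ ⌊α + β⌋₊ ∧ k ≤ m ∧ T ≤ 5 * n + n * rootCost m ⌊α + β⌋₊ +
        lengthBound ⌊α + β⌋₊ k * searchCost n m k ⌊α + β⌋₊ + 8) := by
  have henc : Enc e k (input e k) :=
    ⟨by simp [input], by simp [input], by simp [input], by simp [input], by simp [input]⟩
  have hD : ∀ y : ℕ, (y : ℝ) ≤ α + β ↔ y ≤ ⌊α + β⌋₊ := fun y =>
    (Nat.le_floor_iff (by linarith)).symm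
  rw [spannerProg, run_ite]
  refine ⟨fun hkm => ?_, fun hkm => ?_⟩
  · simp [henc.reg1, henc.reg2] at hkm
    rw [run_ite]
    refine ⟨fun h2 => ?_, fun h2 => ?_⟩
    · simp at h2
      have hD2 : 2 ≤ ⌊α + β⌋₊ := (hD 2).1 (by exact_mod_cast h2)
      rw [run_seq]
      refine ((run_computeRounds (n := n) (m := m) (k := k) hD henc.reg0 hW).frame).mono ?_
      rintro T₁ s₁ ⟨⟨hT₁, h3⟩, hfr⟩
      have harr : ∀ a, s₁.arr a = (input e k).arr a := fun a => hfr.2 a rfl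
      rw [run_seq]
      refine (run_searchRoots hα hβ hD (by omega) hG (henc.congr (hfr.1 0 rfl) (hfr.1 1 rfl)
        (hfr.1 2 rfl) (harr 0) (harr 1)) h3 ((hfr.1 5 rfl).trans (by simp [input]))
        ((hfr.1 7 rfl).trans (by simp [input])) (fun i => by rw [harr]; simp [input])
        (fun i => by rw [harr]; simp [input]) hk hkm hW).mono ?_
      rintro T₂ s₂ ⟨hT₂, h⟩
      simp
      refine ⟨by omega, ?_, .inr ⟨hD2, hkm, by omega⟩⟩
      rcases h with h | h
      · exact .inl ⟨by simpa using h.1, h.2⟩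
      · exact .inr ⟨by simpa using h.1, h.2⟩
    · simp at h2
      simp
      exact ⟨by omega, .inr ⟨by simp, not_isSolution_of_lt_two (by linarith) hk⟩⟩
  · simp [henc.reg1, henc.reg2] at hkm
    simp
    exact ⟨by omega, .inr ⟨by simp, not_isSolution_of_lt hG hkm⟩⟩

/-! ### The running time -/

theorem trailBound_le {D k : ℕ} (hD : 2 ≤ D) : trailBound D k ≤ D ^ (9 * k + 5) := by
  have h1 : 2 * D + 3 ≤ D ^ 4 := by nlinarith [Nat.pow_le_pow_left hD 2, Nat.pow_le_pow_left hD 3]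
  have h2 : 3 * D + 1 ≤ D ^ 3 := by nlinarith [Nat.pow_le_pow_left hD 2]
  have h3 : k ≤ D ^ k := Nat.lt_pow_self (by omega) |>.le
  have h4 : (2 * D + 3) ^ k ≤ D ^ (4 * k) := by
    rw [pow_mul]; exact Nat.pow_le_pow_left h1 k
  have h5 : 2 * k * ((3 * D + 1) * (2 * D + 3) ^ k) ≤ D ^ (5 * k + 4) := by
    calc 2 * k * ((3 * D + 1) * (2 * D + 3) ^ k) ≤ D * D ^ k * (D ^ 3 * D ^ (4 * k)) := by gcongr
      _ = D ^ (5 * k + 4) := by ring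
  have h6 : D ^ (5 * k + 4) + 1 ≤ D ^ (5 * k + 5) := by
    have := Nat.pow_pos (n := 5 * k + 4) (show 0 < D by omega)
    rw [pow_succ D (5 * k + 4)]
    nlinarith
  calc trailBound D k ≤ D ^ (5 * k + 5) * D ^ (4 * k) := by unfold trailBound; gcongr; omega
    _ = D ^ (9 * k + 5) := by ring

theorem lengthBound_le {D k : ℕ} (hD : 2 ≤ D) (hk : 1 ≤ k) : lengthBound D k ≤ D ^ (23 * k) := by
  have h0 := trailBound_le (k := k) hD
  have h1 : 2 * D + 3 ≤ D ^ 4 := by nlinarith [Nat.pow_le_pow_left hD 2, Nat.pow_le_pow_left hD 3]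
  have h2 : D + 1 ≤ D ^ 2 := by nlinarith
  have h3 : k ≤ D ^ k := Nat.lt_pow_self (by omega) |>.le
  have h4 : unionBound D k ≤ D ^ (10 * k + 12) := by
    calc unionBound D k ≤ D ^ (9 * k + 5) * (D ^ 2 * D) * (D ^ k * D ^ 4) := by
          unfold unionBound; gcongr
      _ = D ^ (10 * k + 12) := by ring
  have h5 : k * (D + 1) ≤ D ^ (10 * k + 12) := by
    calc k * (D + 1) ≤ D ^ k * D ^ 2 := by gcongr
      _ = D ^ (k + 2) := by ring
      _ ≤ D ^ (10 * k + 12) := Nat.pow_le_pow_right (by omega) (by omega)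
  calc lengthBound D k ≤ D ^ (10 * k + 12) * 2 := by unfold lengthBound; omega
    _ ≤ D ^ (10 * k + 12) * D := by gcongr
    _ = D ^ (10 * k + 13) := by ring
    _ ≤ D ^ (23 * k) := Nat.pow_le_pow_right (by omega) (by omega)

/-- The number of steps, if the search is not over at once. -/
theorem steps_le {n m k D : ℕ} (hD : 2 ≤ D) (hk : 1 ≤ k) (hm : 1 ≤ m) (hn : 1 ≤ n) :
    5 * n + n * rootCost m D + lengthBound D k * searchCost n m k D + 8 ≤
      1000 * D ^ (48 * k ^ 2) * (n * m) := by
  have hB := lengthBound_le hD hk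
  have hk2 : k ≤ k ^ 2 := by nlinarith
  have h3 : k ≤ D ^ k := Nat.lt_pow_self (by omega) |>.le
  have hnm : n ≤ n * m := Nat.le_mul_of_pos_right n hm
  have hnm1 : 1 ≤ n * m := Nat.mul_pos hn hm
  have h4 : (n + 1) * (140 * m + 70) ≤ 420 * (n * m) := by nlinarith
  have h5 : lengthBound D k ^ k + 1 ≤ D ^ (23 * k ^ 2 + 1) := by
    have h6 : lengthBound D k ^ k ≤ D ^ (23 * k ^ 2) := by
      calc lengthBound D k ^ k ≤ (D ^ (23 * k)) ^ k := Nat.pow_le_pow_left hB k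
        _ = D ^ (23 * k ^ 2) := by rw [← pow_mul]; ring_nf
    have := Nat.pow_pos (n := 23 * k ^ 2) (show 0 < D by omega)
    rw [pow_succ D]
    nlinarith
  have h7 : lengthBound D k * searchCost n m k D ≤ 420 * D ^ (48 * k ^ 2) * (n * m) := by
    calc lengthBound D k * searchCost n m k D
        ≤ D ^ (23 * k) * (D ^ (23 * k ^ 2 + 1) * (D ^ k * (420 * (n * m)))) := by
          unfold searchCost; gcongr
      _ = 420 * D ^ (23 * k + (23 * k ^ 2 + 1) + k) * (n * m) := by ring
      _ ≤ 420 * D ^ (48 * k ^ 2) * (n * m) := by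
          gcongr
          · omega
          · nlinarith
  have h8 : D + 2 ≤ D ^ (48 * k ^ 2) := by
    calc D + 2 ≤ D ^ 2 := by nlinarith
      _ ≤ D ^ (48 * k ^ 2) := Nat.pow_le_pow_right (by omega) (by nlinarith)
  have h9 : n * rootCost m D ≤ 134 * D ^ (48 * k ^ 2) * (n * m) := by
    have h10 : 62 * m + 62 ≤ 124 * m := by omega
    calc n * rootCost m D ≤ n * (D ^ (48 * k ^ 2) * (124 * m) + D ^ (48 * k ^ 2) * (10 * m)) := by
          unfold rootCost; gcongr; nlinarith
      _ = 134 * D ^ (48 * k ^ 2) * (n * m) := by ring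
  nlinarith

end WordRAM

theorem theorem2 :
    ∃ (P : WordRAM.Prog) (c C : ℕ), ∀ (α β : ℝ), 1 ≤ α → 0 ≤ β →
      ∀ (n m k : ℕ) (G : SimpleGraph (Fin n)) (e : Fin m → Fin n × Fin n),
        Spanner.IsEdgeListing G e → 1 ≤ k →
        ∀ w : ℕ, (n + m + k + 2) ^ c ≤ 2 ^ w →
          ∃ (T : ℕ) (s : WordRAM.State),
            WordRAM.Exec (2 ^ w) α β P (WordRAM.input e k) T s ∧
            WordRAM.IsCorrectAnswer α β G e k s ∧
            (T : ℝ) ≤ (C : ℝ) * (α + β) ^ ((C : ℝ) * ((k : ℝ) ^ 2 + (α + β) * (k : ℝ))) *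
              ((n : ℝ) * (m : ℝ) + 1) := by
  refine ⟨WordRAM.spannerProg, 2, 1000, ?_⟩
  intro α β hα hβ n m k G e hG hk w hw
  have hW : 2 * (n + m + k + 2) ≤ 2 ^ w := by nlinarith
  obtain ⟨T, s, h1, h2, h3⟩ := WordRAM.run_spannerProg hα hβ hG hk hW
  refine ⟨T, s, h1, h2, ?_⟩
  have hαβ : 1 ≤ α + β := by linarith
  have hk0 : (0 : ℝ) ≤ k := Nat.cast_nonneg k
  have hnm : (0 : ℝ) ≤ (n : ℝ) * m := by positivity
  rcases h3 with h3 | ⟨hD, hkm, h3⟩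
  · have h4 : (1 : ℝ) ≤ (α + β) ^ (((1000 : ℕ) : ℝ) * ((k : ℝ) ^ 2 + (α + β) * (k : ℝ))) :=
      Real.one_le_rpow hαβ (by positivity)
    have h5 : (T : ℝ) ≤ 3 := by exact_mod_cast h3
    push_cast at h4 ⊢
    nlinarith
  · have hn : 1 ≤ n := by
      have := (e ⟨0, by omega⟩).1.2
      omega
    have h4 := h3.trans (WordRAM.steps_le hD hk (hk.trans hkm) hn)
    have h5 : (T : ℝ) ≤ 1000 * (⌊α + β⌋₊ : ℝ) ^ (48 * k ^ 2) * ((n : ℝ) * m) := by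
      exact_mod_cast h4
    have h6 : (⌊α + β⌋₊ : ℝ) ^ (48 * k ^ 2) ≤
        (α + β) ^ (((1000 : ℕ) : ℝ) * ((k : ℝ) ^ 2 + (α + β) * (k : ℝ))) := by
      calc (⌊α + β⌋₊ : ℝ) ^ (48 * k ^ 2) ≤ (α + β) ^ (48 * k ^ 2) := by
            gcongr; exact Nat.floor_le (by linarith)
        _ = (α + β) ^ (((48 * k ^ 2 : ℕ) : ℝ)) := (Real.rpow_natCast _ _).symm
        _ ≤ _ := by
            refine Real.rpow_le_rpow_of_exponent_le hαβ ?_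
            push_cast
            nlinarith [mul_nonneg (by linarith : (0 : ℝ) ≤ α + β) hk0]
    calc (T : ℝ) ≤ 1000 * (⌊α + β⌋₊ : ℝ) ^ (48 * k ^ 2) * ((n : ℝ) * m) := h5
      _ ≤ ((1000 : ℕ) : ℝ) * (α + β) ^ (((1000 : ℕ) : ℝ) * ((k : ℝ) ^ 2 + (α + β) * (k : ℝ))) *
          ((n : ℝ) * m + 1) := by
          push_cast at h6 ⊢
          gcongr
          linarith
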